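/- **Setting.** Let $\mathbf x(t)=(x_1(t),\dots,x_M(t))^T$ be real, zero-mean, finite-variance, jointly wide-sense stationary processes with (integrable, positive semidefinite) power spectral density matrix $C_x(f)\in\mathbb C^{M\times M}$, so $\mathbb E[x_i(t+\tau)x_j(t)]=\int [C_x(f)]_{ij}e^{j2\pi f\tau}\,df$. Let $\mathbf s\in\mathbb R^N$ be a zero-mean, finite-variance random vector (the task) whose MMSE estimate from the inputs is linear: $\tilde{\mathbf s}=\mathbb E[\mathbf s\mid \mathbf x]=(\Gamma*\mathbf x)(0)$ for a real multivariate filter with frequency response $\Gamma(f)\in\mathbb C^{N\times M}$. An acquisition system with $K\ge 1$ ADCs, sampling rate $f_s=1/T_s>0$, $b\ge1$ bits and dynamic-range parameter $\eta>0$, where $\frac{2\eta^2}{3\cdot 2^{2b}}<1$, works as follows. A real analog filter with frequency response $H(f)\in\mathbb C^{K\times M}$ and finite-variance outputs produces $\mathbf y(t)=(H*\mathbf x)(t)$, which is sampled as $y_k[n]=T_s\,y_k(nT_s)$. (Filtering is understood in the mean-square sense: $H*\mathbf x$ is the mean-square limit of outputs of tapped delay lines whose responses converge to $H$ in the norm $(\int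 hC_xh^H df)^{1/2}$ of each row $h$.) The samples are quantized by identical mid-rise $b$-bit quantizers $q_b$ with dynamic range $\gamma>0$ and step $\Delta=2\gamma/2^b$: $z_k[n]=q_b(y_k[n]+w_k[n])$, where the dither $w$ is i.i.d. in time and space with triangular density of width $2\Delta$, independent of the inputs and the task, $\gamma^2=\eta^2\max_k\mathbb E[(y_k[n]+w_k[n])^2]$, and there is no overload: $\Pr(|y_k[n]+w_k[n]|\ge\gamma)=0$. Alternatively the quantizers follow the equivalent additive model $z_k[n]=y_k[n]+e_k[n]$ with $e$ uncorrelated with the inputs and the task, $\mathbb E[e_k[n]e_{k'}[n']]=\frac{\Delta^2}{4}\delta_{kk'}\delta_{nn'}$ and $\gamma^2=\eta^2\max_k(\mathbb E[y_k[n]^2]+\Delta^2/6)$. The task is recovered by a linear digital filter, $\hat{\mathbf s}=\sum_{n\in\mathbb Z}G[-n]\,\mathbf z[n]$ with $G[n]\in\mathbb R^{N\times K}$ (mean-square convergence). The MSE of an analog filter $H$ is $\inf_G\mathbb E\|\mathbf s-\hat{\mathbf s}\|^2$, or, relative to the MMSE estimate, $\inf_G\mathbb E\|\tilde{\mathbf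 s}-\hat{\mathbf s}\|^2$. **Statement.** Suppose that the inputs are bandlimited and sampled at least at the Nyquist rate: $C_x(f)=0$ for all $|f|>f_s/2$. Put $\bar\Gamma(f)=\Gamma(f)C_x^{1/2}(f)$, with singular values $\sigma_{1}(f)\ge\sigma_2(f)\ge\dots$ (padded by zeros), and $\bar\kappa=\eta^2\bigl(1-\frac{2\eta^2}{3\cdot2^{2b}}\bigr)^{-1}$. Let, as measurable functions of $f$ and for almost every $f\in[-\frac{f_s}2,\frac{f_s}2]$, - $\bar V_H(f)\in\mathbb C^{M\times M}$ be a unitary matrix of right-singular vectors of $\bar\Gamma(f)$, ordered by descending singular values; - $\bar\Sigma_H(f)\in\mathbb R^{K\times M}$ be diagonal with $[\bar\Sigma_H(f)]_{ii}=2^{-b}\sqrt{(\zeta\sigma_i(f)-1)^+}$, where the constant $\zeta$ satisfies $$\frac{\bar\kappa T_s}{K}\int_{-f_s/2}^{f_s/2}\sum_{i=1}^{\min(K,M)}[\bar\Sigma_H(f)]_{ii}^2\,df=1;$$ - $\bar U_H(f)\in\mathbb C^{K\times K}$ be unitary such that all diagonal entries of $\bar U_H\bar\Sigma_H\bar\Sigma_H^H\bar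 U_H^H$ at $f$ are equal; and let them be chosen so that $$H^{\mathrm o}(f)=\bar U_H(f)\,\bar\Sigma_H(f)\,\bar V_H^H(f)\,\bigl(C_x^{1/2}(f)\bigr)^{\dagger}$$ is the response of a real filter, i.e. $H^{\mathrm o}(-f)=H^{\mathrm o}(f)^*$ (entrywise conjugate) for almost every $f$; here $(\cdot)^\dagger$ is the Moore–Penrose pseudo-inverse. Then $H^{\mathrm o}$ is a real analog filter with finite-variance outputs and it minimizes the MSE (in both senses above) among all such analog filters $H(f)\in\mathbb C^{K\times M}$, for the fixed configuration $(K,f_s,b)$. Moreover, such $\zeta,\bar U_H,\bar V_H$ exist whenever $\bar\Gamma$ is not almost everywhere zero. -/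

import Mathlib

open MeasureTheory ProbabilityTheory Filter Topology
open scoped ComplexOrder MatrixOrder

namespace TaskADC

/-! ### Linear algebra -/

section LinearAlgebra

/-- The four Penrose equations: `X` is the Moore–Penrose pseudo-inverse of `A`. -/
structure IsMoorePenrose {m n : ℕ} (A : Matrix (Fin m) (Fin n) ℂ)
    (X : Matrix (Fin n) (Fin m) ℂ) : Prop where
  mul_mul_self : A * X * A = A
  self_mul_mul : X * A * X = X
  left_hermitian : (A * X).conjTranspose = A * X
  right_hermitian : (X * A).conjTranspose = X * A

theorem exists_isMoorePenrose {m n : ℕ} (A : Matrix (Fin m) (Fin n) ℂ) :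
    ∃ X, IsMoorePenrose A X := by
  set B : Matrix (Fin n) (Fin n) ℂ := A.conjTranspose * A with hB
  have hBsa : IsSelfAdjoint B := Matrix.isHermitian_conjTranspose_mul_self A
  have hcont : ∀ g : ℝ → ℝ, ContinuousOn g (spectrum ℝ B) :=
    fun g => (Matrix.finite_real_spectrum (A := B)).continuousOn g
  set Y : Matrix (Fin n) (Fin n) ℂ := cfc (fun t : ℝ => t⁻¹) B with hY
  have hYB : Y * B = cfc (fun t : ℝ => t⁻¹ * t) B := by
    conv_lhs => rw [← cfc_id ℝ B]
    rw [hY, cfc_id ℝ B, cfc_mul (fun t : ℝ => t⁻¹) (fun t => t) B (hcont _) (hcont _)]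
    rw [cfc_id' ℝ B]
  have hYs : Y.conjTranspose = Y := cfc_predicate (p := IsSelfAdjoint) (fun t : ℝ => t⁻¹) B
  have hYBs : (Y * B).conjTranspose = Y * B := by
    rw [hYB]; exact cfc_predicate (p := IsSelfAdjoint) (fun t : ℝ => t⁻¹ * t) B
  have hBYB : B * (Y * B) = B := by
    have h1 : cfc (fun t : ℝ => t * (t⁻¹ * t)) B = B := by
      conv_rhs => rw [← cfc_id' ℝ B]
      refine cfc_congr fun t _ => ?_
      by_cases h : t = 0
      · simp [h]
      · field_simp
    rw [cfc_mul (fun t : ℝ => t) (fun t : ℝ => t⁻¹ * t) B (hcont _) (hcont _), cfc_id' ℝ B,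
      ← hYB] at h1
    exact h1
  have hYBY : Y * B * Y = Y := by
    rw [hYB, hY, ← cfc_mul (fun t : ℝ => t⁻¹ * t) (fun t : ℝ => t⁻¹) B (hcont _) (hcont _)]
    congr 1
    funext t
    by_cases h : t = 0
    · simp [h]
    · field_simp
  have hA : A * (Y * B) = A := by
    have h0 : A.conjTranspose * A * (Y * B - 1) = 0 := by
      rw [Matrix.mul_sub, ← hB, hBYB, Matrix.mul_one, sub_self]
    have h1 := (Matrix.conjTranspose_mul_self_mul_eq_zero A (Y * B - 1)).1 h0
    rw [Matrix.mul_sub, Matrix.mul_one, sub_eq_zero] at h1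
    exact h1
  refine ⟨Y * A.conjTranspose, ?_, ?_, ?_, ?_⟩
  · rw [Matrix.mul_assoc, Matrix.mul_assoc, ← hB, hA]
  · rw [Matrix.mul_assoc Y, ← hB, ← Matrix.mul_assoc, hYBY]
  · rw [Matrix.conjTranspose_mul, Matrix.conjTranspose_mul, Matrix.conjTranspose_conjTranspose,
      hYs, Matrix.mul_assoc]
  · rw [Matrix.mul_assoc, ← hB, hYBs]

theorem IsMoorePenrose.unique {m n : ℕ} {A : Matrix (Fin m) (Fin n) ℂ}
    {X Y : Matrix (Fin n) (Fin m) ℂ} (hX : IsMoorePenrose A X) (hY : IsMoorePenrose A Y) :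
    X = Y := by
  have h1 : A * X = A * Y := by
    calc A * X = (A * X).conjTranspose := hX.left_hermitian.symm
      _ = (A * Y * A * X).conjTranspose := by rw [hY.mul_mul_self]
      _ = (A * X).conjTranspose * (A * Y).conjTranspose := by
        rw [Matrix.mul_assoc (A * Y) A X, Matrix.conjTranspose_mul (A * Y)]
      _ = A * X * (A * Y) := by rw [hX.left_hermitian, hY.left_hermitian]
      _ = A * X * A * Y := by simp only [Matrix.mul_assoc]
      _ = A * Y := by rw [hX.mul_mul_self]
  have h2 : X * A = Y * A := by
    calc X * A = (X * A).conjTranspose := hX.right_hermitian.symm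
      _ = (X * (A * Y * A)).conjTranspose := by rw [hY.mul_mul_self]
      _ = (X * A * (Y * A)).conjTranspose := by simp only [Matrix.mul_assoc]
      _ = (Y * A).conjTranspose * (X * A).conjTranspose := by
        rw [Matrix.conjTranspose_mul (X * A)]
      _ = Y * A * (X * A) := by rw [hX.right_hermitian, hY.right_hermitian]
      _ = Y * (A * X * A) := by simp only [Matrix.mul_assoc]
      _ = Y * A := by rw [hX.mul_mul_self]
  calc X = X * A * X := hX.self_mul_mul.symm
    _ = Y * (A * X) := by rw [h2, Matrix.mul_assoc]
    _ = Y * A * Y := by rw [h1, Matrix.mul_assoc]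
    _ = Y := hY.self_mul_mul

/-- The Moore–Penrose pseudo-inverse `A†`. -/
noncomputable def pinv {m n : ℕ} (A : Matrix (Fin m) (Fin n) ℂ) : Matrix (Fin n) (Fin m) ℂ :=
  (exists_isMoorePenrose A).choose

theorem pinv_spec {m n : ℕ} (A : Matrix (Fin m) (Fin n) ℂ) : IsMoorePenrose A (pinv A) :=
  (exists_isMoorePenrose A).choose_spec

/-- The singular values of `A` in descending order, counted from `0`, padded by zeros. -/
noncomputable def sval {m n : ℕ} (A : Matrix (Fin m) (Fin n) ℂ) (i : ℕ) : ℝ :=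
  (Matrix.toEuclideanLin A).singularValues i

/-- `V` is a (full, `n × n`) matrix of right-singular vectors of `A`: it is unitary and its `i`th
column is a right-singular vector for the `i`th largest singular value. -/
def IsRightSingularMatrix {m n : ℕ} (A : Matrix (Fin m) (Fin n) ℂ)
    (V : Matrix (Fin n) (Fin n) ℂ) : Prop :=
  V ∈ Matrix.unitaryGroup (Fin n) ℂ ∧
    A.conjTranspose * A * V = V * Matrix.diagonal (fun i : Fin n => ((sval A i ^ 2 : ℝ) : ℂ))

end LinearAlgebra

section Signals

variable {Ω : Type*} [MeasurableSpace Ω]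

/-! ### Jointly wide-sense stationary inputs and their filters -/

/-- Frequency responses of real filters: `H(-f) = H(f)^*` (entrywise complex conjugate) for almost
every frequency. -/
def ConjSymm {m n : ℕ} (H : ℝ → Matrix (Fin m) (Fin n) ℂ) : Prop :=
  ∀ᵐ f : ℝ, H (-f) = (H f).map (starRingEnd ℂ)

/-- The real processes `x₁, …, x_M` have zero mean and finite variance, are jointly wide-sense
stationary, and have joint power spectral density (PSD) matrix `C`:
`E[x_i(t+τ) x_j(t)] = ∫ C_{ij}(f) e^{j2πfτ} df`. -/
structure IsWSSWithPSD {M : ℕ} (P : Measure Ω) (x : Fin M → ℝ → Ω → ℝ)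
    (C : ℝ → Matrix (Fin M) (Fin M) ℂ) : Prop where
  measurable : ∀ m t, Measurable (x m t)
  memLp : ∀ m t, MemLp (x m t) 2 P
  mean_zero : ∀ m t, ∫ ω, x m t ω ∂P = 0
  posSemidef : ∀ f, (C f).PosSemidef
  conjSymm : ConjSymm C
  integrable : ∀ i j, Integrable (fun f => C f i j)
  autocorrelation : ∀ i j t τ, ((∫ ω, x i (t + τ) ω * x j t ω ∂P : ℝ) : ℂ) =
    ∫ f : ℝ, C f i j * Complex.exp (2 * Real.pi * Complex.I * f * τ)

/-- The value `h C h^H` for a row vector `h` and a positive semidefinite matrix `C`: if `h` is a row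
of a frequency response at frequency `f` and `C` the input PSD at `f`, it is the output PSD. -/
noncomputable def outPSD {M : ℕ} (C : Matrix (Fin M) (Fin M) ℂ) (h : Fin M → ℂ) : ℝ :=
  (∑ i, ∑ j, h i * C i j * starRingEnd ℂ (h j)).re

/-- `H` is the frequency response of a real multivariate filter whose outputs have finite variance
when the inputs have PSD matrix `C`. -/
structure IsAnalogFilter {K M : ℕ} (C : ℝ → Matrix (Fin M) (Fin M) ℂ)
    (H : ℝ → Matrix (Fin K) (Fin M) ℂ) : Prop where
  measurable : ∀ k m, AEStronglyMeasurable (fun f => H f k m) volume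
  conjSymm : ConjSymm H
  finite_variance : ∀ k, Integrable (fun f => outPSD (C f) (H f k))

/-- The frequency response of the tapped delay line with impulse response
`∑ c(m,τ) δ(· - τ)` on channel `m`. -/
noncomputable def tapResponse {M : ℕ} (c : (Fin M × ℝ) →₀ ℝ) (f : ℝ) (m : Fin M) : ℂ :=
  c.sum fun p a => if p.1 = m then (a : ℂ) * Complex.exp (-(2 * Real.pi * Complex.I * f * p.2))
    else 0

/-- The output at time `t` of the same tapped delay line. -/
noncomputable def tapOutput {M : ℕ} (x : Fin M → ℝ → Ω → ℝ) (c : (Fin M × ℝ) →₀ ℝ) (t : ℝ)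
    (ω : Ω) : ℝ :=
  c.sum fun p a => a * x p.1 (t - p.2) ω

/-- `Y = (h * x)(t)`, where `h` is given through its frequency response (a row vector for each
frequency): the convolution, extended in mean square. `Y` is the mean-square limit of outputs at
time `t` of tapped delay lines whose frequency responses converge to `h` in the norm
`(∫ h C h^H df)^{1/2}`, which is the standard deviation of the output. -/
def IsFilteredAt {M : ℕ} (P : Measure Ω) (x : Fin M → ℝ → Ω → ℝ)
    (C : ℝ → Matrix (Fin M) (Fin M) ℂ) (h : ℝ → Fin M → ℂ) (t : ℝ) (Y : Ω → ℝ) : Prop :=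
  MemLp Y 2 P ∧ ∀ ε : ℝ, 0 < ε → ∃ c : (Fin M × ℝ) →₀ ℝ,
    (∫ f : ℝ, outPSD (C f) (fun m => h f m - tapResponse c f m)) ≤ ε ∧
    (∫ ω, (Y ω - tapOutput x c t ω) ^ 2 ∂P) ≤ ε

/-- `y₁, …, y_K` are the outputs of the multivariate filter `H` driven by `x`. -/
def IsFilterOutput {K M : ℕ} (P : Measure Ω) (x : Fin M → ℝ → Ω → ℝ)
    (C : ℝ → Matrix (Fin M) (Fin M) ℂ) (H : ℝ → Matrix (Fin K) (Fin M) ℂ)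
    (y : Fin K → ℝ → Ω → ℝ) : Prop :=
  ∀ k t, IsFilteredAt P x C (fun f => H f k) t (y k t)

/-- Uniform sampling: `y_k[n] = T_s y_k(n T_s)` with `T_s = 1 / f_s`. -/
noncomputable def sampled {K : ℕ} (fs : ℝ) (y : Fin K → ℝ → Ω → ℝ) (k : Fin K) (n : ℤ)
    (ω : Ω) : ℝ :=
  1 / fs * y k (n * (1 / fs)) ω

/-- The σ-algebra generated by the inputs. -/
abbrev inputSigma {M : ℕ} (x : Fin M → ℝ → Ω → ℝ) : MeasurableSpace Ω :=
  ⨆ m, ⨆ t, MeasurableSpace.comap (x m t) inferInstance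

/-! ### Quantization -/

/-- Quantization step size `Δ = 2γ / 2^b`. -/
noncomputable def stepSize (b : ℕ) (γ : ℝ) : ℝ := 2 * γ / 2 ^ b

open Classical in
/-- Mid-rise uniform quantizer with `b` bits and dynamic range `γ`. -/
noncomputable def midRise (b : ℕ) (γ r : ℝ) : ℝ :=
  if |r| < γ then stepSize b γ * (⌊r / stepSize b γ⌋ + 1 / 2)
  else Real.sign r * (γ - stepSize b γ / 2)

open Classical in
/-- Triangular probability density of width `2Δ`. -/
noncomputable def ditherPdf (Δ r : ℝ) : ℝ :=
  if |r| ≤ Δ then 1 / Δ * (1 - |r| / Δ) else 0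

/-- `z` is obtained from the samples `y` by nonsubtractive dithered quantization without overload.
The dither `w` is i.i.d. in time and space with triangular density, independent of the inputs and
the task; the dynamic range is `η` times the largest standard deviation of the quantizer inputs
`y + w`; and these inputs almost surely stay within the dynamic range. -/
def IsDitheredQuantization {K M N : ℕ} (P : Measure Ω) (x : Fin M → ℝ → Ω → ℝ)
    (s : Fin N → Ω → ℝ) (b : ℕ) (η : ℝ) (y z : Fin K → ℤ → Ω → ℝ) : Prop :=
  ∃ (γ : ℝ) (w : Fin K → ℤ → Ω → ℝ), 0 < γ ∧
    (∀ k n, Measurable (w k n)) ∧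
    (∀ k n, P.map (w k n) =
      volume.withDensity fun r => ENNReal.ofReal (ditherPdf (stepSize b γ) r)) ∧
    iIndepFun (fun p : Fin K × ℤ => w p.1 p.2) P ∧
    Indep (⨆ k, ⨆ n, MeasurableSpace.comap (w k n) inferInstance)
      (inputSigma x ⊔ ⨆ i, MeasurableSpace.comap (s i) inferInstance) P ∧
    (∀ n, γ ^ 2 = η ^ 2 * ⨆ k, ∫ ω, (y k n ω + w k n ω) ^ 2 ∂P) ∧
    (∀ k n, P {ω | γ ≤ |y k n ω + w k n ω|} = 0) ∧
    ∀ k n ω, z k n ω = midRise b γ (y k n ω + w k n ω)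

/-- The equivalent (additive) quantizer model: `z = y + e` with an error `e` that is uncorrelated
with the inputs and the task and white over time and space with variance `Δ² / 4`. The dynamic
range is again `η` times the largest standard deviation of the dithered quantizer inputs, the
triangular dither having variance `Δ² / 6`. -/
def IsEquivalentQuantization {K M N : ℕ} (P : Measure Ω) (x : Fin M → ℝ → Ω → ℝ)
    (s : Fin N → Ω → ℝ) (b : ℕ) (η : ℝ) (y z : Fin K → ℤ → Ω → ℝ) : Prop :=
  ∃ (γ : ℝ) (e : Fin K → ℤ → Ω → ℝ), 0 < γ ∧
    (∀ k n, MemLp (e k n) 2 P) ∧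
    (∀ k n m t, ∫ ω, e k n ω * x m t ω ∂P = 0) ∧
    (∀ k n i, ∫ ω, e k n ω * s i ω ∂P = 0) ∧
    (∀ k n k' n', ∫ ω, e k n ω * e k' n' ω ∂P =
      if k = k' ∧ n = n' then stepSize b γ ^ 2 / 4 else 0) ∧
    (∀ n, γ ^ 2 = η ^ 2 * ⨆ k, ((∫ ω, y k n ω ^ 2 ∂P) + stepSize b γ ^ 2 / 6)) ∧
    ∀ k n ω, z k n ω = y k n ω + e k n ω

/-- `z` is a digital output of the acquisition front end (analog filter `H`, uniform samplers with
rate `fs`, `b`-bit quantizers with dynamic range parameter `η`), the quantizers being non-overloaded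
dithered quantizers or following the equivalent model. -/
def IsFrontEndOutput {K M N : ℕ} (P : Measure Ω) (x : Fin M → ℝ → Ω → ℝ)
    (C : ℝ → Matrix (Fin M) (Fin M) ℂ) (s : Fin N → Ω → ℝ) (fs : ℝ) (b : ℕ) (η : ℝ)
    (H : ℝ → Matrix (Fin K) (Fin M) ℂ) (z : Fin K → ℤ → Ω → ℝ) : Prop :=
  ∃ y : Fin K → ℝ → Ω → ℝ, IsFilterOutput P x C H y ∧
    (IsDitheredQuantization P x s b η (sampled fs y) z ∨
      IsEquivalentQuantization P x s b η (sampled fs y) z)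

/-! ### Linear digital recovery and its mean-squared error -/

/-- `ŝ = ∑ₙ G[-n] z[n]`, the series converging in mean square. -/
def IsLinearEstimate {K N : ℕ} (P : Measure Ω) (G : ℤ → Matrix (Fin N) (Fin K) ℝ)
    (z : Fin K → ℤ → Ω → ℝ) (shat : Fin N → Ω → ℝ) : Prop :=
  ∀ i, MemLp (shat i) 2 P ∧
    Tendsto (fun L : ℕ => eLpNorm (fun ω => shat i ω -
      ∑ n ∈ Finset.Icc (-(L : ℤ)) L, ∑ k, G (-n) i k * z k n ω) 2 P) atTop (𝓝 0)

/-- The least mean-squared error `E‖v - ŝ‖²` in estimating the vector `v` from `z` by linear digital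
filters: the infimum over all filters `G[n]`. -/
noncomputable def mse {K N : ℕ} (P : Measure Ω) (v : Fin N → Ω → ℝ) (z : Fin K → ℤ → Ω → ℝ) : ℝ :=
  sInf {r : ℝ | ∃ (G : ℤ → Matrix (Fin N) (Fin K) ℝ) (shat : Fin N → Ω → ℝ),
    IsLinearEstimate P G z shat ∧ r = ∫ ω, ∑ i, (v i ω - shat i ω) ^ 2 ∂P}

end Signals

/-! ### The optimal filter -/

section Optimal

/-- `Γ̄(f) = Γ(f) C^{1/2}(f)`. -/
noncomputable def gammaBar {N M : ℕ} (C : ℝ → Matrix (Fin M) (Fin M) ℂ)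
    (Γ : ℝ → Matrix (Fin N) (Fin M) ℂ) (f : ℝ) : Matrix (Fin N) (Fin M) ℂ :=
  Γ f * CFC.sqrt (C f)

/-- The water-filling diagonal entry `2^{-b} √((ζ σ - 1)⁺)`. -/
noncomputable def waterLevel (b : ℕ) (ζ σ : ℝ) : ℝ :=
  1 / 2 ^ b * Real.sqrt (max (ζ * σ - 1) 0)

/-- The `K × M` diagonal matrix with the water-filling entries for the singular values of `A`. -/
noncomputable def sigmaH {N M : ℕ} (K b : ℕ) (ζ : ℝ) (A : Matrix (Fin N) (Fin M) ℂ) :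
    Matrix (Fin K) (Fin M) ℂ :=
  Matrix.of fun i j => if (i : ℕ) = j then (waterLevel b ζ (sval A i) : ℂ) else 0

/-- `κ̄ = η² (1 - 2η² / (3 · 2^{2b}))⁻¹`. -/
noncomputable def kappaBar (b : ℕ) (η : ℝ) : ℝ :=
  η ^ 2 * (1 - 2 * η ^ 2 / (3 * 2 ^ (2 * b)))⁻¹

/-- The conditions on the factors `Ū_H`, `Σ̄_H` (through `ζ`) and `V̄_H` of the optimal filter, for
almost every frequency of the band `[-f_s/2, f_s/2]`. -/
structure IsOptimalFactors {N M K : ℕ} (fs : ℝ) (b : ℕ) (η : ℝ)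
    (A : ℝ → Matrix (Fin N) (Fin M) ℂ) (ζ : ℝ) (U : ℝ → Matrix (Fin K) (Fin K) ℂ)
    (V : ℝ → Matrix (Fin M) (Fin M) ℂ) : Prop where
  measurable_U : ∀ i j, AEStronglyMeasurable (fun f => U f i j)
    (volume.restrict (Set.Icc (-(fs / 2)) (fs / 2)))
  measurable_V : ∀ i j, AEStronglyMeasurable (fun f => V f i j)
    (volume.restrict (Set.Icc (-(fs / 2)) (fs / 2)))
  rightSingular : ∀ᵐ f ∂(volume.restrict (Set.Icc (-(fs / 2)) (fs / 2))),
    IsRightSingularMatrix (A f) (V f)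
  unitary_U : ∀ᵐ f ∂(volume.restrict (Set.Icc (-(fs / 2)) (fs / 2))),
    U f ∈ Matrix.unitaryGroup (Fin K) ℂ
  equal_diagonal : ∀ᵐ f ∂(volume.restrict (Set.Icc (-(fs / 2)) (fs / 2))), ∀ i j,
    (U f * sigmaH K b ζ (A f) * (sigmaH K b ζ (A f)).conjTranspose * (U f).conjTranspose) i i =
      (U f * sigmaH K b ζ (A f) * (sigmaH K b ζ (A f)).conjTranspose * (U f).conjTranspose) j j
  normalization : kappaBar b η * (1 / fs) / K *
    (∫ f in (-(fs / 2))..(fs / 2), ∑ i ∈ Finset.range (min K M), waterLevel b ζ (sval (A f) i) ^ 2)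
      = 1

/-- `H°(f) = Ū_H(f) Σ̄_H(f) V̄_H(f)^H (C^{1/2}(f))†`. -/
noncomputable def optFilter {N M K : ℕ} (C : ℝ → Matrix (Fin M) (Fin M) ℂ)
    (Γ : ℝ → Matrix (Fin N) (Fin M) ℂ) (b : ℕ) (ζ : ℝ) (U : ℝ → Matrix (Fin K) (Fin K) ℂ)
    (V : ℝ → Matrix (Fin M) (Fin M) ℂ) (f : ℝ) : Matrix (Fin K) (Fin M) ℂ :=
  U f * sigmaH K b ζ (gammaBar C Γ f) * (V f).conjTranspose * pinv (CFC.sqrt (C f))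

end Optimal

end TaskADC

/-! The problem reduces to one matrix optimization per frequency, coupled only through a power
budget. Lagrangian duality solves it.

Triangular dither without overload makes the quantizer error centred, white, of variance Δ²/4 and
uncorrelated with the inputs and the task (`IsDitheredQuantization.isEquivalentQuantization`), so
both quantizer models become additive noise. The range γ depends on the noise it creates. Solving
that linear equation for γ² gives a noise variance σ2 proportional to the power of the strongest
channel, max_k ∫ h_k C h_kᴴ (`IsFrontEndOutput.exists_isAdditiveModel`). The MMSE residual is
orthogonal to all data, so estimating `s` and estimating `st` differ by a constant independent of
the front end (`IsAdditiveModel.mse_eq`).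

Since the inputs are bandlimited there is no aliasing, and a digital filter acts as a trigonometric
polynomial g(f) on one period. With A = Γ C^{1/2}, B = H C^{1/2} and ν = σ2 f_s, its error is ∫ ‖A -
g B‖² + ν ‖g‖² over the band, in Frobenius norms
(`IsAdditiveModel.sum_integral_sub_truncEstimate_sq`).

Lower bound: for every τ the integrand is at least ‖A‖² - ∑ ((σ_i - τ)⁺)² - (τ²/ν) ‖B‖², the sum
running over the min(K, M) largest singular values of A (`soft_threshold_le`,
`thresholdedError_le`). The total power ∫ ‖B‖² is at most K times that of the strongest channel, to
which ν is proportional. Hence the integrated penalty is at most τ² times a constant free of H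
(`IsAdditiveModel.lower_bound`).

Attainment: take τ = 1/ζ. For H° the equal diagonals give all channels the same power, the
normalization makes ν = 4^{-b}, and the water-filling singular values with the matching Wiener
filter give equality at almost every frequency (`water_filling_attains`). That Wiener filter need
not be a trigonometric polynomial. Density of these in a weighted L² space, together with passing to
real parts of coefficients, shows that the infimum over real digital filters does not exceed its
error (`IsAdditiveModel.mse_le`).

Existence of the factors: singular vectors are chosen measurably and extended by conjugate symmetry,
a Fourier matrix equalizes the diagonals, and ζ comes from the intermediate value theorem
(`exists_isOptimalFactors`). -/

namespace TaskADC

/-! ### Measurable selection from closed relations with compact values -/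

section Selection

/-- A closed relation with values in a compact subset of `ℝ^d` has a Borel measurable selection
on its domain: take the lexicographic minimum. -/
theorem exists_measurable_selection_fin (d : ℕ) : ∀ {X : Type} [TopologicalSpace X]
    [SecondCountableTopology X] [MeasurableSpace X] [BorelSpace X]
    (K : Set (Fin d → ℝ)) (_ : IsCompact K) (S : Set (X × (Fin d → ℝ))) (_ : IsClosed S)
    (_ : ∀ p ∈ S, p.2 ∈ K),
    ∃ g : X → Fin d → ℝ, Measurable g ∧ ∀ x, (∃ y, (x, y) ∈ S) → (x, g x) ∈ S := by
  induction d with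
  | zero =>
    intro X _ _ _ _ K hK S hS hSK
    refine ⟨fun _ => 0, measurable_const, ?_⟩
    rintro x ⟨y, hy⟩
    convert hy
  | succ d ih =>
    intro X _ _ _ _ K hK S hS hSK
    -- Projection along a compact factor is a closed map; the domain of `S` and the sublevel sets of
    -- `m` are such projections.
    have hproj : ∀ T : Set (X × (Fin (d + 1) → ℝ)), IsClosed T → (∀ p ∈ T, p.2 ∈ K) →
        IsClosed (Prod.fst '' T) := by
      intro T hT hTK
      have : CompactSpace K := isCompact_iff_compactSpace.1 hK
      have h1 : IsClosed ((fun p : X × K => (p.1, (p.2 : Fin (d + 1) → ℝ))) ⁻¹' T) :=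
        hT.preimage (by fun_prop)
      convert isClosedMap_fst_of_compactSpace _ h1 using 1
      ext x
      constructor
      · rintro ⟨⟨a, y⟩, hy, rfl⟩
        exact ⟨(a, ⟨y, hTK _ hy⟩), hy, rfl⟩
      · rintro ⟨⟨a, y⟩, hy, rfl⟩
        exact ⟨(a, y), hy, rfl⟩
    set m : X → ℝ := fun x => sInf {c | ∃ y, (x, y) ∈ S ∧ y 0 = c} with hm
    have hcomp : ∀ x, IsCompact {c | ∃ y, (x, y) ∈ S ∧ y 0 = c} := by
      intro x
      have h1 : IsClosed {y | (x, y) ∈ S} := hS.preimage (by fun_prop)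
      have h2 : IsCompact {y | (x, y) ∈ S} :=
        hK.of_isClosed_subset h1 fun y hy => hSK _ hy
      exact h2.image (f := fun y : Fin (d + 1) → ℝ => y 0) (by fun_prop)
    have hmin : ∀ x, (∃ y, (x, y) ∈ S) → ∃ y, (x, y) ∈ S ∧ y 0 = m x := by
      rintro x ⟨y, hy⟩
      exact (hcomp x).sInf_mem ⟨y 0, y, hy, rfl⟩
    have hD : IsClosed (Prod.fst '' S) := hproj S hS hSK
    have hmm : Measurable m := by
      refine measurable_of_Iic fun a => ?_
      have h1 : IsClosed (Prod.fst '' (S ∩ {p | p.2 0 ≤ a})) :=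
        hproj _ (hS.inter (isClosed_le (by fun_prop) continuous_const)) fun p hp => hSK p hp.1
      -- Outside the domain of `S`, `m` takes the default value `sInf ∅ = 0`, which accounts for the
      -- second set.
      have h2 : m ⁻¹' Set.Iic a =
          Prod.fst '' (S ∩ {p | p.2 0 ≤ a}) ∪ ((Prod.fst '' S)ᶜ ∩ {_x | 0 ≤ a}) := by
        ext x
        by_cases hx : ∃ y, (x, y) ∈ S
        · constructor
          · intro h
            obtain ⟨y, hy, hy0⟩ := hmin x hx
            exact Or.inl ⟨(x, y), ⟨hy, by simpa [hy0] using h⟩, rfl⟩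
          · rintro (⟨⟨x', y⟩, ⟨hy, hya⟩, rfl⟩ | ⟨h, -⟩)
            · exact (csInf_le (hcomp x').bddBelow ⟨y, hy, rfl⟩).trans hya
            · obtain ⟨y, hy⟩ := hx
              exact absurd ⟨(x, y), hy, rfl⟩ h
        · have h0 : m x = 0 := by
            rw [hm]
            have : {c | ∃ y, (x, y) ∈ S ∧ y 0 = c} = ∅ := by
              ext c
              simp only [Set.mem_ofPred_eq, Set.mem_empty_iff_false, iff_false]
              rintro ⟨y, hy, -⟩
              exact hx ⟨y, hy⟩
            simp only [this, Real.sInf_empty]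
          constructor
          · intro h
            refine Or.inr ⟨?_, by simpa [h0] using h⟩
            rintro ⟨⟨x', y⟩, hy, rfl⟩
            exact hx ⟨y, hy⟩
          · rintro (⟨⟨x', y⟩, ⟨hy, hya⟩, rfl⟩ | ⟨-, h⟩)
            · exact absurd ⟨y, hy⟩ hx
            · simpa [h0] using h
      rw [h2]
      exact h1.measurableSet.union (hD.measurableSet.compl.inter (MeasurableSet.const _))
    -- The first coordinate becomes an additional parameter; this is why the induction is over all
    -- spaces `X` at once.
    obtain ⟨g, hg, hgS⟩ := ih (X := X × ℝ) ((fun y (i : Fin d) => y i.succ) '' K)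
      (hK.image (by fun_prop)) {p | (p.1.1, (Fin.cons p.1.2 p.2 : Fin (d + 1) → ℝ)) ∈ S}
      (hS.preimage (Continuous.prodMk (by fun_prop) (continuous_pi fun i => by
        refine Fin.cases ?_ (fun j => ?_) i
        · simp only [Fin.cons_zero]; fun_prop
        · simp only [Fin.cons_succ]; fun_prop)))
      (by
        rintro ⟨⟨x, c⟩, y⟩ h
        exact ⟨_, hSK _ h, by simp⟩)
    refine ⟨fun x => Fin.cons (m x) (g (x, m x)), ?_, ?_⟩
    · refine measurable_pi_iff.2 fun i => ?_
      refine Fin.cases ?_ (fun j => ?_) i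
      · simpa only [Fin.cons_zero] using hmm
      · simp only [Fin.cons_succ]
        exact (measurable_pi_apply j).comp (hg.comp (measurable_id.prodMk hmm))
    · intro x hx
      obtain ⟨y, hy, hy0⟩ := hmin x hx
      refine hgS (x, m x) ⟨fun i => y i.succ, ?_⟩
      change (x, (Fin.cons (m x) fun i => y i.succ : Fin (d + 1) → ℝ)) ∈ S
      rw [← hy0]
      convert hy using 2
      exact Fin.cons_self_tail y

theorem exists_measurable_selection {X Y : Type} [TopologicalSpace X]
    [SecondCountableTopology X] [MeasurableSpace X] [BorelSpace X]
    [NormedAddCommGroup Y] [NormedSpace ℝ Y] [FiniteDimensional ℝ Y] [MeasurableSpace Y]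
    [BorelSpace Y] (K : Set Y) (hK : IsCompact K) (S : Set (X × Y)) (hS : IsClosed S)
    (hSK : ∀ p ∈ S, p.2 ∈ K) (hne : ∀ x, ∃ y, (x, y) ∈ S) :
    ∃ g : X → Y, Measurable g ∧ ∀ x, (x, g x) ∈ S := by
  let e : Y ≃L[ℝ] (Fin (Module.finrank ℝ Y) → ℝ) :=
    ContinuousLinearEquiv.ofFinrankEq (by simp)
  obtain ⟨g, hg, hgS⟩ := exists_measurable_selection_fin (Module.finrank ℝ Y) (X := X) (e '' K)
    (hK.image e.continuous) {p | (p.1, e.symm p.2) ∈ S}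
    (hS.preimage (continuous_fst.prodMk (e.symm.continuous.comp continuous_snd))) (by
      rintro ⟨x, y⟩ h
      exact ⟨_, hSK _ h, by simp⟩)
  refine ⟨fun x => e.symm (g x), e.symm.continuous.measurable.comp hg, fun x => ?_⟩
  obtain ⟨y, hy⟩ := hne x
  exact hgS x ⟨e y, by simpa using hy⟩

end Selection

/-! ### Singular values through unitary diagonalization -/

section SingularValues

open Matrix

theorem charpoly_toEuclideanLin {n : ℕ} (B : Matrix (Fin n) (Fin n) ℂ) :
    (toEuclideanLin B).charpoly = B.charpoly := by
  rw [← LinearMap.charpoly_toMatrix _ (EuclideanSpace.basisFun (Fin n) ℂ).toBasis,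
    toEuclideanLin_eq_toLin_orthonormal, LinearMap.toMatrix_toLin]

/-- The characteristic polynomial of `Aᴴ * A` fixes the eigenvalues as a multiset, and two
descending lists of the same multiset agree. This identifies `sval` with the entries of any concrete
ordered diagonalization. -/
theorem eigenvalues_eq_of_diagonalization {m n : ℕ} (A : Matrix (Fin m) (Fin n) ℂ)
    {V : Matrix (Fin n) (Fin n) ℂ} (hV : V ∈ unitaryGroup (Fin n) ℂ) {d : Fin n → ℝ}
    (hd : Antitone d) (h : Aᴴ * A * V = V * diagonal (fun i => (d i : ℂ))) (i : Fin n) :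
    sval A i ^ 2 = d i := by
  have hn : Module.finrank ℂ (EuclideanSpace ℂ (Fin n)) = n := by simp
  have hVV : V * Vᴴ = 1 := mem_unitaryGroup_iff.1 hV
  have hcp : (LinearMap.adjoint (toEuclideanLin A) ∘ₗ toEuclideanLin A).charpoly =
      ∏ i, (Polynomial.X - Polynomial.C (d i : ℂ)) := by
    have h1 : LinearMap.adjoint (toEuclideanLin A) ∘ₗ toEuclideanLin A =
        toEuclideanLin (Aᴴ * A) := by
      rw [← toEuclideanLin_conjTranspose_eq_adjoint]
      ext x i
      simp [toLpLin_apply]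
    rw [h1, charpoly_toEuclideanLin]
    have h2 : Aᴴ * A = V * diagonal (fun i => (d i : ℂ)) * Vᴴ := by
      rw [← h, Matrix.mul_assoc, hVV, Matrix.mul_one]
    have hVV' : Vᴴ * V = 1 := mem_unitaryGroup_iff'.1 hV
    rw [h2, Matrix.mul_assoc, charpoly_mul_comm, Matrix.mul_assoc, hVV', Matrix.mul_one,
      charpoly_diagonal]
  have hs := (toEuclideanLin A).isSymmetric_adjoint_comp_self.sort_roots_charpoly_eq_eigenvalues hn
  have hr : (∏ i, (Polynomial.X - Polynomial.C (d i : ℂ))).roots =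
      Multiset.map (RCLike.ofReal ∘ d) Finset.univ.val := by
    rw [Polynomial.roots_prod _ _ (by
      simp [Finset.prod_ne_zero_iff, Polynomial.X_sub_C_ne_zero])]
    simp
  have hsd : ((Multiset.map (RCLike.ofReal ∘ d : Fin n → ℂ) Finset.univ.val).map RCLike.re).sort
      (· ≥ ·) = List.ofFn d := by
    simp_rw [Fin.univ_val_map, Multiset.map_coe, List.map_ofFn,
      Function.comp_def, RCLike.ofReal_re, Multiset.coe_sort]
    convert! List.mergeSort_of_pairwise ?_
    simp_rw [decide_eq_true_eq, ← List.sortedGE_iff_pairwise]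
    exact hd.sortedGE_ofFn
  rw [hcp, hr, hsd, List.ofFn_inj] at hs
  rw [sval, (toEuclideanLin A).sq_singularValues_fin hn, ← hs]

theorem exists_antitone_diagonalization {n : ℕ} {B : Matrix (Fin n) (Fin n) ℂ}
    (hB : B.IsHermitian) : ∃ (V : Matrix (Fin n) (Fin n) ℂ) (d : Fin n → ℝ),
      V ∈ unitaryGroup (Fin n) ℂ ∧ Antitone d ∧ B * V = V * diagonal (fun i => (d i : ℂ)) := by
  have hn : Module.finrank ℂ (EuclideanSpace ℂ (Fin n)) = n := by simp
  have hT : (toEuclideanLin B).IsSymmetric := isSymmetric_toEuclideanLin_iff.2 hB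
  set v := hT.eigenvectorBasis hn with hv
  refine ⟨(EuclideanSpace.basisFun (Fin n) ℂ).toBasis.toMatrix v, hT.eigenvalues hn,
    (EuclideanSpace.basisFun (Fin n) ℂ).toMatrix_orthonormalBasis_mem_unitary v,
    hT.eigenvalues_antitone hn, ?_⟩
  ext i j
  have h1 := congrArg (fun w : EuclideanSpace ℂ (Fin n) => w i) (hT.apply_eigenvectorBasis hn j)
  simp only [toLpLin_apply, PiLp.smul_apply, smul_eq_mul] at h1
  rw [Matrix.mul_diagonal]
  simp only [Matrix.mul_apply, Module.Basis.toMatrix_apply, OrthonormalBasis.coe_toBasis_repr_apply,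
    EuclideanSpace.basisFun_repr]
  rw [mul_comm]
  simpa [mulVec, dotProduct] using h1

theorem exists_isRightSingularMatrix {m n : ℕ} (A : Matrix (Fin m) (Fin n) ℂ) :
    ∃ V, IsRightSingularMatrix A V := by
  obtain ⟨V, d, hV, hd, h⟩ := exists_antitone_diagonalization (isHermitian_conjTranspose_mul_self A)
  refine ⟨V, hV, ?_⟩
  simp_rw [eigenvalues_eq_of_diagonalization A hV hd h]
  exact h

theorem sval_nonneg {m n : ℕ} (A : Matrix (Fin m) (Fin n) ℂ) (i : ℕ) : 0 ≤ sval A i :=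
  LinearMap.singularValues_nonneg _ _

theorem sval_antitone {m n : ℕ} (A : Matrix (Fin m) (Fin n) ℂ) : Antitone (sval A) :=
  LinearMap.singularValues_antitone _

/-- Hermitian matrices can be diagonalized by unitary matrices that depend on them in a Borel
measurable way. -/
theorem exists_measurable_diagonalization (n : ℕ) :
    ∃ W : (Fin n → Fin n → ℂ) → (Fin n → Fin n → ℂ), Measurable W ∧
      ∀ B : Matrix (Fin n) (Fin n) ℂ, of (W B) ∈ unitaryGroup (Fin n) ℂ ∧
        (B.IsHermitian → ∃ d : Fin n → ℝ, Antitone d ∧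
          B * of (W B) = of (W B) * diagonal (fun i => (d i : ℂ))) := by
  -- Adding the adjoint makes the relation total, since `B + Bᴴ` is always diagonalizable. For
  -- Hermitian `B` it is `2 B`, with the same eigenvectors in the same order. All conditions are
  -- closed, and unitarity bounds the values.
  set S : Set ((Fin n → Fin n → ℂ) × (Fin n → Fin n → ℂ)) :=
    {p | of p.2 * (of p.2)ᴴ = 1 ∧
      (∀ i j, i ≠ j → ((of p.2)ᴴ * (of p.1 + (of p.1)ᴴ) * of p.2) i j = 0) ∧
      (∀ i j, i ≤ j → (((of p.2)ᴴ * (of p.1 + (of p.1)ᴴ) * of p.2) j j).re ≤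
        (((of p.2)ᴴ * (of p.1 + (of p.1)ᴴ) * of p.2) i i).re)} with hS
  have hof : Continuous fun p : (Fin n → Fin n → ℂ) × (Fin n → Fin n → ℂ) =>
      (of p.2 : Matrix (Fin n) (Fin n) ℂ) := continuous_snd
  have hof' : Continuous fun p : (Fin n → Fin n → ℂ) × (Fin n → Fin n → ℂ) =>
      (of p.1 : Matrix (Fin n) (Fin n) ℂ) := continuous_fst
  have hcl : IsClosed S := by
    have hc : Continuous fun p : (Fin n → Fin n → ℂ) × (Fin n → Fin n → ℂ) =>
        (of p.2)ᴴ * (of p.1 + (of p.1)ᴴ) * of p.2 := by fun_prop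
    have hce : ∀ i j, Continuous fun p : (Fin n → Fin n → ℂ) × (Fin n → Fin n → ℂ) =>
        ((of p.2)ᴴ * (of p.1 + (of p.1)ᴴ) * of p.2) i j := fun i j => hc.matrix_elem i j
    have h1 : IsClosed {p : (Fin n → Fin n → ℂ) × (Fin n → Fin n → ℂ) | ∀ i j, i ≠ j →
        ((of p.2)ᴴ * (of p.1 + (of p.1)ᴴ) * of p.2) i j = 0} := by
      simp only [Set.ofPred_forall]
      exact isClosed_iInter fun i => isClosed_iInter fun j => isClosed_iInter fun _ =>
        isClosed_eq (hce i j) continuous_const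
    have h2 : IsClosed {p : (Fin n → Fin n → ℂ) × (Fin n → Fin n → ℂ) | ∀ i j, i ≤ j →
        (((of p.2)ᴴ * (of p.1 + (of p.1)ᴴ) * of p.2) j j).re ≤
        (((of p.2)ᴴ * (of p.1 + (of p.1)ᴴ) * of p.2) i i).re} := by
      simp only [Set.ofPred_forall]
      exact isClosed_iInter fun i => isClosed_iInter fun j => isClosed_iInter fun _ =>
        isClosed_le (Complex.continuous_re.comp (hce j j)) (Complex.continuous_re.comp (hce i i))
    exact (isClosed_eq (by fun_prop) continuous_const).inter (h1.inter h2)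
  obtain ⟨W, hW, hWS⟩ := exists_measurable_selection (Metric.closedBall (0 : Fin n → Fin n → ℂ) 1)
    (isCompact_closedBall _ _) S hcl (by
      rintro ⟨B, V⟩ ⟨h, -⟩
      rw [mem_closedBall_zero_iff]
      refine (pi_norm_le_iff_of_nonneg zero_le_one).2 fun i =>
        (pi_norm_le_iff_of_nonneg zero_le_one).2 fun j => ?_
      exact entry_norm_bound_of_unitary (U := of V) (mem_unitaryGroup_iff.2 h) i j) (by
      intro B
      obtain ⟨V, d, hV, hd, h⟩ := exists_antitone_diagonalization
        (isHermitian_add_transpose_self (of B))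
      have hVV : Vᴴ * V = 1 := mem_unitaryGroup_iff'.1 hV
      have h' : Vᴴ * (of B + (of B)ᴴ) * V = diagonal (fun i => (d i : ℂ)) := by
        rw [Matrix.mul_assoc, h, ← Matrix.mul_assoc, hVV, Matrix.one_mul]
      refine ⟨V, mem_unitaryGroup_iff.1 hV, fun i j hij => ?_, fun i j hij => ?_⟩
      · change (Vᴴ * (of B + (of B)ᴴ) * V) i j = 0
        rw [h', diagonal_apply_ne _ hij]
      · change ((Vᴴ * (of B + (of B)ᴴ) * V) j j).re ≤ ((Vᴴ * (of B + (of B)ᴴ) * V) i i).re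
        rw [h', diagonal_apply_eq, diagonal_apply_eq]
        exact hd hij)
  refine ⟨W, hW, fun B => ⟨mem_unitaryGroup_iff.2 (hWS B).1, fun hB => ?_⟩⟩
  obtain ⟨h1, h2, h3⟩ := hWS B
  have e : (of (W B))ᴴ * (of B + (of B)ᴴ) * of (W B) = (2 : ℂ) • ((of (W B))ᴴ * B * of (W B)) := by
    change (of (W B))ᴴ * (B + Bᴴ) * of (W B) = _
    rw [hB.eq, ← two_smul ℂ B, Matrix.mul_smul, Matrix.smul_mul]
  simp only at h2 h3
  rw [e] at h2 h3
  set D := (of (W B))ᴴ * B * of (W B) with hD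
  have hDH : D.IsHermitian := isHermitian_conjTranspose_mul_mul (of (W B)) hB
  have hDd : D = diagonal (fun i => (((D i i).re : ℝ) : ℂ)) := by
    ext i j
    by_cases hij : i = j
    · subst hij
      rw [diagonal_apply_eq]
      exact (hDH.coe_re_apply_self i).symm
    · rw [diagonal_apply_ne _ hij]
      have := h2 i j hij
      simpa using this
  refine ⟨fun i => (D i i).re, fun i j hij => ?_, ?_⟩
  · have := h3 i j hij
    simpa using this
  · rw [← hDd, hD, ← Matrix.mul_assoc, ← Matrix.mul_assoc]
    have h1' : of (W B) * (of (W B))ᴴ = 1 := h1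
    rw [h1', Matrix.one_mul]

end SingularValues

/-! ### Frobenius norms and the optimization at a single frequency -/

section Frobenius

open Matrix

/-- The squared Frobenius norm. -/
noncomputable def frob {m n : ℕ} (A : Matrix (Fin m) (Fin n) ℂ) : ℝ := ∑ i, ∑ j, ‖A i j‖ ^ 2

variable {m n k : ℕ}

theorem frob_nonneg (A : Matrix (Fin m) (Fin n) ℂ) : 0 ≤ frob A := by
  unfold frob; positivity

theorem conjTranspose_mul_self_apply_self (A : Matrix (Fin m) (Fin n) ℂ) (j : Fin n) :
    (Aᴴ * A) j j = ((∑ i, ‖A i j‖ ^ 2 : ℝ) : ℂ) := by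
  rw [Matrix.mul_apply, Complex.ofReal_sum]
  refine Finset.sum_congr rfl fun i _ => ?_
  rw [conjTranspose_apply, Complex.star_def, ← Complex.normSq_eq_conj_mul_self,
    Complex.normSq_eq_norm_sq]

theorem mul_conjTranspose_self_apply_self (A : Matrix (Fin m) (Fin n) ℂ) (i : Fin m) :
    (A * Aᴴ) i i = ((∑ j, ‖A i j‖ ^ 2 : ℝ) : ℂ) := by
  rw [Matrix.mul_apply, Complex.ofReal_sum]
  refine Finset.sum_congr rfl fun j _ => ?_
  rw [conjTranspose_apply, Complex.star_def, mul_comm, ← Complex.normSq_eq_conj_mul_self,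
    Complex.normSq_eq_norm_sq]

theorem trace_conjTranspose_mul_self (A : Matrix (Fin m) (Fin n) ℂ) :
    (Aᴴ * A).trace = (frob A : ℂ) := by
  simp only [Matrix.trace, diag_apply, conjTranspose_mul_self_apply_self, frob]
  rw [← Complex.ofReal_sum, Finset.sum_comm]

theorem frob_mul_unitary (A : Matrix (Fin m) (Fin n) ℂ) {U : Matrix (Fin n) (Fin n) ℂ}
    (hU : U ∈ unitaryGroup (Fin n) ℂ) : frob (A * U) = frob A := by
  have h : ((frob (A * U) : ℝ) : ℂ) = (frob A : ℂ) := by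
    have hU' : U * Uᴴ = 1 := mem_unitaryGroup_iff.1 hU
    rw [← trace_conjTranspose_mul_self, ← trace_conjTranspose_mul_self, conjTranspose_mul,
      trace_mul_comm, Matrix.mul_assoc, ← Matrix.mul_assoc U, hU', Matrix.one_mul, trace_mul_comm]
  exact_mod_cast h

theorem frob_mul_conjTranspose_unitary (A : Matrix (Fin m) (Fin n) ℂ)
    {U : Matrix (Fin n) (Fin n) ℂ} (hU : U ∈ unitaryGroup (Fin n) ℂ) : frob (A * Uᴴ) = frob A :=
  frob_mul_unitary A (Unitary.star_mem hU)

theorem frob_unitary_mul (A : Matrix (Fin m) (Fin n) ℂ) {U : Matrix (Fin m) (Fin m) ℂ}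
    (hU : U ∈ unitaryGroup (Fin m) ℂ) : frob (U * A) = frob A := by
  have h : ((frob (U * A) : ℝ) : ℂ) = (frob A : ℂ) := by
    have hU' : Uᴴ * U = 1 := mem_unitaryGroup_iff'.1 hU
    rw [← trace_conjTranspose_mul_self, ← trace_conjTranspose_mul_self, conjTranspose_mul,
      Matrix.mul_assoc, ← Matrix.mul_assoc _ U, hU', Matrix.one_mul]
  exact_mod_cast h

theorem frob_smul (c : ℂ) (A : Matrix (Fin m) (Fin n) ℂ) : frob (c • A) = ‖c‖ ^ 2 * frob A := by
  simp only [frob, Matrix.smul_apply, norm_smul, mul_pow, Finset.mul_sum]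

/-- This is `0 ≤ frob (X - Z)` expanded: a tangent bound for the squared norm, tight at `X = Z`. -/
theorem two_mul_re_trace_sub_frob_le (Z X : Matrix (Fin m) (Fin n) ℂ) :
    2 * (Zᴴ * X).trace.re - frob Z ≤ frob X := by
  have h : (Zᴴ * X).trace.re = ∑ i, ∑ j, (star (Z i j) * X i j).re := by
    simp only [Matrix.trace, diag_apply, Matrix.mul_apply, conjTranspose_apply, Complex.re_sum]
    rw [Finset.sum_comm]
  rw [h, frob, frob, Finset.mul_sum, ← Finset.sum_sub_distrib]
  refine Finset.sum_le_sum fun i _ => ?_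
  rw [Finset.mul_sum, ← Finset.sum_sub_distrib]
  refine Finset.sum_le_sum fun j _ => ?_
  simp only [Complex.star_def, Complex.mul_re, Complex.conj_re, Complex.conj_im,
    ← Complex.normSq_eq_norm_sq, Complex.normSq_apply]
  nlinarith [sq_nonneg ((X i j).re - (Z i j).re), sq_nonneg ((X i j).im - (Z i j).im)]

/-- Frobenius norm of a product whose right factor has diagonal Gram matrix. -/
theorem frob_mul_conjTranspose_of_diagonal (Z : Matrix (Fin m) (Fin n) ℂ)
    (B : Matrix (Fin k) (Fin n) ℂ) {b : Fin n → ℝ} (hB : Bᴴ * B = diagonal fun j => (b j : ℂ)) :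
    frob (Z * Bᴴ) = ∑ i, ∑ j, ‖Z i j‖ ^ 2 * b j := by
  have h : ((frob (Z * Bᴴ) : ℝ) : ℂ) = ((∑ i, ∑ j, ‖Z i j‖ ^ 2 * b j : ℝ) : ℂ) := by
    rw [← trace_conjTranspose_mul_self, conjTranspose_mul, conjTranspose_conjTranspose,
      Matrix.mul_assoc, trace_mul_comm, Matrix.mul_assoc, Matrix.mul_assoc, hB,
      ← Matrix.mul_assoc]
    simp only [Matrix.trace, diag_apply, mul_diagonal, conjTranspose_mul_self_apply_self]
    rw [Finset.sum_comm]
    push_cast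
    simp only [Finset.sum_mul]
  exact_mod_cast h

/-- Linear estimation through a channel with diagonal Gram matrix: the regularized least-squares
error is bounded below by the Wiener error. -/
theorem wiener_le (A : Matrix (Fin m) (Fin n) ℂ) (G : Matrix (Fin m) (Fin k) ℂ)
    (B : Matrix (Fin k) (Fin n) ℂ) {b : Fin n → ℝ} (hb : ∀ j, 0 ≤ b j)
    (hB : Bᴴ * B = diagonal fun j => (b j : ℂ)) :
    ∑ i, ∑ j, ‖A i j‖ ^ 2 / (1 + b j) ≤ frob (A - G * B) + frob G := by
  -- The minimizing `G` is `Z * Bᴴ` with `Z = A (1 + Bᴴ B)⁻¹`, and its residual `A - G * B` is `Z`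
  -- itself. So the tangent bounds `h1` and `h2` are taken at the minimizer, and by `h3` their terms
  -- linear in `G` cancel.
  set Z : Matrix (Fin m) (Fin n) ℂ := of fun i j => A i j * ((1 / (1 + b j) : ℝ) : ℂ) with hZ
  have hZn : ∀ i j, ‖Z i j‖ ^ 2 = ‖A i j‖ ^ 2 / (1 + b j) ^ 2 := by
    intro i j
    have : 0 < 1 + b j := by linarith [hb j]
    rw [hZ, of_apply, norm_mul, mul_pow, Complex.norm_real, Real.norm_eq_abs, sq_abs, one_div,
      inv_pow, div_eq_mul_inv]
  have h1 := two_mul_re_trace_sub_frob_le Z (A - G * B)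
  have h2 := two_mul_re_trace_sub_frob_le (Z * Bᴴ) G
  have h3 : ((Z * Bᴴ)ᴴ * G).trace = (Zᴴ * (G * B)).trace := by
    rw [conjTranspose_mul, conjTranspose_conjTranspose, Matrix.mul_assoc, trace_mul_comm,
      Matrix.mul_assoc]
  have h4 : (Zᴴ * A).trace.re = ∑ i, ∑ j, ‖A i j‖ ^ 2 / (1 + b j) := by
    simp only [Matrix.trace, diag_apply, Matrix.mul_apply, conjTranspose_apply, Complex.re_sum]
    rw [Finset.sum_comm]
    refine Finset.sum_congr rfl fun i _ => Finset.sum_congr rfl fun j _ => ?_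
    rw [hZ, of_apply, star_mul', Complex.star_def, Complex.conj_ofReal,
      mul_right_comm, ← Complex.normSq_eq_conj_mul_self, ← Complex.ofReal_mul, Complex.ofReal_re,
      Complex.normSq_eq_norm_sq]
    ring
  rw [Matrix.mul_sub, trace_sub, Complex.sub_re, h4] at h1
  rw [h3, frob_mul_conjTranspose_of_diagonal Z B hB] at h2
  have h5 : frob Z + ∑ i, ∑ j, ‖Z i j‖ ^ 2 * b j = ∑ i, ∑ j, ‖A i j‖ ^ 2 / (1 + b j) := by
    rw [frob, ← Finset.sum_add_distrib]
    refine Finset.sum_congr rfl fun i _ => ?_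
    rw [← Finset.sum_add_distrib]
    refine Finset.sum_congr rfl fun j _ => ?_
    have : 0 < 1 + b j := by linarith [hb j]
    rw [hZn]
    field_simp
  linarith

/-- For `τ ≤ σ`, clearing the denominator leaves the square of `σ - τ - τ b`. With `τ > 0` it
vanishes at `b = σ / τ - 1`, which is the water-filling power for `ζ = τ⁻¹`. -/
theorem water_filling_scalar {σ τ b : ℝ} (hσ : 0 ≤ σ) (hb : 0 ≤ b) :
    σ ^ 2 * b / (1 + b) - τ ^ 2 * b ≤ max (σ - τ) 0 ^ 2 := by
  have h1 : 0 < 1 + b := by linarith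
  rw [sub_le_iff_le_add, div_le_iff₀ h1]
  rcases le_total σ τ with h | h
  · rw [max_eq_right (by linarith)]
    nlinarith [mul_nonneg hb (sq_nonneg τ), pow_le_pow_left₀ hσ h 2, mul_nonneg hb hb,
      mul_nonneg (mul_nonneg hb hb) (sq_nonneg τ)]
  · rw [max_eq_left (by linarith)]
    nlinarith [sq_nonneg (σ - τ - τ * b)]

/-- A sum of the terms of a nonnegative antitone sequence with weights in `[0, 1]` of total mass at
most the number of indices below `k` is at most the sum of the first `k` terms. -/
theorem sum_mul_le_sum_first {φ : ℕ → ℝ} (hφ : Antitone φ) (k : ℕ) {c : Fin n → ℝ}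
    (hc0 : ∀ i, 0 ≤ c i) (hc1 : ∀ i, c i ≤ 1)
    (hc : ∑ i, c i = ∑ i : Fin n, if (i : ℕ) < k then 1 else 0) :
    ∑ i, c i * φ i ≤ ∑ i : Fin n, if (i : ℕ) < k then φ i else 0 := by
  -- Each term is compared with the constant `φ k`; since the total masses agree, that constant
  -- cancels.
  have h : ∑ i : Fin n, (((if (i : ℕ) < k then φ i else 0) - c i * φ i) -
      ((if (i : ℕ) < k then 1 else 0) - c i) * φ k) ≥ 0 := by
    refine Finset.sum_nonneg fun i _ => ?_
    split_ifs with hi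
    · have := hφ hi.le
      nlinarith [hc1 i]
    · have := hφ (not_lt.1 hi)
      nlinarith [hc0 i]
  rw [Finset.sum_sub_distrib, Finset.sum_sub_distrib, ← Finset.sum_mul, Finset.sum_sub_distrib,
    hc, sub_self, zero_mul] at h
  linarith

theorem sum_fin_ite_lt (φ : ℕ → ℝ) (k : ℕ) :
    (∑ i : Fin n, if (i : ℕ) < k then φ i else 0) = ∑ i ∈ Finset.range (min k n), φ i := by
  rw [Fin.sum_univ_eq_sum_range (fun i => if i < k then φ i else 0) n, ← Finset.sum_filter]
  congr 1
  ext i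
  simp only [Finset.mem_filter, Finset.mem_range]
  omega

theorem sval_eq_zero_of_le (B : Matrix (Fin k) (Fin n) ℂ) {i : ℕ} (hi : k ≤ i) :
    sval B i = 0 := by
  refine (toEuclideanLin B).singularValues_eq_zero_iff_le_finrank_range.2 ?_
  refine (Submodule.finrank_le _).trans ?_
  simpa using hi

theorem sum_norm_sq_col_of_unitary {U : Matrix (Fin n) (Fin n) ℂ}
    (hU : U ∈ unitaryGroup (Fin n) ℂ) (j : Fin n) : ∑ i, ‖U i j‖ ^ 2 = 1 := by
  have h := conjTranspose_mul_self_apply_self U j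
  rw [show Uᴴ * U = 1 from mem_unitaryGroup_iff'.1 hU, one_apply_eq] at h
  exact_mod_cast h.symm

theorem sum_norm_sq_row_of_unitary {U : Matrix (Fin n) (Fin n) ℂ}
    (hU : U ∈ unitaryGroup (Fin n) ℂ) (i : Fin n) : ∑ j, ‖U i j‖ ^ 2 = 1 := by
  have h := mul_conjTranspose_self_apply_self U i
  rw [show U * Uᴴ = 1 from mem_unitaryGroup_iff.1 hU, one_apply_eq] at h
  exact_mod_cast h.symm

/-- Lower bound for the regularized error of a factorization `G * B` of inner dimension `k`: soft
thresholding of the `k` largest singular values is optimal. -/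
theorem soft_threshold_le (A : Matrix (Fin m) (Fin n) ℂ) (G : Matrix (Fin m) (Fin k) ℂ)
    (B : Matrix (Fin k) (Fin n) ℂ) (τ : ℝ) :
    frob A - ∑ i ∈ Finset.range (min k n), max (sval A i - τ) 0 ^ 2 ≤
      frob (A - G * B) + frob G + τ ^ 2 * frob B := by
  obtain ⟨V, hV, hAV⟩ := exists_isRightSingularMatrix A
  obtain ⟨W, hW, hBW⟩ := exists_isRightSingularMatrix B
  have hWW : Wᴴ * W = 1 := mem_unitaryGroup_iff'.1 hW
  have hWW' : W * Wᴴ = 1 := mem_unitaryGroup_iff.1 hW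
  have hVV : V * Vᴴ = 1 := mem_unitaryGroup_iff.1 hV
  set b : Fin n → ℝ := fun j => sval B j ^ 2 with hb
  have hb0 : ∀ j, 0 ≤ b j := fun j => sq_nonneg _
  have hBB : (B * W)ᴴ * (B * W) = diagonal fun j => (b j : ℂ) := by
    rw [conjTranspose_mul, Matrix.mul_assoc, ← Matrix.mul_assoc Bᴴ, hBW, ← Matrix.mul_assoc, hWW,
      Matrix.one_mul]
  -- In the right-singular basis of `B` the Gram matrix is diagonal, so the Wiener bound removes `G`
  -- and leaves only the singular values and vectors of `B`.
  have h1 := wiener_le (A * W) G (B * W) hb0 hBB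
  rw [← Matrix.mul_assoc, ← Matrix.sub_mul, frob_mul_unitary _ hW] at h1
  have h2 : frob B = ∑ j, b j := by
    have := trace_conjTranspose_mul_self (B * W)
    rw [hBB, frob_mul_unitary _ hW, trace_diagonal] at this
    exact_mod_cast this.symm
  -- `D` passes from the right-singular basis of `B` to that of `A`. Being unitary, its squared
  -- moduli form a doubly stochastic matrix.
  set D := Vᴴ * W with hD
  have hDu : D ∈ unitaryGroup (Fin n) ℂ := mul_mem (Unitary.star_mem hV) hW
  have hs : ∀ j, ∑ i, ‖(A * W) i j‖ ^ 2 = ∑ i, ‖D i j‖ ^ 2 * sval A i ^ 2 := by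
    intro j
    have e : (A * W)ᴴ * (A * W) = Dᴴ * diagonal (fun i : Fin n => ((sval A i ^ 2 : ℝ) : ℂ)) * D := by
      have : Aᴴ * A = V * diagonal (fun i : Fin n => ((sval A i ^ 2 : ℝ) : ℂ)) * Vᴴ := by
        rw [← hAV, Matrix.mul_assoc, hVV, Matrix.mul_one]
      rw [conjTranspose_mul, Matrix.mul_assoc, ← Matrix.mul_assoc Aᴴ, this, hD, conjTranspose_mul,
        conjTranspose_conjTranspose]
      simp only [Matrix.mul_assoc]
    have h := conjTranspose_mul_self_apply_self (A * W) j
    rw [e, Matrix.mul_apply] at h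
    have h' : (∑ i, (Dᴴ * diagonal (fun i : Fin n => ((sval A i ^ 2 : ℝ) : ℂ))) j i * D i j) =
        ((∑ i, ‖D i j‖ ^ 2 * sval A i ^ 2 : ℝ) : ℂ) := by
      rw [Complex.ofReal_sum]
      refine Finset.sum_congr rfl fun i _ => ?_
      rw [mul_diagonal, conjTranspose_apply, Complex.star_def, mul_right_comm,
        ← Complex.normSq_eq_conj_mul_self, Complex.normSq_eq_norm_sq, Complex.ofReal_mul]
    rw [h'] at h
    exact_mod_cast h.symm
  have h3 : frob A = ∑ j, ∑ i, ‖D i j‖ ^ 2 * sval A i ^ 2 := by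
    rw [← frob_mul_unitary A hW, frob, Finset.sum_comm]
    exact Finset.sum_congr rfl fun j _ => hs j
  have h4 : ∑ i, ∑ j, ‖(A * W) i j‖ ^ 2 / (1 + b j) =
      ∑ j, (∑ i, ‖D i j‖ ^ 2 * sval A i ^ 2) / (1 + b j) := by
    rw [Finset.sum_comm]
    refine Finset.sum_congr rfl fun j _ => ?_
    rw [← hs, Finset.sum_div]
  -- Columns `j ≥ k` contribute nothing because `B` has rank at most `k`. Each other column averages
  -- the scalar water-filling bound with the weights `‖D i j‖ ^ 2`.
  have h5 : ∀ j : Fin n, (∑ i, ‖D i j‖ ^ 2 * sval A i ^ 2) -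
      (∑ i, ‖D i j‖ ^ 2 * sval A i ^ 2) / (1 + b j) - τ ^ 2 * b j ≤
      ∑ i, (if (j : ℕ) < k then ‖D i j‖ ^ 2 else 0) * max (sval A i - τ) 0 ^ 2 := by
    intro j
    by_cases hj : (j : ℕ) < k
    · have hpos : 0 < 1 + b j := by linarith [hb0 j]
      have e1 : τ ^ 2 * b j = ∑ i, ‖D i j‖ ^ 2 * (τ ^ 2 * b j) := by
        rw [← Finset.sum_mul, sum_norm_sq_col_of_unitary hDu, one_mul]
      rw [e1, Finset.sum_div, ← Finset.sum_sub_distrib, ← Finset.sum_sub_distrib]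
      refine Finset.sum_le_sum fun i _ => ?_
      rw [if_pos hj]
      have := mul_le_mul_of_nonneg_left
        (water_filling_scalar (τ := τ) (sval_nonneg A i) (hb0 j)) (sq_nonneg ‖D i j‖)
      refine le_trans (le_of_eq ?_) this
      field_simp
      ring
    · have : b j = 0 := by simp [hb, sval_eq_zero_of_le B (not_lt.1 hj)]
      simp [this, hj]
  have h6 := Finset.sum_le_sum fun j (_ : j ∈ Finset.univ) => h5 j
  rw [Finset.sum_sub_distrib, Finset.sum_sub_distrib, ← h3, ← h4, ← Finset.mul_sum, ← h2] at h6
  have h8 : ∑ j : Fin n, ∑ i : Fin n, (if (j : ℕ) < k then ‖D i j‖ ^ 2 else 0) *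
      max (sval A i - τ) 0 ^ 2 = ∑ i : Fin n, (∑ j : Fin n, if (j : ℕ) < k then ‖D i j‖ ^ 2 else 0) *
      max (sval A i - τ) 0 ^ 2 := by
    rw [Finset.sum_comm]
    simp only [Finset.sum_mul]
  -- The weights of the singular values of `A` are partial row sums of a doubly stochastic matrix.
  -- They lie in `[0, 1]` and have total mass `min k n`, so putting them on the largest singular
  -- values is best.
  have h7 := sum_mul_le_sum_first (n := n) (φ := fun i => max (sval A i - τ) 0 ^ 2)
    (fun i j hij => pow_le_pow_left₀ (le_max_right _ _)
      (max_le_max (sub_le_sub_right (sval_antitone A hij) _) le_rfl) 2) k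
    (c := fun i => ∑ j : Fin n, if (j : ℕ) < k then ‖D i j‖ ^ 2 else 0)
    (fun i => Finset.sum_nonneg fun j _ => by split_ifs <;> positivity)
    (fun i => by
      rw [← sum_norm_sq_row_of_unitary hDu i]
      refine Finset.sum_le_sum fun j _ => ?_
      split_ifs
      · exact le_rfl
      · positivity)
    (by
      rw [Finset.sum_comm]
      refine Finset.sum_congr rfl fun j _ => ?_
      split_ifs
      · exact sum_norm_sq_col_of_unitary hDu j
      · simp)
  rw [sum_fin_ite_lt (fun i => max (sval A i - τ) 0 ^ 2)] at h7
  linarith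

/-- The water-filling eigenvalue `(ζ σ - 1)⁺`. -/
noncomputable def waterPower (ζ σ : ℝ) : ℝ := max (ζ * σ - 1) 0

theorem waterPower_nonneg (ζ σ : ℝ) : 0 ≤ waterPower ζ σ := le_max_right _ _

theorem waterLevel_sq (b : ℕ) (ζ σ : ℝ) :
    waterLevel b ζ σ ^ 2 = (1 / 2 ^ b) ^ 2 * waterPower ζ σ := by
  rw [waterLevel, mul_pow, Real.sq_sqrt (le_max_right _ _), waterPower]

/-- The `k × n` diagonal matrix with entries `d i`. -/
noncomputable def rectDiag (k n : ℕ) (d : ℕ → ℝ) : Matrix (Fin k) (Fin n) ℂ :=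
  of fun i j => if (i : ℕ) = j then (d i : ℂ) else 0

theorem conjTranspose_rectDiag_mul (d e : ℕ → ℝ) :
    (rectDiag k n d)ᴴ * rectDiag k n e =
      diagonal fun j : Fin n => ((if (j : ℕ) < k then d j * e j else 0 : ℝ) : ℂ) := by
  ext i j
  simp only [Matrix.mul_apply, conjTranspose_apply, rectDiag, of_apply]
  by_cases hi : (i : ℕ) < k
  · rw [Finset.sum_eq_single (⟨i, hi⟩ : Fin k)]
    · by_cases hij : i = j
      · subst hij; simp [hi]
      · have : (i : ℕ) ≠ j := fun h => hij (Fin.ext h)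
        simp [this, hij]
    · intro x _ hx
      have : (x : ℕ) ≠ i := fun h => hx (Fin.ext h)
      simp [this]
    · simp
  · rw [Finset.sum_eq_zero]
    · by_cases hij : i = j
      · subst hij; simp [hi]
      · simp [hij]
    · intro x _
      have : (x : ℕ) ≠ i := fun h => hi (h ▸ x.2)
      simp [this]

theorem frob_mul_rightSingular {A : Matrix (Fin m) (Fin n) ℂ} {V : Matrix (Fin n) (Fin n) ℂ}
    (hV : IsRightSingularMatrix A V) (X : Matrix (Fin n) (Fin k) ℂ) {x : Fin n → ℝ}
    (hX : X * Xᴴ = diagonal fun j => (x j : ℂ)) :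
    frob (A * V * X) = ∑ j : Fin n, sval A j ^ 2 * x j := by
  have hVV : Vᴴ * V = 1 := mem_unitaryGroup_iff'.1 hV.1
  have h : ((frob (A * V * X) : ℝ) : ℂ) = ((∑ j : Fin n, sval A j ^ 2 * x j : ℝ) : ℂ) := by
    have e : (A * V * X)ᴴ * (A * V * X) = Xᴴ * (Vᴴ * (Aᴴ * A * V) * X) := by
      simp only [conjTranspose_mul, Matrix.mul_assoc]
    rw [← trace_conjTranspose_mul_self, e, hV.2, ← Matrix.mul_assoc Vᴴ, hVV, Matrix.one_mul,
      trace_mul_comm, Matrix.mul_assoc, hX, diagonal_mul_diagonal, trace_diagonal]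
    push_cast
    rfl
  exact_mod_cast h

theorem frob_eq_sum_sval_sq (A : Matrix (Fin m) (Fin n) ℂ) :
    frob A = ∑ j : Fin n, sval A j ^ 2 := by
  obtain ⟨V, hV⟩ := exists_isRightSingularMatrix A
  have h := frob_mul_rightSingular hV (1 : Matrix (Fin n) (Fin n) ℂ) (x := fun _ => 1) (by simp)
  rw [Matrix.mul_one, frob_mul_unitary _ hV.1] at h
  simpa using h

/-- The filter bank attaining the soft-thresholding bound. -/
theorem water_filling_attains {A : Matrix (Fin m) (Fin n) ℂ} {V : Matrix (Fin n) (Fin n) ℂ}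
    (hV : IsRightSingularMatrix A V) {U : Matrix (Fin k) (Fin k) ℂ}
    (hU : U ∈ unitaryGroup (Fin k) ℂ) {ζ : ℝ} (hζ : 0 < ζ) :
    let G := A * V * (rectDiag k n fun i => √(waterPower ζ (sval A i)) /
      (1 + waterPower ζ (sval A i)))ᴴ * Uᴴ
    let B := U * rectDiag k n (fun i => √(waterPower ζ (sval A i))) * Vᴴ
    frob (A - G * B) + frob G + ζ⁻¹ ^ 2 * ∑ i ∈ Finset.range (min k n), waterPower ζ (sval A i) =
      frob A - ∑ i ∈ Finset.range (min k n), max (sval A i - ζ⁻¹) 0 ^ 2 ∧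
    frob G = ζ⁻¹ ^ 2 * ∑ i ∈ Finset.range (min k n), waterPower ζ (sval A i) := by
  -- `G` is the Wiener solution `A (1 + Bᴴ B)⁻¹ Bᴴ` for this `B`: the diagonal entries `√β` become
  -- `√β / (1 + β)`.
  intro G B
  set β : ℕ → ℝ := fun i => waterPower ζ (sval A i) with hβ
  have hβ0 : ∀ i, 0 ≤ β i := fun i => waterPower_nonneg _ _
  have hUU : Uᴴ * U = 1 := mem_unitaryGroup_iff'.1 hU
  have hVV : V * Vᴴ = 1 := mem_unitaryGroup_iff.1 hV.1
  set p : Fin n → ℝ := fun j => if (j : ℕ) < k then β j / (1 + β j) else 0 with hp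
  have hGB : G * B = A * V * diagonal (fun j => (p j : ℂ)) * Vᴴ := by
    have e : G * B = A * V * ((rectDiag k n fun i => √(β i) / (1 + β i))ᴴ *
        ((Uᴴ * U) * rectDiag k n fun i => √(β i))) * Vᴴ := by
      simp only [G, B, Matrix.mul_assoc, hβ]
    rw [e, hUU, Matrix.one_mul, conjTranspose_rectDiag_mul]
    congr 4
    funext j
    simp only [hp]
    congr 2
    rw [div_mul_eq_mul_div, Real.mul_self_sqrt (hβ0 _)]
  have hA : A - G * B = A * V * diagonal (fun j => ((1 - p j : ℝ) : ℂ)) * Vᴴ := by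
    have : diagonal (fun j => ((1 - p j : ℝ) : ℂ)) = 1 - diagonal (fun j => (p j : ℂ)) := by
      rw [← diagonal_one, diagonal_sub]
      push_cast
      rfl
    rw [hGB, this, Matrix.mul_sub, Matrix.mul_one, Matrix.sub_mul, Matrix.mul_assoc A V Vᴴ, hVV,
      Matrix.mul_one]
  have h1 : frob (A - G * B) = ∑ j : Fin n, sval A j ^ 2 * (1 - p j) ^ 2 := by
    rw [hA, frob_mul_conjTranspose_unitary _ hV.1]
    refine frob_mul_rightSingular hV _ ?_
    rw [diagonal_conjTranspose, diagonal_mul_diagonal]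
    congr 1
    funext j
    simp [sq]
  have h2 : frob G = ∑ j : Fin n, sval A j ^ 2 *
      (if (j : ℕ) < k then √(β j) / (1 + β j) * (√(β j) / (1 + β j)) else 0) := by
    simp only [G]
    rw [frob_mul_conjTranspose_unitary _ hU]
    refine frob_mul_rightSingular hV _ ?_
    rw [conjTranspose_conjTranspose, conjTranspose_rectDiag_mul]
  -- Where the power `β` is positive, `1 + β = ζ σ`; so the energy of `G` equals the power penalty
  -- term by term.
  have key : ∀ i : ℕ, sval A i ^ 2 * (√(β i) / (1 + β i) * (√(β i) / (1 + β i))) =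
      ζ⁻¹ ^ 2 * β i := by
    intro i
    rw [div_mul_div_comm, Real.mul_self_sqrt (hβ0 i)]
    rcases le_total (ζ * sval A i) 1 with h | h
    · have : β i = 0 := max_eq_right (by linarith)
      simp [this]
    · have e : β i = ζ * sval A i - 1 := max_eq_left (by linarith)
      have hs : sval A i ≠ 0 := by rintro h0; rw [h0] at h; simp at h; linarith
      rw [e]
      field_simp
      ring
  have key2 : ∀ i : ℕ, sval A i ^ 2 * (1 - β i / (1 + β i)) ^ 2 + ζ⁻¹ ^ 2 * β i + ζ⁻¹ ^ 2 * β i =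
      sval A i ^ 2 - max (sval A i - ζ⁻¹) 0 ^ 2 := by
    intro i
    rcases le_total (ζ * sval A i) 1 with h | h
    · have : β i = 0 := max_eq_right (by linarith)
      have h' : sval A i ≤ ζ⁻¹ := by rwa [← one_div, le_div_iff₀' hζ]
      rw [this, max_eq_right (by linarith)]
      simp
    · have e : β i = ζ * sval A i - 1 := max_eq_left (by linarith)
      have h' : ζ⁻¹ ≤ sval A i := by rwa [← one_div, div_le_iff₀' hζ]
      have hs : sval A i ≠ 0 := by rintro h0; rw [h0] at h; simp at h; linarith
      rw [e, max_eq_left (by linarith)]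
      field_simp
      ring
  have h3 : frob G = ζ⁻¹ ^ 2 * ∑ i ∈ Finset.range (min k n), β i := by
    rw [h2, ← sum_fin_ite_lt, Finset.mul_sum]
    refine Finset.sum_congr rfl fun j _ => ?_
    split_ifs
    · exact key j
    · simp
  refine ⟨?_, h3⟩
  rw [h3, h1, frob_eq_sum_sval_sq, ← sum_fin_ite_lt (fun i => max (sval A i - ζ⁻¹) 0 ^ 2),
    ← sum_fin_ite_lt β, Finset.mul_sum, ← Finset.sum_add_distrib, ← Finset.sum_add_distrib,
    ← Finset.sum_sub_distrib]
  refine Finset.sum_congr rfl fun j _ => ?_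
  simp only [hp]
  split_ifs
  · exact key2 j
  · simp

end Frobenius

/-! ### Output power of a filter row; rows of finite variance -/

section OutputPSD

open Matrix

variable {M : ℕ}

theorem sqrt_isHermitian (C : Matrix (Fin M) (Fin M) ℂ) : (CFC.sqrt C)ᴴ = CFC.sqrt C :=
  (nonneg_iff_posSemidef.1 (CFC.sqrt_nonneg C)).1

/-- Splitting `C` as the square of its Hermitian root turns the quadratic form into a squared
Euclidean length. This is where whitening by the square root enters. -/
theorem outPSD_eq_sum_norm_sq {C : Matrix (Fin M) (Fin M) ℂ} (hC : C.PosSemidef)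
    (h : Fin M → ℂ) : outPSD C h = ∑ m, ‖(h ᵥ* CFC.sqrt C) m‖ ^ 2 := by
  set S := CFC.sqrt C with hS
  have hSS : S * S = C := CFC.sqrt_mul_sqrt_self C (nonneg_iff_posSemidef.2 hC)
  have hSH : ∀ i j, starRingEnd ℂ (S i j) = S j i := fun i j => by
    rw [← Complex.star_def, ← conjTranspose_apply, sqrt_isHermitian]
  have e : (∑ i, ∑ j, h i * C i j * starRingEnd ℂ (h j)) =
      ((∑ m, ‖(h ᵥ* S) m‖ ^ 2 : ℝ) : ℂ) := by
    rw [Complex.ofReal_sum]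
    have h1 : ∀ m, ((‖(h ᵥ* S) m‖ ^ 2 : ℝ) : ℂ) =
        ∑ i, ∑ j, h i * S i m * (starRingEnd ℂ (h j) * S m j) := by
      intro m
      rw [← Complex.normSq_eq_norm_sq, ← Complex.mul_conj]
      simp only [vecMul, dotProduct]
      rw [map_sum, Finset.sum_mul_sum]
      refine Finset.sum_congr rfl fun i _ => Finset.sum_congr rfl fun j _ => ?_
      rw [map_mul, hSH]
    simp only [h1]
    symm
    rw [Finset.sum_comm]
    refine Finset.sum_congr rfl fun i _ => ?_
    rw [Finset.sum_comm]
    refine Finset.sum_congr rfl fun j _ => ?_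
    rw [← hSS, Matrix.mul_apply, Finset.mul_sum, Finset.sum_mul]
    refine Finset.sum_congr rfl fun m _ => ?_
    ring
  rw [outPSD, e, Complex.ofReal_re]

theorem outPSD_nonneg {C : Matrix (Fin M) (Fin M) ℂ} (hC : C.PosSemidef) (h : Fin M → ℂ) :
    0 ≤ outPSD C h := by
  rw [outPSD_eq_sum_norm_sq hC]
  positivity

theorem outPSD_smul (C : Matrix (Fin M) (Fin M) ℂ) (c : ℂ) (h : Fin M → ℂ) :
    outPSD C (fun m => c * h m) = ‖c‖ ^ 2 * outPSD C h := by
  have e : (∑ i, ∑ j, c * h i * C i j * starRingEnd ℂ (c * h j)) =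
      ((‖c‖ ^ 2 : ℝ) : ℂ) * ∑ i, ∑ j, h i * C i j * starRingEnd ℂ (h j) := by
    rw [← Complex.normSq_eq_norm_sq, ← Complex.mul_conj, Finset.mul_sum]
    refine Finset.sum_congr rfl fun i _ => ?_
    rw [Finset.mul_sum]
    refine Finset.sum_congr rfl fun j _ => ?_
    rw [map_mul]
    ring
  rw [outPSD, e, Complex.re_ofReal_mul, outPSD]

/-- The triangle inequality followed by Young's inequality. The factor `1 + δ`, arbitrarily close to
`1`, lets squared norms pass to limits through `le_of_approx`. -/
theorem norm_sq_le_add (a b : ℂ) {δ : ℝ} (hδ : 0 < δ) :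
    ‖a‖ ^ 2 ≤ (1 + δ) * ‖b‖ ^ 2 + (1 + δ⁻¹) * ‖a - b‖ ^ 2 := by
  have h1 : ‖a‖ ≤ ‖b‖ + ‖a - b‖ := by
    have := norm_add_le b (a - b)
    rwa [add_sub_cancel] at this
  have h2 : ‖a‖ ^ 2 ≤ (‖b‖ + ‖a - b‖) ^ 2 := pow_le_pow_left₀ (norm_nonneg _) h1 2
  have h3 : 0 ≤ δ⁻¹ * (δ * ‖b‖ - ‖a - b‖) ^ 2 := by positivity
  have h4 : δ⁻¹ * (δ * ‖b‖ - ‖a - b‖) ^ 2 = δ * ‖b‖ ^ 2 - 2 * ‖b‖ * ‖a - b‖ +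
      δ⁻¹ * ‖a - b‖ ^ 2 := by
    field_simp
    ring
  nlinarith

theorem outPSD_le_add {C : Matrix (Fin M) (Fin M) ℂ} (hC : C.PosSemidef) (h h' : Fin M → ℂ)
    {δ : ℝ} (hδ : 0 < δ) :
    outPSD C h ≤ (1 + δ) * outPSD C h' + (1 + δ⁻¹) * outPSD C (fun m => h m - h' m) := by
  simp only [outPSD_eq_sum_norm_sq hC]
  rw [Finset.mul_sum, Finset.mul_sum, ← Finset.sum_add_distrib]
  refine Finset.sum_le_sum fun m _ => ?_
  have : ((fun m => h m - h' m) ᵥ* CFC.sqrt C) m =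
      (h ᵥ* CFC.sqrt C) m - (h' ᵥ* CFC.sqrt C) m := by
    rw [show (fun m => h m - h' m) = h - h' from rfl, sub_vecMul, Pi.sub_apply]
  rw [this]
  exact norm_sq_le_add _ _ hδ

theorem outPSD_neg (C : Matrix (Fin M) (Fin M) ℂ) (h : Fin M → ℂ) :
    outPSD C (fun m => -h m) = outPSD C h := by
  have := outPSD_smul C (-1) h
  simpa using this

theorem outPSD_add_le {C : Matrix (Fin M) (Fin M) ℂ} (hC : C.PosSemidef) (h h' : Fin M → ℂ) :
    outPSD C (fun m => h m + h' m) ≤ 2 * outPSD C h + 2 * outPSD C h' := by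
  have := outPSD_le_add hC (fun m => h m + h' m) h zero_lt_one
  simp only [add_sub_cancel_left, inv_one] at this
  linarith

/-- The row vectors of frequency responses whose outputs have finite variance. -/
structure IsFiniteVariance (C : ℝ → Matrix (Fin M) (Fin M) ℂ) (h : ℝ → Fin M → ℂ) : Prop where
  measurable : ∀ m, AEStronglyMeasurable (fun f => h f m) volume
  integrable : Integrable (fun f => outPSD (C f) (h f))

theorem aestronglyMeasurable_outPSD {C : ℝ → Matrix (Fin M) (Fin M) ℂ}
    (hC : ∀ i j, AEStronglyMeasurable (fun f => C f i j) volume) {h : ℝ → Fin M → ℂ}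
    (hh : ∀ m, AEStronglyMeasurable (fun f => h f m) volume) :
    AEStronglyMeasurable (fun f => outPSD (C f) (h f)) volume := by
  refine Complex.continuous_re.comp_aestronglyMeasurable ?_
  refine Finset.aestronglyMeasurable_fun_sum _ fun i _ => Finset.aestronglyMeasurable_fun_sum _
    fun j _ => ((hh i).mul (hC i j)).mul ?_
  exact Complex.continuous_conj.comp_aestronglyMeasurable (hh j)

variable {C : ℝ → Matrix (Fin M) (Fin M) ℂ} {h h' : ℝ → Fin M → ℂ}

theorem IsFiniteVariance.add (hC : ∀ f, (C f).PosSemidef)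
    (hCm : ∀ i j, AEStronglyMeasurable (fun f => C f i j) volume)
    (hh : IsFiniteVariance C h) (hh' : IsFiniteVariance C h') :
    IsFiniteVariance C (fun f m => h f m + h' f m) where
  measurable m := (hh.measurable m).add (hh'.measurable m)
  integrable := by
    refine ((hh.integrable.const_mul 2).add (hh'.integrable.const_mul 2)).mono'
      (aestronglyMeasurable_outPSD hCm fun m => (hh.measurable m).add (hh'.measurable m)) ?_
    refine ae_of_all _ fun f => ?_
    rw [Real.norm_eq_abs, abs_of_nonneg (outPSD_nonneg (hC f) _)]
    exact outPSD_add_le (hC f) _ _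

theorem IsFiniteVariance.mul (hC : ∀ f, (C f).PosSemidef)
    (hCm : ∀ i j, AEStronglyMeasurable (fun f => C f i j) volume)
    (hh : IsFiniteVariance C h) {a : ℝ → ℂ} (ha : AEStronglyMeasurable a volume) {B : ℝ}
    (hB : ∀ f, ‖a f‖ ≤ B) : IsFiniteVariance C (fun f m => a f * h f m) where
  measurable m := ha.mul (hh.measurable m)
  integrable := by
    refine (hh.integrable.const_mul (B ^ 2)).mono'
      (aestronglyMeasurable_outPSD hCm fun m => ha.mul (hh.measurable m)) ?_
    refine ae_of_all _ fun f => ?_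
    rw [Real.norm_eq_abs, abs_of_nonneg (outPSD_nonneg (hC f) _), outPSD_smul]
    exact mul_le_mul_of_nonneg_right (pow_le_pow_left₀ (norm_nonneg _) (hB f) 2)
      (outPSD_nonneg (hC f) _)

theorem IsFiniteVariance.sub (hC : ∀ f, (C f).PosSemidef)
    (hCm : ∀ i j, AEStronglyMeasurable (fun f => C f i j) volume)
    (hh : IsFiniteVariance C h) (hh' : IsFiniteVariance C h') :
    IsFiniteVariance C (fun f m => h f m - h' f m) := by
  have := hh.add hC hCm (hh'.mul hC hCm (a := fun _ => -1) (B := 1)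
    aestronglyMeasurable_const (by simp))
  simpa [sub_eq_add_neg] using this

theorem isFiniteVariance_zero : IsFiniteVariance C (fun _ _ => 0) where
  measurable _ := aestronglyMeasurable_const
  integrable := by simp [outPSD]

theorem IsFiniteVariance.sum (hC : ∀ f, (C f).PosSemidef)
    (hCm : ∀ i j, AEStronglyMeasurable (fun f => C f i j) volume) {ι : Type*} (s : Finset ι)
    {g : ι → ℝ → Fin M → ℂ} (hg : ∀ i ∈ s, IsFiniteVariance C (g i)) :
    IsFiniteVariance C (fun f m => ∑ i ∈ s, g i f m) := by
  classical
  induction s using Finset.induction_on with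
  | empty => simpa using isFiniteVariance_zero
  | insert a s ha ih =>
    simp only [Finset.sum_insert ha]
    exact (hg a (Finset.mem_insert_self _ _)).add hC hCm
      (ih fun i hi => hg i (Finset.mem_insert_of_mem hi))

theorem isFiniteVariance_of_bounded
    (hCi : ∀ i j, Integrable (fun f => C f i j))
    (hm : ∀ m, AEStronglyMeasurable (fun f => h f m) volume) {B : ℝ}
    (hB : ∀ f m, ‖h f m‖ ≤ B) : IsFiniteVariance C h where
  measurable := hm
  integrable := by
    have hi : Integrable (fun f => ∑ i, ∑ j, B * ‖C f i j‖ * B) :=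
      integrable_finsetSum _ fun i _ => integrable_finsetSum _ fun j _ =>
        ((hCi i j).norm.const_mul B).mul_const B
    refine hi.mono' (aestronglyMeasurable_outPSD (fun i j => (hCi i j).1) hm) ?_
    refine ae_of_all _ fun f => ?_
    rw [outPSD]
    refine ((Complex.abs_re_le_norm _).trans (norm_sum_le _ _)).trans ?_
    refine Finset.sum_le_sum fun i _ => (norm_sum_le _ _).trans (Finset.sum_le_sum fun j _ => ?_)
    rw [norm_mul, norm_mul, RCLike.norm_conj]
    have hB0 : 0 ≤ B := (norm_nonneg _).trans (hB f i)
    gcongr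
    · exact hB f i
    · exact hB f j

end OutputPSD

/-! ### Tapped delay lines: output variance in the frequency domain -/

section Taps

variable {Ω : Type*} [MeasurableSpace Ω] {P : Measure Ω} {M : ℕ} {x : Fin M → ℝ → Ω → ℝ}
  {C : ℝ → Matrix (Fin M) (Fin M) ℂ}

theorem norm_exp_freq (f τ : ℝ) : ‖Complex.exp (-(2 * Real.pi * Complex.I * f * τ))‖ = 1 := by
  rw [Complex.norm_exp]
  simp

theorem norm_exp_freq' (f τ : ℝ) : ‖Complex.exp (2 * Real.pi * Complex.I * f * τ)‖ = 1 := by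
  rw [Complex.norm_exp]
  simp

theorem continuous_tapResponse (c : (Fin M × ℝ) →₀ ℝ) (m : Fin M) :
    Continuous fun f => tapResponse c f m := by
  unfold tapResponse Finsupp.sum
  refine continuous_finsetSum _ fun p _ => ?_
  dsimp only
  split_ifs <;> fun_prop

theorem isFiniteVariance_tapResponse (hx : IsWSSWithPSD P x C) (c : (Fin M × ℝ) →₀ ℝ) :
    IsFiniteVariance C (tapResponse c) := by
  refine isFiniteVariance_of_bounded hx.integrable
    (fun m => (continuous_tapResponse c m).aestronglyMeasurable)
    (B := ∑ p ∈ c.support, |c p|) fun f m => ?_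
  unfold tapResponse Finsupp.sum
  refine (norm_sum_le _ _).trans (Finset.sum_le_sum fun p _ => ?_)
  dsimp only
  split_ifs
  · rw [norm_mul, norm_exp_freq, mul_one, Complex.norm_real, Real.norm_eq_abs]
  · simp

theorem memLp_tapOutput (hx : IsWSSWithPSD P x C) (c : (Fin M × ℝ) →₀ ℝ) (t : ℝ) :
    MemLp (tapOutput x c t) 2 P := by
  unfold tapOutput Finsupp.sum
  exact memLp_finsetSum _ fun p _ => (hx.memLp _ _).const_mul _

/-- Both sides expand into the same double sum over pairs of taps; a pair `p`, `q` is matched by the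
autocorrelation formula at lag `q.2 - p.2`. This is the isometry for finite sums, from which the
general one follows by density. -/
theorem integral_tapOutput_sq (hx : IsWSSWithPSD P x C) (c : (Fin M × ℝ) →₀ ℝ) (t : ℝ) :
    ∫ ω, tapOutput x c t ω ^ 2 ∂P = ∫ f, outPSD (C f) (tapResponse c f) := by
  have hprod : ∀ p q : Fin M × ℝ,
      Integrable (fun ω => c p * x p.1 (t - p.2) ω * (c q * x q.1 (t - q.2) ω)) P := fun p q =>
    ((hx.memLp _ _).const_mul _).integrable_mul ((hx.memLp _ _).const_mul _)
  have h1 : ∫ ω, tapOutput x c t ω ^ 2 ∂P = ∑ p ∈ c.support, ∑ q ∈ c.support,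
      c p * c q * ∫ ω, x p.1 (t - p.2) ω * x q.1 (t - q.2) ω ∂P := by
    simp only [tapOutput, Finsupp.sum, sq, Finset.sum_mul_sum]
    rw [integral_finsetSum _ fun p _ => integrable_finsetSum _ fun q _ => hprod p q]
    refine Finset.sum_congr rfl fun p _ => ?_
    rw [integral_finsetSum _ fun q _ => hprod p q]
    refine Finset.sum_congr rfl fun q _ => ?_
    rw [← integral_const_mul]
    congr 1
    funext ω
    ring
  have hint : ∀ p q : Fin M × ℝ, Integrable (fun f : ℝ =>
      (c p * c q : ℂ) * (C f p.1 q.1 * Complex.exp (2 * Real.pi * Complex.I * f *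
        ((q.2 - p.2 : ℝ) : ℂ)))) := by
    intro p q
    refine Integrable.const_mul ?_ _
    refine (hx.integrable p.1 q.1).mul_bdd (c := 1) (by fun_prop) (ae_of_all _ fun f => ?_)
    rw [norm_exp_freq']
  have h2 : ∀ f : ℝ, (∑ i, ∑ j, tapResponse c f i * C f i j * starRingEnd ℂ (tapResponse c f j)) =
      ∑ p ∈ c.support, ∑ q ∈ c.support, (c p * c q : ℂ) * (C f p.1 q.1 *
        Complex.exp (2 * Real.pi * Complex.I * f * ((q.2 - p.2 : ℝ) : ℂ))) := by
    intro f
    have e1 : ∀ F : Fin M → ℂ, ∑ i, tapResponse c f i * F i = ∑ p ∈ c.support,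
        (c p : ℂ) * Complex.exp (-(2 * Real.pi * Complex.I * f * p.2)) * F p.1 := by
      intro F
      simp only [tapResponse, Finsupp.sum, Finset.sum_mul]
      rw [Finset.sum_comm]
      refine Finset.sum_congr rfl fun p _ => ?_
      rw [Finset.sum_eq_single p.1]
      · simp
      · intro i _ hi
        simp [hi.symm]
      · simp
    have e2 : ∀ F : Fin M → ℂ, ∑ j, F j * starRingEnd ℂ (tapResponse c f j) = ∑ q ∈ c.support,
        (c q : ℂ) * Complex.exp (2 * Real.pi * Complex.I * f * q.2) * F q.1 := by
      intro F
      have := congrArg (starRingEnd ℂ) (e1 fun j => starRingEnd ℂ (F j))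
      simp only [map_sum, map_mul, Complex.conj_conj, Complex.conj_ofReal, ← Complex.exp_conj,
        map_neg, Complex.conj_I, map_ofNat] at this
      simp only [mul_comm (F _)]
      rw [this]
      refine Finset.sum_congr rfl fun q _ => ?_
      congr 3
      ring
    simp only [e2 (fun j => tapResponse c f _ * C f _ j)]
    rw [Finset.sum_comm, Finset.sum_comm' (s := c.support) (t := fun _ => c.support)
      (t' := c.support) (s' := fun _ => c.support) (by simp)]
    refine Finset.sum_congr rfl fun q _ => ?_
    have : ∑ i, (c q : ℂ) * Complex.exp (2 * Real.pi * Complex.I * f * q.2) *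
        (tapResponse c f i * C f i q.1) = ∑ i, tapResponse c f i *
        ((c q : ℂ) * Complex.exp (2 * Real.pi * Complex.I * f * q.2) * C f i q.1) :=
      Finset.sum_congr rfl fun i _ => by ring
    rw [this, e1]
    refine Finset.sum_congr rfl fun p _ => ?_
    have e3 : Complex.exp (2 * Real.pi * Complex.I * f * ((q.2 - p.2 : ℝ) : ℂ)) =
        Complex.exp (-(2 * Real.pi * Complex.I * f * p.2)) *
        Complex.exp (2 * Real.pi * Complex.I * f * q.2) := by
      rw [← Complex.exp_add]
      congr 1
      push_cast
      ring
    rw [e3]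
    ring
  have h3 : ((∫ ω, tapOutput x c t ω ^ 2 ∂P : ℝ) : ℂ) =
      ∫ f : ℝ, ∑ i, ∑ j, tapResponse c f i * C f i j * starRingEnd ℂ (tapResponse c f j) := by
    simp only [h2]
    rw [integral_finsetSum _ fun p _ => integrable_finsetSum _ fun q _ => hint p q, h1,
      Complex.ofReal_sum]
    refine Finset.sum_congr rfl fun p _ => ?_
    rw [integral_finsetSum _ fun q _ => hint p q, Complex.ofReal_sum]
    refine Finset.sum_congr rfl fun q _ => ?_
    rw [integral_const_mul, ← hx.autocorrelation p.1 q.1 (t - q.2) (q.2 - p.2)]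
    push_cast
    rw [show t - q.2 + (q.2 - p.2) = t - p.2 by ring]
  have h4 : Integrable fun f : ℝ =>
      ∑ i, ∑ j, tapResponse c f i * C f i j * starRingEnd ℂ (tapResponse c f j) := by
    simp only [h2]
    exact integrable_finsetSum _ fun p _ => integrable_finsetSum _ fun q _ => hint p q
  have h5 := congrArg Complex.re h3
  rw [Complex.ofReal_re] at h5
  rw [h5]
  exact (integral_re h4).symm

end Taps

/-! ### Sums, multiples and shifts of tapped delay lines -/

section TapAlgebra

variable {Ω : Type*} {M : ℕ} {x : Fin M → ℝ → Ω → ℝ}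

theorem tapResponse_add (c d : (Fin M × ℝ) →₀ ℝ) (f : ℝ) (m : Fin M) :
    tapResponse (c + d) f m = tapResponse c f m + tapResponse d f m := by
  unfold tapResponse
  refine Finsupp.sum_add_index' (fun p => by simp) fun p a b => ?_
  split_ifs
  · push_cast; ring
  · simp

theorem tapOutput_add (c d : (Fin M × ℝ) →₀ ℝ) (t : ℝ) (ω : Ω) :
    tapOutput x (c + d) t ω = tapOutput x c t ω + tapOutput x d t ω := by
  unfold tapOutput
  exact Finsupp.sum_add_index' (fun p => by simp) fun p a b => by ring

theorem tapResponse_smul (a : ℝ) (c : (Fin M × ℝ) →₀ ℝ) (f : ℝ) (m : Fin M) :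
    tapResponse (a • c) f m = a * tapResponse c f m := by
  unfold tapResponse
  rw [Finsupp.sum_smul_index' fun p => by simp, Finsupp.sum, Finsupp.sum, Finset.mul_sum]
  refine Finset.sum_congr rfl fun p _ => ?_
  split_ifs
  · rw [smul_eq_mul, Complex.ofReal_mul, mul_assoc]
  · simp

theorem tapOutput_smul (a : ℝ) (c : (Fin M × ℝ) →₀ ℝ) (t : ℝ) (ω : Ω) :
    tapOutput x (a • c) t ω = a * tapOutput x c t ω := by
  unfold tapOutput
  rw [Finsupp.sum_smul_index' fun p => by simp, Finsupp.sum, Finsupp.sum, Finset.mul_sum]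
  refine Finset.sum_congr rfl fun p _ => ?_
  rw [smul_eq_mul, mul_assoc]

/-- Advance all taps by `t`. -/
noncomputable def tapShift (t : ℝ) (c : (Fin M × ℝ) →₀ ℝ) : (Fin M × ℝ) →₀ ℝ :=
  c.mapDomain fun p => (p.1, p.2 - t)

theorem tapResponse_tapShift (t : ℝ) (c : (Fin M × ℝ) →₀ ℝ) (f : ℝ) (m : Fin M) :
    tapResponse (tapShift t c) f m =
      Complex.exp (2 * Real.pi * Complex.I * f * t) * tapResponse c f m := by
  unfold tapResponse tapShift
  rw [Finsupp.sum_mapDomain_index (fun p => by simp) (fun p a b => by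
    split_ifs
    · push_cast; ring
    · simp), Finsupp.sum, Finsupp.sum, Finset.mul_sum]
  refine Finset.sum_congr rfl fun p _ => ?_
  dsimp only
  split_ifs
  · rw [mul_left_comm, ← Complex.exp_add]
    congr 2
    push_cast
    ring
  · simp

theorem tapOutput_tapShift (t : ℝ) (c : (Fin M × ℝ) →₀ ℝ) (ω : Ω) :
    tapOutput x (tapShift t c) 0 ω = tapOutput x c t ω := by
  unfold tapOutput tapShift
  rw [Finsupp.sum_mapDomain_index (fun p => by simp) (fun p a b => by ring)]
  refine Finset.sum_congr rfl fun p _ => ?_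
  dsimp only
  rw [show (0 : ℝ) - (p.2 - t) = t - p.2 by ring]

theorem measurable_inputSigma (m : Fin M) (u : ℝ) : Measurable[inputSigma x] (x m u) :=
  Measurable.of_comap_le (le_iSup_of_le m (le_iSup_of_le u le_rfl))

theorem measurable_tapOutput (c : (Fin M × ℝ) →₀ ℝ) (t : ℝ) :
    Measurable[inputSigma x] (tapOutput x c t) := by
  unfold tapOutput Finsupp.sum
  exact Finset.measurable_sum _ fun p _ => (measurable_inputSigma _ _).const_mul _

end TapAlgebra

/-! ### The spectral isometry for mean-square filtered signals -/

section Filtered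

variable {Ω : Type*} [MeasurableSpace Ω] {P : Measure Ω} {M : ℕ} {x : Fin M → ℝ → Ω → ℝ}
  {C : ℝ → Matrix (Fin M) (Fin M) ℂ} {h h' : ℝ → Fin M → ℂ} {t : ℝ} {Y Y' : Ω → ℝ}

/-- Moving the observation time to `0` costs a phase factor in the response. All samples thus refer
to one common time and can be combined linearly. -/
theorem IsFilteredAt.shift (hY : IsFilteredAt P x C h t Y) :
    IsFilteredAt P x C (fun f m => Complex.exp (2 * Real.pi * Complex.I * f * t) * h f m) 0 Y := by
  refine ⟨hY.1, fun ε hε => ?_⟩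
  obtain ⟨c, h1, h2⟩ := hY.2 ε hε
  refine ⟨tapShift t c, ?_, ?_⟩
  · simp only [tapResponse_tapShift, ← mul_sub, outPSD_smul, norm_exp_freq', one_pow, one_mul]
    exact h1
  · simpa only [tapOutput_tapShift] using h2

theorem IsFilteredAt.const_mul (hY : IsFilteredAt P x C h t Y) (a : ℝ) :
    IsFilteredAt P x C (fun f m => a * h f m) t (fun ω => a * Y ω) := by
  refine ⟨hY.1.const_mul a, fun ε hε => ?_⟩
  -- Dividing by `a ^ 2 + 1` rather than `a ^ 2` covers `a = 0`.
  obtain ⟨c, h1, h2⟩ := hY.2 (ε / (a ^ 2 + 1)) (by positivity)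
  have ha : a ^ 2 * (ε / (a ^ 2 + 1)) ≤ ε := by
    rw [mul_div_assoc', div_le_iff₀ (by positivity)]
    nlinarith
  refine ⟨a • c, ?_, ?_⟩
  · simp only [tapResponse_smul, ← mul_sub, outPSD_smul, Complex.norm_real, Real.norm_eq_abs,
      sq_abs]
    rw [integral_const_mul]
    exact (mul_le_mul_of_nonneg_left h1 (sq_nonneg a)).trans ha
  · simp only [tapOutput_smul, ← mul_sub, mul_pow]
    rw [integral_const_mul]
    exact (mul_le_mul_of_nonneg_left h2 (sq_nonneg a)).trans ha

theorem isFilteredAt_zero : IsFilteredAt P x C (fun _ _ => 0) t (fun _ => 0) := by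
  refine ⟨MemLp.zero, fun ε hε => ⟨0, ?_, ?_⟩⟩
  · simpa [tapResponse, outPSD] using hε.le
  · simpa [tapOutput] using hε.le

theorem IsFilteredAt.add (hx : IsWSSWithPSD P x C) (hh : IsFiniteVariance C h)
    (hh' : IsFiniteVariance C h') (hY : IsFilteredAt P x C h t Y)
    (hY' : IsFilteredAt P x C h' t Y') :
    IsFilteredAt P x C (fun f m => h f m + h' f m) t (fun ω => Y ω + Y' ω) := by
  have hCm : ∀ i j, AEStronglyMeasurable (fun f => C f i j) volume := fun i j =>
    (hx.integrable i j).1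
  refine ⟨hY.1.add hY'.1, fun ε hε => ?_⟩
  obtain ⟨c, h1, h2⟩ := hY.2 (ε / 4) (by positivity)
  obtain ⟨d, h3, h4⟩ := hY'.2 (ε / 4) (by positivity)
  refine ⟨c + d, ?_, ?_⟩
  · have i1 := (hh.sub hx.posSemidef hCm (isFiniteVariance_tapResponse hx c)).integrable
    have i2 := (hh'.sub hx.posSemidef hCm (isFiniteVariance_tapResponse hx d)).integrable
    have e : ∫ f, outPSD (C f) (fun m => h f m + h' f m - tapResponse (c + d) f m) ≤
        ∫ f, (2 * outPSD (C f) (fun m => h f m - tapResponse c f m) +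
          2 * outPSD (C f) (fun m => h' f m - tapResponse d f m)) := by
      refine integral_mono_of_nonneg (ae_of_all _ fun f => outPSD_nonneg (hx.posSemidef f) _)
        ((i1.const_mul 2).add (i2.const_mul 2)) (ae_of_all _ fun f => ?_)
      refine le_trans (le_of_eq ?_) (outPSD_add_le (hx.posSemidef f) _ _)
      simp only [tapResponse_add, add_sub_add_comm]
    rw [integral_add (i1.const_mul 2) (i2.const_mul 2), integral_const_mul,
      integral_const_mul] at e
    linarith
  · have i1 := (hY.1.sub (memLp_tapOutput hx c t)).integrable_sq
    have i2 := (hY'.1.sub (memLp_tapOutput hx d t)).integrable_sq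
    simp only [Pi.sub_apply] at i1 i2
    have e : ∫ ω, (Y ω + Y' ω - tapOutput x (c + d) t ω) ^ 2 ∂P ≤
        ∫ ω, (2 * (Y ω - tapOutput x c t ω) ^ 2 + 2 * (Y' ω - tapOutput x d t ω) ^ 2) ∂P := by
      refine integral_mono_of_nonneg (ae_of_all _ fun ω => sq_nonneg _)
        ((i1.const_mul 2).add (i2.const_mul 2)) (ae_of_all _ fun ω => ?_)
      simp only [tapOutput_add]
      nlinarith [sq_nonneg ((Y ω - tapOutput x c t ω) - (Y' ω - tapOutput x d t ω))]
    rw [integral_add (i1.const_mul 2) (i2.const_mul 2), integral_const_mul,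
      integral_const_mul] at e
    linarith

theorem IsFilteredAt.sum (hx : IsWSSWithPSD P x C) {ι : Type*} (s : Finset ι)
    {g : ι → ℝ → Fin M → ℂ} {Z : ι → Ω → ℝ} (hg : ∀ i ∈ s, IsFiniteVariance C (g i))
    (hZ : ∀ i ∈ s, IsFilteredAt P x C (g i) t (Z i)) :
    IsFilteredAt P x C (fun f m => ∑ i ∈ s, g i f m) t (fun ω => ∑ i ∈ s, Z i ω) := by
  classical
  induction s using Finset.induction_on with
  | empty => simpa using isFilteredAt_zero
  | insert a s ha ih =>
    simp only [Finset.sum_insert ha]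
    exact (hZ a (Finset.mem_insert_self _ _)).add hx (hg a (Finset.mem_insert_self _ _))
      (IsFiniteVariance.sum hx.posSemidef (fun i j => (hx.integrable i j).1) s
        fun i hi => hg i (Finset.mem_insert_of_mem hi))
      (ih (fun i hi => hg i (Finset.mem_insert_of_mem hi))
        fun i hi => hZ i (Finset.mem_insert_of_mem hi))

/-- First `ε → 0` with `δ` fixed, then `δ → 0`. The intermediate `T` is close to both quantities in
the sense of squared norms; this replaces continuity of the norm along an approximating sequence. -/
theorem le_of_approx {A B : ℝ} (H : ∀ ε > 0, ∃ T,
    (∀ δ > 0, A ≤ (1 + δ) * T + (1 + δ⁻¹) * ε) ∧ ∀ δ > 0, T ≤ (1 + δ) * B + (1 + δ⁻¹) * ε) :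
    A ≤ B := by
  have h1 : ∀ δ > 0, A ≤ (1 + δ) * ((1 + δ) * B) := by
    intro δ hδ
    refine le_of_forall_pos_le_add fun ε hε => ?_
    obtain ⟨T, hA, hB⟩ := H (ε / ((1 + δ) * (1 + δ⁻¹) + (1 + δ⁻¹))) (by positivity)
    have h2 := hA δ hδ
    have h3 := mul_le_mul_of_nonneg_left (hB δ hδ) (by positivity : 0 ≤ 1 + δ)
    have h4 : ((1 + δ) * (1 + δ⁻¹) + (1 + δ⁻¹)) *
        (ε / ((1 + δ) * (1 + δ⁻¹) + (1 + δ⁻¹))) = ε := by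
      field_simp
    nlinarith
  have h2 : Tendsto (fun δ : ℝ => (1 + δ) * ((1 + δ) * B)) (𝓝[>] 0) (𝓝 ((1 + 0) * ((1 + 0) * B))) :=
    (Continuous.tendsto (by fun_prop) _).mono_left nhdsWithin_le_nhds
  simp only [add_zero, one_mul] at h2
  exact ge_of_tendsto h2 (eventually_mem_nhdsWithin.mono fun δ hδ => h1 δ hδ)

theorem sq_le_add (a b : ℝ) {δ : ℝ} (hδ : 0 < δ) :
    a ^ 2 ≤ (1 + δ) * b ^ 2 + (1 + δ⁻¹) * (a - b) ^ 2 := by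
  have := norm_sq_le_add (a : ℂ) b hδ
  rw [← Complex.ofReal_sub] at this
  simpa only [Complex.norm_real, Real.norm_eq_abs, sq_abs] using this

theorem integral_sq_le_add {X : Ω → ℝ} (hY : MemLp Y 2 P) (hX : MemLp X 2 P) {δ : ℝ}
    (hδ : 0 < δ) : ∫ ω, Y ω ^ 2 ∂P ≤
      (1 + δ) * ∫ ω, X ω ^ 2 ∂P + (1 + δ⁻¹) * ∫ ω, (Y ω - X ω) ^ 2 ∂P := by
  have i1 := hX.integrable_sq
  have i2 := (hY.sub hX).integrable_sq
  simp only [Pi.sub_apply] at i2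
  rw [← integral_const_mul, ← integral_const_mul, ← integral_add (i1.const_mul _) (i2.const_mul _)]
  exact integral_mono hY.integrable_sq ((i1.const_mul _).add (i2.const_mul _))
    fun ω => sq_le_add _ _ hδ

theorem integral_outPSD_le_add (hx : IsWSSWithPSD P x C) (hh : IsFiniteVariance C h)
    (hh' : IsFiniteVariance C h') {δ : ℝ} (hδ : 0 < δ) : ∫ f, outPSD (C f) (h f) ≤
      (1 + δ) * (∫ f, outPSD (C f) (h' f)) +
        (1 + δ⁻¹) * (∫ f, outPSD (C f) (fun m => h f m - h' f m)) := by
  have i1 := hh'.integrable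
  have i2 := (hh.sub hx.posSemidef (fun i j => (hx.integrable i j).1) hh').integrable
  rw [← integral_const_mul, ← integral_const_mul, ← integral_add (i1.const_mul _) (i2.const_mul _)]
  exact integral_mono hh.integrable ((i1.const_mul _).add (i2.const_mul _))
    fun f => outPSD_le_add (hx.posSemidef f) _ _ hδ

/-- The isometry between filtered signals and their frequency responses. -/
theorem IsFilteredAt.integral_sq (hx : IsWSSWithPSD P x C) (hh : IsFiniteVariance C h)
    (hY : IsFilteredAt P x C h t Y) : ∫ ω, Y ω ^ 2 ∂P = ∫ f, outPSD (C f) (h f) := by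
  refine le_antisymm (le_of_approx fun ε hε => ?_) (le_of_approx fun ε hε => ?_)
  · obtain ⟨c, h1, h2⟩ := hY.2 ε hε
    refine ⟨∫ ω, tapOutput x c t ω ^ 2 ∂P, fun δ hδ => ?_, fun δ hδ => ?_⟩
    · refine (integral_sq_le_add hY.1 (memLp_tapOutput hx c t) hδ).trans ?_
      gcongr
    · rw [integral_tapOutput_sq hx]
      refine (integral_outPSD_le_add hx (isFiniteVariance_tapResponse hx c) hh hδ).trans ?_
      have : ∀ f, outPSD (C f) (fun m => tapResponse c f m - h f m) =
          outPSD (C f) (fun m => h f m - tapResponse c f m) := fun f => by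
        rw [← outPSD_neg]; simp only [neg_sub]
      simp only [this]
      gcongr
  · obtain ⟨c, h1, h2⟩ := hY.2 ε hε
    refine ⟨∫ ω, tapOutput x c t ω ^ 2 ∂P, fun δ hδ => ?_, fun δ hδ => ?_⟩
    · rw [integral_tapOutput_sq hx]
      refine (integral_outPSD_le_add hx hh (isFiniteVariance_tapResponse hx c) hδ).trans ?_
      gcongr
    · refine (integral_sq_le_add (memLp_tapOutput hx c t) hY.1 hδ).trans ?_
      have : ∀ ω, (tapOutput x c t ω - Y ω) ^ 2 = (Y ω - tapOutput x c t ω) ^ 2 := fun ω => by ring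
      simp only [this]
      gcongr

theorem integrable_mul_of_memLp {e d : Ω → ℝ} (he : MemLp e 2 P) (hd : MemLp d 2 P) :
    Integrable (fun ω => e ω * d ω) P := he.integrable_mul hd

theorem abs_integral_mul_le {e d : Ω → ℝ} (he : MemLp e 2 P) (hd : MemLp d 2 P) {δ : ℝ}
    (hδ : 0 < δ) : |∫ ω, e ω * d ω ∂P| ≤ δ * ∫ ω, e ω ^ 2 ∂P + δ⁻¹ * ∫ ω, d ω ^ 2 ∂P := by
  have i1 := he.integrable_sq
  have i2 := hd.integrable_sq
  rw [← integral_const_mul, ← integral_const_mul, ← integral_add (i1.const_mul _) (i2.const_mul _)]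
  refine abs_integral_le_integral_abs.trans (integral_mono (integrable_mul_of_memLp he hd).abs
    ((i1.const_mul _).add (i2.const_mul _)) fun ω => ?_)
  have h3 : δ⁻¹ * (δ * |e ω| - |d ω|) ^ 2 = δ * e ω ^ 2 - 2 * (|e ω| * |d ω|) + δ⁻¹ * d ω ^ 2 := by
    rw [← sq_abs (e ω), ← sq_abs (d ω)]
    field_simp
    ring
  have h4 : 0 ≤ δ⁻¹ * (δ * |e ω| - |d ω|) ^ 2 := by positivity
  have h5 : 0 ≤ |e ω| * |d ω| := by positivity
  simp only [abs_mul]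
  linarith

/-- Orthogonality passes to mean-square limits. -/
theorem integral_mul_eq_zero_of_approx {e : Ω → ℝ} (he : MemLp e 2 P) (hY : MemLp Y 2 P)
    (H : ∀ ε > 0, ∃ X, MemLp X 2 P ∧ ∫ ω, e ω * X ω ∂P = 0 ∧ ∫ ω, (Y ω - X ω) ^ 2 ∂P ≤ ε) :
    ∫ ω, e ω * Y ω ∂P = 0 := by
  have h0 : 0 ≤ ∫ ω, e ω ^ 2 ∂P := integral_nonneg fun _ => sq_nonneg _
  refine abs_nonpos_iff.1 (le_of_forall_pos_le_add fun r hr => ?_)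
  set δ := r / (∫ ω, e ω ^ 2 ∂P + 1) with hδ
  have hδ0 : 0 < δ := by positivity
  obtain ⟨X, hX, hX0, hXε⟩ := H (δ ^ 2) (by positivity)
  have e1 : ∫ ω, e ω * Y ω ∂P = ∫ ω, e ω * (Y ω - X ω) ∂P := by
    simp only [mul_sub]
    rw [integral_sub (integrable_mul_of_memLp he hY) (integrable_mul_of_memLp he hX), hX0, sub_zero]
  rw [e1, zero_add]
  have h1 := abs_integral_mul_le he (hY.sub hX) hδ0
  simp only [Pi.sub_apply] at h1
  refine h1.trans ?_
  have h2 : δ⁻¹ * ∫ ω, (Y ω - X ω) ^ 2 ∂P ≤ δ⁻¹ * δ ^ 2 := by gcongr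
  have h3 : δ⁻¹ * δ ^ 2 = δ := by field_simp
  have h4 : δ * (∫ ω, e ω ^ 2 ∂P + 1) = r := by rw [hδ]; field_simp
  linarith

/-- Orthogonality to the inputs extends to finite combinations of taps and then to their mean-square
limits. It serves both for the quantization noise and for the residual of the MMSE estimate. -/
theorem IsFilteredAt.integral_mul_eq_zero (hx : IsWSSWithPSD P x C)
    (hY : IsFilteredAt P x C h t Y) {e : Ω → ℝ} (he : MemLp e 2 P)
    (hex : ∀ m u, ∫ ω, e ω * x m u ω ∂P = 0) : ∫ ω, e ω * Y ω ∂P = 0 := by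
  refine integral_mul_eq_zero_of_approx he hY.1 fun ε hε => ?_
  obtain ⟨c, -, h2⟩ := hY.2 ε hε
  refine ⟨tapOutput x c t, memLp_tapOutput hx c t, ?_, h2⟩
  simp only [tapOutput, Finsupp.sum, Finset.mul_sum]
  rw [integral_finsetSum _ fun p _ => integrable_mul_of_memLp he ((hx.memLp _ _).const_mul _)]
  refine Finset.sum_eq_zero fun p _ => ?_
  have : ∀ ω, e ω * (c p * x p.1 (t - p.2) ω) = c p * (e ω * x p.1 (t - p.2) ω) := fun ω => by ring
  simp only [this]
  rw [integral_const_mul, hex, mul_zero]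

theorem inputSigma_le (hx : ∀ m u, Measurable (x m u)) :
    inputSigma x ≤ (inferInstance : MeasurableSpace Ω) :=
  iSup_le fun m => iSup_le fun u => (hx m u).comap_le

/-- Mean-square convergence of tapped delay lines gives almost everywhere convergence along a
subsequence, and the pointwise limit is measurable in the inputs. Independence of the dither is
assumed only relative to the σ-algebra of inputs and task, so such a version of the filter output is
needed. -/
theorem IsFilteredAt.exists_inputSigma_measurable (hx : IsWSSWithPSD P x C)
    (hY : IsFilteredAt P x C h t Y) : ∃ Z : Ω → ℝ, Measurable[inputSigma x] Z ∧ Y =ᵐ[P] Z := by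
  have hc : ∀ n : ℕ, ∃ c, ∫ ω, (Y ω - tapOutput x c t ω) ^ 2 ∂P ≤ 1 / ((n : ℝ) + 1) := fun n => by
    obtain ⟨c, -, h2⟩ := hY.2 (1 / ((n : ℝ) + 1)) (by positivity)
    exact ⟨c, h2⟩
  choose c hc using hc
  have hlim : Tendsto (fun n => eLpNorm (tapOutput x (c n) t - Y) 2 P) atTop (𝓝 0) := by
    have h1 : ∀ n, eLpNorm (tapOutput x (c n) t - Y) 2 P =
        ENNReal.ofReal ((∫ ω, (Y ω - tapOutput x (c n) t ω) ^ 2 ∂P) ^ (2⁻¹ : ℝ)) := by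
      intro n
      rw [((memLp_tapOutput hx (c n) t).sub hY.1).eLpNorm_eq_integral_rpow_norm
        (by norm_num) (by norm_num)]
      congr 2
      · congr 1
        funext ω
        simp only [Pi.sub_apply, Real.norm_eq_abs, ENNReal.toReal_ofNat, Real.rpow_two, sq_abs]
        ring
    simp only [h1]
    rw [← ENNReal.ofReal_zero]
    refine ENNReal.tendsto_ofReal ?_
    have h2 : Tendsto (fun n => ∫ ω, (Y ω - tapOutput x (c n) t ω) ^ 2 ∂P) atTop (𝓝 0) :=
      squeeze_zero (fun n => integral_nonneg fun _ => sq_nonneg _) hc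
        tendsto_one_div_add_atTop_nhds_zero_nat
    have h3 := h2.rpow_const (p := (2⁻¹ : ℝ)) (Or.inr (by norm_num))
    rwa [Real.zero_rpow (by norm_num)] at h3
  have hm := tendstoInMeasure_of_tendsto_eLpNorm (two_ne_zero)
    (fun n => (memLp_tapOutput hx (c n) t).1) hY.1.1 hlim
  obtain ⟨ns, -, hns⟩ := hm.exists_seq_tendsto_ae
  refine ⟨fun ω => limUnder atTop fun n => tapOutput x (c (ns n)) t ω, ?_, ?_⟩
  · exact (@StronglyMeasurable.limUnder ℕ Ω ℝ (inputSigma x) _ _ atTop _ _ _ _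
      fun n => (measurable_tapOutput _ _).stronglyMeasurable).measurable
  · filter_upwards [hns] with ω hω
    exact hω.limUnder_eq.symm

end Filtered

/-! ### Triangular dither and the moments of the quantizer error -/

section Triangular

variable {Δ : ℝ}

/-- The triangular distribution of width `2Δ`. -/
noncomputable def triangular (Δ : ℝ) : Measure ℝ :=
  volume.withDensity fun r => ENNReal.ofReal (ditherPdf Δ r)

theorem measurable_ditherPdf : Measurable (ditherPdf Δ) := by
  unfold ditherPdf
  refine Measurable.ite (measurableSet_le (by fun_prop) measurable_const) (by fun_prop)
    measurable_const

theorem ditherPdf_nonneg (hΔ : 0 < Δ) (r : ℝ) : 0 ≤ ditherPdf Δ r := by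
  unfold ditherPdf
  split_ifs with h
  · have : |r| / Δ ≤ 1 := (div_le_one hΔ).2 h
    have : 0 ≤ 1 - |r| / Δ := by linarith
    positivity
  · exact le_rfl

theorem ditherPdf_neg (r : ℝ) : ditherPdf Δ (-r) = ditherPdf Δ r := by
  simp [ditherPdf]

theorem integral_triangular (hΔ : 0 < Δ) (g : ℝ → ℝ) :
    ∫ w, g w ∂(triangular Δ) = ∫ w, ditherPdf Δ w * g w := by
  rw [triangular, integral_withDensity_eq_integral_toReal_smul
    measurable_ditherPdf.ennreal_ofReal (by simp)]
  simp only [ENNReal.toReal_ofReal (ditherPdf_nonneg hΔ _), smul_eq_mul]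

theorem integral_Ioi_ditherPdf (g : ℝ → ℝ) {s : ℝ} (hs : 0 ≤ s) (hsΔ : s ≤ Δ) :
    ∫ w in Set.Ioi s, ditherPdf Δ w * g w = ∫ w in s..Δ, 1 / Δ * (1 - w / Δ) * g w := by
  have h := setIntegral_eq_of_subset_of_forall_sdiff_eq_zero (μ := volume)
    (f := fun w => ditherPdf Δ w * g w) measurableSet_Ioi
    (Set.Ioc_subset_Ioi_self : Set.Ioc s Δ ⊆ Set.Ioi s) (by
      intro w hw
      have h0 : 0 < w := hs.trans_lt hw.1
      have h1 : ¬ w ≤ Δ := fun h => hw.2 ⟨hw.1, h⟩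
      simp [ditherPdf, abs_of_pos h0, h1])
  rw [intervalIntegral.integral_of_le hsΔ, h]
  refine setIntegral_congr_fun measurableSet_Ioc fun w hw => ?_
  have h0 : 0 < w := hs.trans_lt hw.1
  simp only [ditherPdf, abs_of_pos h0, if_pos hw.2]

theorem measureReal_triangular_Ioi (hΔ : 0 < Δ) {s : ℝ} (hs : 0 ≤ s) (hsΔ : s ≤ Δ) :
    (triangular Δ).real (Set.Ioi s) = (1 - s / Δ) ^ 2 / 2 := by
  have h1 : (triangular Δ).real (Set.Ioi s) = ∫ w in Set.Ioi s, ditherPdf Δ w * 1 := by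
    rw [← integral_indicator_one measurableSet_Ioi, integral_triangular hΔ,
      ← integral_indicator measurableSet_Ioi]
    congr 1
    funext w
    by_cases h : w ∈ Set.Ioi s <;> simp [h]
  rw [h1, integral_Ioi_ditherPdf _ hs hsΔ]
  simp only [mul_one]
  rw [intervalIntegral.integral_const_mul, intervalIntegral.integral_sub (by simp)
    (by apply Continuous.intervalIntegrable; fun_prop), intervalIntegral.integral_div]
  simp only [intervalIntegral.integral_const, smul_eq_mul, mul_one, integral_id]
  field_simp
  ring

theorem triangular_map_neg (hΔ : 0 < Δ) (S : Set ℝ) (hS : MeasurableSet S) :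
    (triangular Δ).real (Neg.neg ⁻¹' S) = (triangular Δ).real S := by
  rw [← integral_indicator_one hS, ← integral_indicator_one (hS.preimage measurable_neg),
    integral_triangular hΔ, integral_triangular hΔ, ← integral_neg_eq_self]
  congr 1
  funext w
  rw [ditherPdf_neg]
  congr 1
  have hiff : -w ∈ Neg.neg ⁻¹' S ↔ w ∈ S := by rw [Set.mem_preimage, neg_neg]
  by_cases hw : w ∈ S
  · rw [Set.indicator_of_mem (hiff.2 hw), Set.indicator_of_mem hw, Pi.one_apply, Pi.one_apply]
  · rw [Set.indicator_of_notMem (mt hiff.1 hw), Set.indicator_of_notMem hw]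

theorem ae_abs_le_triangular : ∀ᵐ w ∂(triangular Δ), |w| ≤ Δ := by
  rw [triangular, ae_withDensity_iff measurable_ditherPdf.ennreal_ofReal]
  refine ae_of_all _ fun w hw => ?_
  by_contra h
  exact hw (by simp [ditherPdf, h])

theorem triangular_singleton (r : ℝ) : (triangular Δ) {r} = 0 :=
  withDensity_absolutelyContinuous _ _ (by simp)

theorem integral_id_triangular (hΔ : 0 < Δ) : ∫ w, w ∂(triangular Δ) = 0 := by
  rw [integral_triangular hΔ]
  have h := integral_neg_eq_self (fun w => ditherPdf Δ w * w) volume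
  simp only [ditherPdf_neg, mul_neg, integral_neg] at h
  linarith

theorem integral_sq_triangular (hΔ : 0 < Δ) : ∫ w, w ^ 2 ∂(triangular Δ) = Δ ^ 2 / 6 := by
  rw [integral_triangular hΔ]
  have h := integral_comp_abs (f := fun w => ditherPdf Δ w * w ^ 2)
  have h1 : ∀ w : ℝ, ditherPdf Δ |w| * |w| ^ 2 = ditherPdf Δ w * w ^ 2 := fun w => by
    simp [ditherPdf]
  simp only [h1] at h
  rw [h, integral_Ioi_ditherPdf _ le_rfl hΔ.le]
  have h2 : ∀ w : ℝ, 1 / Δ * (1 - w / Δ) * w ^ 2 = 1 / Δ * w ^ 2 - 1 / Δ ^ 2 * w ^ 3 := fun w => by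
    field_simp
  simp only [h2]
  rw [intervalIntegral.integral_sub (by apply Continuous.intervalIntegrable; fun_prop)
    (by apply Continuous.intervalIntegrable; fun_prop), intervalIntegral.integral_const_mul,
    intervalIntegral.integral_const_mul, integral_pow, integral_pow]
  field_simp
  ring

/-- The unbounded mid-rise quantizer with step `Δ`. -/
noncomputable def roundMid (Δ r : ℝ) : ℝ := Δ * (⌊r / Δ⌋ + 1 / 2)

theorem measurable_roundMid : Measurable (roundMid Δ) := by
  unfold roundMid
  have : Measurable fun r : ℝ => ((⌊r / Δ⌋ : ℤ) : ℝ) :=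
    (measurable_from_top (f := fun n : ℤ => (n : ℝ))).comp
      (Int.measurable_floor.comp (by fun_prop))
  fun_prop

theorem abs_roundMid_sub_le (hΔ : 0 < Δ) (r : ℝ) : |roundMid Δ r - r| ≤ Δ / 2 := by
  have h1 := Int.floor_le (r / Δ)
  have h2 := Int.lt_floor_add_one (r / Δ)
  rw [le_div_iff₀ hΔ] at h1
  rw [div_lt_iff₀ hΔ] at h2
  rw [roundMid, abs_le]
  constructor <;> nlinarith

/-- The distribution of the total error of a triangularly dithered mid-rise quantizer. -/
theorem integral_roundMid_error [IsProbabilityMeasure (triangular Δ)] (hΔ : 0 < Δ) (y : ℝ)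
    (φ : ℝ → ℝ) :
    ∫ w, φ (roundMid Δ (y + w) - y) ∂(triangular Δ) =
      (1 - Int.fract (y / Δ)) ^ 2 / 2 * φ (Δ * (-(1 / 2) - Int.fract (y / Δ))) +
      (1 / 2 + Int.fract (y / Δ) - Int.fract (y / Δ) ^ 2) * φ (Δ * (1 / 2 - Int.fract (y / Δ))) +
      Int.fract (y / Δ) ^ 2 / 2 * φ (Δ * (3 / 2 - Int.fract (y / Δ))) := by
  set t := Int.fract (y / Δ) with ht
  set m := ⌊y / Δ⌋ with hm
  have ht0 : 0 ≤ t := Int.fract_nonneg _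
  have ht1 : t < 1 := Int.fract_lt_one _
  have hy : y = Δ * (m + t) := by
    rw [hm, ht, Int.floor_add_fract]
    field_simp
  -- With `y = Δ (m + t)` and `|w| ≤ Δ`, the sum `y + w` falls into cell `m - 1`, `m` or `m + 1`.
  -- `A` is the event of the lower cell and `B` that of the upper one, up to the boundary point `w =
  -- Δ (1 - t)`, which has measure zero.
  set A : Set ℝ := Neg.neg ⁻¹' Set.Ioi (Δ * t) with hA
  set B : Set ℝ := Set.Ioi (Δ * (1 - t)) with hB
  have hAm : MeasurableSet A := measurableSet_Ioi.preimage measurable_neg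
  have hBm : MeasurableSet B := measurableSet_Ioi
  have hAr : (triangular Δ).real A = (1 - t) ^ 2 / 2 := by
    rw [hA, triangular_map_neg hΔ _ measurableSet_Ioi,
      measureReal_triangular_Ioi hΔ (by positivity) (by nlinarith)]
    field_simp
  have hBr : (triangular Δ).real B = t ^ 2 / 2 := by
    rw [hB, measureReal_triangular_Ioi hΔ (mul_nonneg hΔ.le (by linarith)) (by nlinarith)]
    field_simp
    ring
  have hdisj : Disjoint A B := by
    rw [Set.disjoint_left]
    intro w hw hw'
    simp only [hA, hB, Set.mem_preimage, Set.mem_Ioi] at hw hw'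
    nlinarith
  have hC : (triangular Δ).real (A ∪ B)ᶜ = 1 / 2 + t - t ^ 2 := by
    rw [measureReal_compl (hAm.union hBm), measureReal_union hdisj hBm, hAr, hBr]
    simp
    ring
  have hae : ∀ᵐ w ∂(triangular Δ), φ (roundMid Δ (y + w) - y) =
      A.indicator (fun _ => φ (Δ * (-(1 / 2) - t))) w +
      (A ∪ B)ᶜ.indicator (fun _ => φ (Δ * (1 / 2 - t))) w +
      B.indicator (fun _ => φ (Δ * (3 / 2 - t))) w := by
    filter_upwards [ae_abs_le_triangular (Δ := Δ), compl_mem_ae_iff.2 (triangular_singleton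
      (Δ := Δ) (Δ * (1 - t)))] with w hw hw'
    rw [abs_le] at hw
    have hfl : ∀ k : ℤ, (k : ℝ) * Δ ≤ Δ * t + w → Δ * t + w < (k + 1) * Δ →
        roundMid Δ (y + w) - y = Δ * (1 / 2 + k - t) := by
      intro k h1 h2
      have : ⌊(y + w) / Δ⌋ = m + k := by
        rw [Int.floor_eq_iff, le_div_iff₀ hΔ, div_lt_iff₀ hΔ]
        push_cast
        constructor <;> nlinarith
      rw [roundMid, this, hy]
      push_cast
      ring
    by_cases hwA : w ∈ A
    · have hwB : w ∉ B := Set.disjoint_left.1 hdisj hwA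
      have h := hfl (-1) (by
        simp only [hA, Set.mem_preimage, Set.mem_Ioi] at hwA; push_cast; nlinarith) (by
        simp only [hA, Set.mem_preimage, Set.mem_Ioi] at hwA; push_cast; nlinarith)
      rw [h]
      simp only [Set.indicator_of_mem hwA, Set.indicator_of_notMem hwB,
        Set.indicator_of_notMem (show w ∉ (A ∪ B)ᶜ from fun h => h (Or.inl hwA)), add_zero]
      congr 2
      push_cast
      ring
    · by_cases hwB : w ∈ B
      · have h := hfl 1 (by
          simp only [hB, Set.mem_Ioi] at hwB; push_cast; nlinarith) (by
          push_cast; nlinarith)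
        rw [h]
        simp only [Set.indicator_of_mem hwB, Set.indicator_of_notMem hwA,
          Set.indicator_of_notMem (show w ∉ (A ∪ B)ᶜ from fun h => h (Or.inr hwB)), zero_add]
        congr 2
        push_cast
        ring
      · have h := hfl 0 (by
          simp only [hA, Set.mem_preimage, Set.mem_Ioi] at hwA; push_cast; nlinarith) (by
          simp only [hB, Set.mem_Ioi, not_lt] at hwB
          have : w < Δ * (1 - t) := lt_of_le_of_ne hwB hw'
          push_cast; nlinarith)
        rw [h]
        simp only [Set.indicator_of_notMem hwB, Set.indicator_of_notMem hwA,
          Set.indicator_of_mem (show w ∈ (A ∪ B)ᶜ from fun h => h.elim hwA hwB), zero_add,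
          add_zero]
        congr 2
        push_cast
        ring
  rw [integral_congr_ae hae, integral_add, integral_add, integral_indicator_const _ hAm,
    integral_indicator_const _ hBm, integral_indicator_const _ (hAm.union hBm).compl, hAr, hBr, hC]
  · simp only [smul_eq_mul]
  · exact (integrable_const _).indicator hAm
  · exact (integrable_const _).indicator (hAm.union hBm).compl
  · exact ((integrable_const _).indicator hAm).add
      ((integrable_const _).indicator (hAm.union hBm).compl)
  · exact (integrable_const _).indicator hBm

theorem integral_roundMid_error_eq_zero [IsProbabilityMeasure (triangular Δ)] (hΔ : 0 < Δ)
    (y : ℝ) : ∫ w, (roundMid Δ (y + w) - y) ∂(triangular Δ) = 0 := by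
  rw [integral_roundMid_error hΔ y fun r => r]
  ring

/-- The error takes three values whose positions and probabilities are polynomials in the fractional
part of `y / Δ`, which cancels from the second moment as it does from the first. This is the purpose
of the triangular shape; the value is the uniform error variance `Δ² / 12` plus the dither variance
`Δ² / 6`. -/
theorem integral_roundMid_error_sq [IsProbabilityMeasure (triangular Δ)] (hΔ : 0 < Δ)
    (y : ℝ) : ∫ w, (roundMid Δ (y + w) - y) ^ 2 ∂(triangular Δ) = Δ ^ 2 / 4 := by
  rw [integral_roundMid_error hΔ y fun r => r ^ 2]
  ring

end Triangular

/-! ### From dithered quantization to additive white noise -/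

section DitherSigma

variable {Ω : Type*} {M N K : ℕ}

/-- The σ-algebra generated by a dither. -/
abbrev ditherSigma (w : Fin K → ℤ → Ω → ℝ) : MeasurableSpace Ω :=
  ⨆ k, ⨆ n, MeasurableSpace.comap (w k n) inferInstance

/-- The σ-algebra generated by the inputs and the task. -/
abbrev jointSigma (x : Fin M → ℝ → Ω → ℝ) (s : Fin N → Ω → ℝ) : MeasurableSpace Ω :=
  inputSigma x ⊔ ⨆ i, MeasurableSpace.comap (s i) inferInstance

end DitherSigma

section Dither

variable {Ω : Type*} [mΩ : MeasurableSpace Ω] {P : Measure Ω} [IsProbabilityMeasure P]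

/-- Fubini on the product law: the dither `W` is integrated out first, with the variables `X`
frozen. -/
theorem integral_of_indep {E F : Type*} [MeasurableSpace E] [MeasurableSpace F] {W : Ω → E}
    {X : Ω → F} (hW : Measurable W) (hX : Measurable X) (hi : IndepFun W X P) {g : E × F → ℝ}
    (hg : Measurable g) (hint : Integrable (fun ω => g (W ω, X ω)) P) :
    ∫ ω, g (W ω, X ω) ∂P = ∫ a, ∫ w, g (w, a) ∂(P.map W) ∂(P.map X) := by
  have hmap : P.map (fun ω => (W ω, X ω)) = (P.map W).prod (P.map X) :=
    (indepFun_iff_map_prod_eq_prod_map_map hW.aemeasurable hX.aemeasurable).1 hi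
  have : IsProbabilityMeasure (P.map W) := Measure.isProbabilityMeasure_map hW.aemeasurable
  have : IsProbabilityMeasure (P.map X) := Measure.isProbabilityMeasure_map hX.aemeasurable
  have hint' : Integrable g ((P.map W).prod (P.map X)) := by
    rw [← hmap]
    exact (integrable_map_measure hg.aestronglyMeasurable (hW.prodMk hX).aemeasurable).2 hint
  rw [← integral_prod_symm g hint', ← hmap,
    integral_map (hW.prodMk hX).aemeasurable hg.aestronglyMeasurable]

variable {M N K : ℕ} {x : Fin M → ℝ → Ω → ℝ} {s : Fin N → Ω → ℝ} {b : ℕ} {η : ℝ}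
  {y z : Fin K → ℤ → Ω → ℝ}

/-- Nonsubtractive triangularly dithered quantization without overload follows the equivalent
additive white-noise model. -/
theorem IsDitheredQuantization.isEquivalentQuantization (hxm : ∀ m u, Measurable (x m u))
    (hx2 : ∀ m u, MemLp (x m u) 2 P) (hs : ∀ i, Measurable (s i)) (hs2 : ∀ i, MemLp (s i) 2 P)
    (hy2 : ∀ k n, MemLp (y k n) 2 P)
    (hyx : ∀ k n, ∃ Z : Ω → ℝ, Measurable[inputSigma x] Z ∧ y k n =ᵐ[P] Z)
    (hz : IsDitheredQuantization P x s b η y z) : IsEquivalentQuantization P x s b η y z := by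
  obtain ⟨γ, w, hγ, hwm, hwlaw, hwi, hwx, hγ2, hover, hzw⟩ := hz
  set Δ := stepSize b γ with hΔdef
  have hΔ : 0 < Δ := by rw [hΔdef, stepSize]; positivity
  have hlaw : ∀ k n, P.map (w k n) = triangular Δ := hwlaw
  have hJle : (jointSigma x s) ≤ mΩ := sup_le (inputSigma_le hxm) (iSup_le fun i => (hs i).comap_le)
  have hprob : ∀ (_ : Fin K) (_ : ℤ), IsProbabilityMeasure (triangular Δ) := fun k n => by
    rw [← hlaw k n]
    exact Measure.isProbabilityMeasure_map (hwm k n).aemeasurable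
  choose Z hZm hyZ using hyx
  have hZJ : ∀ k n, Measurable[(jointSigma x s)] (Z k n) := fun k n => (hZm k n).mono le_sup_left le_rfl
  have hZ : ∀ k n, Measurable (Z k n) := fun k n => (hZJ k n).mono hJle le_rfl
  have hwD : ∀ k n, Measurable[(ditherSigma w)] (w k n) := fun k n =>
    Measurable.of_comap_le (le_iSup_of_le k (le_iSup_of_le n le_rfl))
  have hxJ : ∀ m u, Measurable[(jointSigma x s)] (x m u) := fun m u =>
    (measurable_inputSigma m u).mono le_sup_left le_rfl
  have hsJ : ∀ i, Measurable[(jointSigma x s)] (s i) := fun i =>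
    Measurable.of_comap_le ((le_iSup (fun i => MeasurableSpace.comap (s i) inferInstance) i).trans
      le_sup_right)
  have hindep : ∀ {E F : Type} [MeasurableSpace E] [MeasurableSpace F] {W : Ω → E} {X : Ω → F},
      Measurable[(ditherSigma w)] W → Measurable[(jointSigma x s)] X → IndepFun W X P := by
    intro E F _ _ W X hW hX
    exact (IndepFun_iff_Indep _ _ _).2
      (indep_of_indep_of_le_left (indep_of_indep_of_le_right hwx hX.comap_le) hW.comap_le)
  have hwb : ∀ k n, ∀ᵐ ω ∂P, |w k n ω| ≤ Δ := fun k n => by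
    have h := ae_abs_le_triangular (Δ := Δ)
    rw [← hlaw k n] at h
    exact ae_of_ae_map (hwm k n).aemeasurable h
  -- the error in terms of the inputs and the dither
  set err : Fin K → ℤ → Ω → ℝ := fun k n ω => roundMid Δ (Z k n ω + w k n ω) - Z k n ω with herr
  have herrm : ∀ k n, Measurable (err k n) := fun k n =>
    (measurable_roundMid.comp ((hZ k n).add (hwm k n))).sub (hZ k n)
  have herrb : ∀ k n, ∀ᵐ ω ∂P, ‖err k n ω‖ ≤ 2 * Δ := fun k n => by
    filter_upwards [hwb k n] with ω hω
    have h1 := abs_roundMid_sub_le hΔ (Z k n ω + w k n ω)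
    rw [abs_le] at h1 hω
    rw [Real.norm_eq_abs, herr, abs_le]
    constructor <;> linarith
  have herr2 : ∀ k n, MemLp (err k n) 2 P := fun k n =>
    MemLp.of_bound (herrm k n).aestronglyMeasurable _ (herrb k n)
  -- Without overload the clipping branch of `midRise` has probability zero, so the quantizer agrees
  -- almost surely with the unbounded one.
  have hez : ∀ k n, (fun ω => z k n ω - y k n ω) =ᵐ[P] err k n := fun k n => by
    have h0 : ∀ᵐ ω ∂P, ¬ γ ≤ |y k n ω + w k n ω| := by
      rw [ae_iff]
      simpa using hover k n
    filter_upwards [h0, hyZ k n] with ω h1 h2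
    simp only [herr]
    rw [hzw, midRise, if_pos (not_le.1 h1), ← h2]
    rfl
  have hZ2 : ∀ k n, MemLp (Z k n) 2 P := fun k n => (memLp_congr_ae (hyZ k n)).1 (hy2 k n)
  have hw2 : ∀ k n, MemLp (w k n) 2 P := fun k n =>
    MemLp.of_bound (hwm k n).aestronglyMeasurable Δ (hwb k n)
  -- For frozen inputs and task the error has mean zero, whatever the quantizer input is; so it is
  -- orthogonal to every square integrable function of them.
  have horth : ∀ k n (v : Ω → ℝ), Measurable[(jointSigma x s)] v → MemLp v 2 P →
      ∫ ω, (z k n ω - y k n ω) * v ω ∂P = 0 := by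
    intro k n v hv hv2
    have := hprob k n
    have e1 : ∫ ω, (z k n ω - y k n ω) * v ω ∂P = ∫ ω, err k n ω * v ω ∂P :=
      integral_congr_ae ((hez k n).mul (ae_eq_refl v))
    have h := integral_of_indep (P := P) (hwm k n) ((hZ k n).prodMk (hv.mono hJle le_rfl))
      (hindep (hwD k n) ((hZJ k n).prodMk hv))
      (g := fun p : ℝ × (ℝ × ℝ) => (roundMid Δ (p.2.1 + p.1) - p.2.1) * p.2.2)
      (by have := measurable_roundMid (Δ := Δ); fun_prop)
      (integrable_mul_of_memLp (herr2 k n) hv2)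
    rw [e1]
    refine h.trans ?_
    simp only [hlaw, integral_mul_const, integral_roundMid_error_eq_zero hΔ, zero_mul,
      integral_zero]
  refine ⟨γ, fun k n ω => z k n ω - y k n ω, hγ, fun k n => (memLp_congr_ae (hez k n)).2 (herr2 k n),
    fun k n m u => horth k n _ (hxJ m u) (hx2 m u), fun k n i => horth k n _ (hsJ i) (hs2 i),
    ?_, ?_, fun k n ω => by ring⟩
  · intro k n k' n'
    have := hprob k n
    have e1 : ∫ ω, (z k n ω - y k n ω) * (z k' n' ω - y k' n' ω) ∂P =
        ∫ ω, err k n ω * err k' n' ω ∂P := integral_congr_ae ((hez k n).mul (hez k' n'))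
    rw [e1]
    split_ifs with hkn
    · obtain ⟨rfl, rfl⟩ := hkn
      have h := integral_of_indep (P := P) (hwm k n) (hZ k n) (hindep (hwD k n) (hZJ k n))
        (g := fun p : ℝ × ℝ => (roundMid Δ (p.2 + p.1) - p.2) * (roundMid Δ (p.2 + p.1) - p.2))
        (by have := measurable_roundMid (Δ := Δ); fun_prop)
        (integrable_mul_of_memLp (herr2 k n) (herr2 k n))
      refine h.trans ?_
      have : IsProbabilityMeasure (P.map (Z k n)) :=
        Measure.isProbabilityMeasure_map (hZ k n).aemeasurable
      simp only [← sq, hlaw, integral_roundMid_error_sq hΔ]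
      simp [hΔdef]
    -- At two distinct indices the dithers are independent. With the inputs frozen, the product of
    -- errors therefore integrates to a product of zero means.
    · have hww : IndepFun (w k n) (w k' n') P :=
        hwi.indepFun (i := (k, n)) (j := (k', n')) (fun h => hkn (by simpa using h))
      have hmap : P.map (fun ω => (w k n ω, w k' n' ω)) = (triangular Δ).prod (triangular Δ) := by
        rw [(indepFun_iff_map_prod_eq_prod_map_map (hwm k n).aemeasurable
          (hwm k' n').aemeasurable).1 hww, hlaw, hlaw]
      have h := integral_of_indep (P := P) ((hwm k n).prodMk (hwm k' n'))
        ((hZ k n).prodMk (hZ k' n'))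
        (hindep ((hwD k n).prodMk (hwD k' n')) ((hZJ k n).prodMk (hZJ k' n')))
        (g := fun p : (ℝ × ℝ) × (ℝ × ℝ) => (roundMid Δ (p.2.1 + p.1.1) - p.2.1) *
          (roundMid Δ (p.2.2 + p.1.2) - p.2.2))
        (by have := measurable_roundMid (Δ := Δ); fun_prop)
        (integrable_mul_of_memLp (herr2 k n) (herr2 k' n'))
      refine h.trans ?_
      have hin : ∀ a : ℝ × ℝ, ∫ p : ℝ × ℝ, (roundMid Δ (a.1 + p.1) - a.1) *
          (roundMid Δ (a.2 + p.2) - a.2) ∂((triangular Δ).prod (triangular Δ)) = 0 := by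
        intro a
        rw [integral_prod_mul (fun w => roundMid Δ (a.1 + w) - a.1)
          (fun w => roundMid Δ (a.2 + w) - a.2), integral_roundMid_error_eq_zero hΔ, zero_mul]
      rw [hmap]
      simp only [hin, integral_zero]
  · intro n
    rw [hγ2 n]
    congr 2
    funext k
    have := hprob k n
    -- The dither is centred and independent of the sample, so the quantizer input has the power of
    -- the sample plus `Δ² / 6`, as in the equivalent model.
    have hyw : ∫ ω, y k n ω * w k n ω ∂P = 0 := by
      have e1 : ∫ ω, y k n ω * w k n ω ∂P = ∫ ω, Z k n ω * w k n ω ∂P :=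
        integral_congr_ae ((hyZ k n).mul (ae_eq_refl _))
      have h := integral_of_indep (P := P) (hwm k n) (hZ k n) (hindep (hwD k n) (hZJ k n))
        (g := fun p : ℝ × ℝ => p.2 * p.1) (by fun_prop)
        (integrable_mul_of_memLp (hZ2 k n) (hw2 k n))
      rw [e1]
      refine h.trans ?_
      have hin : ∀ a : ℝ, ∫ w, a * w ∂(triangular Δ) = 0 := fun a => by
        rw [integral_const_mul, integral_id_triangular hΔ, mul_zero]
      simp only [hlaw, hin, integral_zero]
    have hwsq : ∫ ω, w k n ω ^ 2 ∂P = Δ ^ 2 / 6 := by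
      rw [← integral_sq_triangular hΔ, ← hlaw k n,
        integral_map (hwm k n).aemeasurable (by fun_prop)]
    have e : ∀ ω, (y k n ω + w k n ω) ^ 2 = y k n ω ^ 2 + 2 * (y k n ω * w k n ω) + w k n ω ^ 2 :=
      fun ω => by ring
    have i1 := (hy2 k n).integrable_sq
    have i2 := integrable_mul_of_memLp (hy2 k n) (hw2 k n)
    have i3 : Integrable (fun ω => y k n ω ^ 2 + 2 * (y k n ω * w k n ω)) P :=
      i1.add (i2.const_mul 2)
    simp only [e]
    rw [integral_add i3 (hw2 k n).integrable_sq,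
      integral_add i1 (i2.const_mul 2), integral_const_mul, hyw, hwsq, mul_zero, add_zero]

end Dither

/-! ### The infimum over digital filters: truncation and orthogonal decomposition -/

section Estimation

variable {Ω : Type*} [MeasurableSpace Ω] {P : Measure Ω} {M N K : ℕ} {x : Fin M → ℝ → Ω → ℝ}
  {C : ℝ → Matrix (Fin M) (Fin M) ℂ} {s st : Fin N → Ω → ℝ} {z : Fin K → ℤ → Ω → ℝ}

theorem tendsto_integral_sq_of_tendsto_eLpNorm {F : ℕ → Ω → ℝ} (hF : ∀ n, MemLp (F n) 2 P)
    (h : Tendsto (fun n => eLpNorm (F n) 2 P) atTop (𝓝 0)) :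
    Tendsto (fun n => ∫ ω, F n ω ^ 2 ∂P) atTop (𝓝 0) := by
  have h1 : ∀ n, ∫ ω, F n ω ^ 2 ∂P = (eLpNorm (F n) 2 P).toReal ^ 2 := by
    intro n
    have h0 : 0 ≤ ∫ ω, F n ω ^ 2 ∂P := integral_nonneg fun _ => sq_nonneg _
    rw [(hF n).eLpNorm_eq_integral_rpow_norm (by norm_num) (by norm_num)]
    simp only [ENNReal.toReal_ofNat, Real.rpow_two, Real.norm_eq_abs, sq_abs]
    rw [ENNReal.toReal_ofReal (by positivity), ← Real.rpow_natCast, ← Real.rpow_mul h0]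
    norm_num
  simp only [h1]
  have h2 := ((ENNReal.tendsto_toReal ENNReal.zero_ne_top).comp h).pow 2
  simpa using h2

theorem integrable_sub_sq {f g : Ω → ℝ} (hf : MemLp f 2 P) (hg : MemLp g 2 P) :
    Integrable (fun ω => (f ω - g ω) ^ 2) P := (hf.sub hg).integrable_sq

/-- The truncated digital estimate of component `i`. -/
noncomputable def truncEstimate (G : ℤ → Matrix (Fin N) (Fin K) ℝ) (z : Fin K → ℤ → Ω → ℝ) (L : ℕ)
    (i : Fin N) (ω : Ω) : ℝ :=
  ∑ n ∈ Finset.Icc (-(L : ℤ)) L, ∑ k, G (-n) i k * z k n ω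

theorem memLp_truncEstimate (hz : ∀ k n, MemLp (z k n) 2 P) (G : ℤ → Matrix (Fin N) (Fin K) ℝ)
    (L : ℕ) (i : Fin N) : MemLp (truncEstimate G z L i) 2 P :=
  memLp_finsetSum _ fun n _ => memLp_finsetSum _ fun k _ => (hz k n).const_mul _

theorem IsLinearEstimate.tendsto (hz : ∀ k n, MemLp (z k n) 2 P)
    {G : ℤ → Matrix (Fin N) (Fin K) ℝ} {shat : Fin N → Ω → ℝ} (h : IsLinearEstimate P G z shat)
    (i : Fin N) :
    Tendsto (fun L : ℕ => ∫ ω, (shat i ω - truncEstimate G z L i ω) ^ 2 ∂P) atTop (𝓝 0) :=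
  tendsto_integral_sq_of_tendsto_eLpNorm
    (F := fun L ω => shat i ω - truncEstimate G z L i ω)
    (fun L => (h i).1.sub (memLp_truncEstimate hz G L i)) (h i).2

theorem isLinearEstimate_truncEstimate (hz : ∀ k n, MemLp (z k n) 2 P)
    {G : ℤ → Matrix (Fin N) (Fin K) ℝ} {L : ℕ} (hG : ∀ n : ℤ, (L : ℤ) < |n| → G (-n) = 0) :
    IsLinearEstimate P G z (truncEstimate G z L) := by
  refine fun i => ⟨memLp_truncEstimate hz G L i, ?_⟩
  refine tendsto_const_nhds.congr' ?_
  filter_upwards [eventually_ge_atTop L] with L' hL'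
  have : ∀ ω, truncEstimate G z L i ω -
      ∑ n ∈ Finset.Icc (-(L' : ℤ)) L', ∑ k, G (-n) i k * z k n ω = 0 := by
    intro ω
    rw [sub_eq_zero, truncEstimate]
    have hL'' : (L : ℤ) ≤ L' := by exact_mod_cast hL'
    refine Finset.sum_subset (Finset.Icc_subset_Icc (by omega) hL'') fun n _ hn => ?_
    rw [hG n ?_]
    · simp
    · rw [Finset.mem_Icc, not_and_or, not_le, not_le] at hn
      rw [lt_abs]
      omega
  simp only [this]
  exact eLpNorm_zero.symm

theorem isLinearEstimate_zero (z : Fin K → ℤ → Ω → ℝ) :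
    IsLinearEstimate P (0 : ℤ → Matrix (Fin N) (Fin K) ℝ) z 0 := by
  intro i
  refine ⟨MemLp.zero, ?_⟩
  simp

theorem mse_set_bddBelow (v : Fin N → Ω → ℝ) (z : Fin K → ℤ → Ω → ℝ) :
    BddBelow {r : ℝ | ∃ (G : ℤ → Matrix (Fin N) (Fin K) ℝ) (shat : Fin N → Ω → ℝ),
      IsLinearEstimate P G z shat ∧ r = ∫ ω, ∑ i, (v i ω - shat i ω) ^ 2 ∂P} := by
  refine ⟨0, ?_⟩
  rintro r ⟨G, shat, -, rfl⟩
  exact integral_nonneg fun ω => Finset.sum_nonneg fun i _ => sq_nonneg _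

theorem mse_set_nonempty (v : Fin N → Ω → ℝ) (z : Fin K → ℤ → Ω → ℝ) :
    {r : ℝ | ∃ (G : ℤ → Matrix (Fin N) (Fin K) ℝ) (shat : Fin N → Ω → ℝ),
      IsLinearEstimate P G z shat ∧ r = ∫ ω, ∑ i, (v i ω - shat i ω) ^ 2 ∂P}.Nonempty :=
  ⟨_, 0, 0, isLinearEstimate_zero z, rfl⟩

/-- Estimating a vector whose estimation error from `st` is orthogonal to the data and to `st` is
the same, up to a constant, as estimating `st`. -/
theorem mse_eq_add_mse (hs : ∀ i, MemLp (s i) 2 P) (hst : ∀ i, MemLp (st i) 2 P)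
    (hz : ∀ k n, MemLp (z k n) 2 P) (h1 : ∀ i, ∫ ω, (s i ω - st i ω) * st i ω ∂P = 0)
    (h2 : ∀ i k n, ∫ ω, (s i ω - st i ω) * z k n ω ∂P = 0) :
    mse P s z = (∫ ω, ∑ i, (s i ω - st i ω) ^ 2 ∂P) + mse P st z := by
  have hd : ∀ i, MemLp (fun ω => s i ω - st i ω) 2 P := fun i => (hs i).sub (hst i)
  have key : ∀ (G : ℤ → Matrix (Fin N) (Fin K) ℝ) (shat : Fin N → Ω → ℝ),
      IsLinearEstimate P G z shat → ∫ ω, ∑ i, (s i ω - shat i ω) ^ 2 ∂P =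
        (∫ ω, ∑ i, (s i ω - st i ω) ^ 2 ∂P) + ∫ ω, ∑ i, (st i ω - shat i ω) ^ 2 ∂P := by
    intro G shat hG
    have horth : ∀ i, ∫ ω, (s i ω - st i ω) * shat i ω ∂P = 0 := by
      intro i
      refine integral_mul_eq_zero_of_approx (hd i) (hG i).1 fun ε hε => ?_
      obtain ⟨L, hL⟩ := ((hG.tendsto hz i).eventually_le_const hε).exists
      refine ⟨truncEstimate G z L i, memLp_truncEstimate hz G L i, ?_, hL⟩
      simp only [truncEstimate, Finset.mul_sum]
      have hi : ∀ n k, Integrable (fun ω => (s i ω - st i ω) * (G (-n) i k * z k n ω)) P :=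
        fun n k => integrable_mul_of_memLp (hd i) ((hz k n).const_mul _)
      rw [integral_finsetSum _ fun n _ => integrable_finsetSum _ fun k _ => hi n k]
      refine Finset.sum_eq_zero fun n _ => ?_
      rw [integral_finsetSum _ fun k _ => hi n k]
      refine Finset.sum_eq_zero fun k _ => ?_
      simp only [mul_left_comm _ (G (-n) i k)]
      rw [integral_const_mul, h2, mul_zero]
    have i1 : ∀ i, Integrable (fun ω => (s i ω - st i ω) ^ 2) P := fun i => (hd i).integrable_sq
    have i2 : ∀ i, Integrable (fun ω => (st i ω - shat i ω) ^ 2) P := fun i =>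
      ((hst i).sub (hG i).1).integrable_sq
    have i3 : ∀ i, Integrable (fun ω => (s i ω - shat i ω) ^ 2) P := fun i =>
      ((hs i).sub (hG i).1).integrable_sq
    rw [integral_finsetSum _ fun i _ => i1 i, integral_finsetSum _ fun i _ => i2 i,
      integral_finsetSum _ fun i _ => i3 i, ← Finset.sum_add_distrib]
    refine Finset.sum_congr rfl fun i _ => ?_
    have j1 := integrable_mul_of_memLp (hd i) (hst i)
    have j2 := integrable_mul_of_memLp (hd i) (hG i).1
    have e : ∀ ω, (s i ω - shat i ω) ^ 2 = (s i ω - st i ω) ^ 2 + (st i ω - shat i ω) ^ 2 +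
        2 * ((s i ω - st i ω) * st i ω - (s i ω - st i ω) * shat i ω) := fun ω => by ring
    have i4 : Integrable (fun ω => (s i ω - st i ω) ^ 2 + (st i ω - shat i ω) ^ 2) P :=
      (i1 i).add (i2 i)
    have i5 : Integrable (fun ω => 2 * ((s i ω - st i ω) * st i ω - (s i ω - st i ω) * shat i ω)) P :=
      (j1.sub j2).const_mul 2
    simp only [e]
    rw [integral_add i4 i5, integral_add (i1 i) (i2 i), integral_const_mul, integral_sub j1 j2,
      h1, horth]
    ring
  set c := ∫ ω, ∑ i, (s i ω - st i ω) ^ 2 ∂P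
  have himg : {r : ℝ | ∃ (G : ℤ → Matrix (Fin N) (Fin K) ℝ) (shat : Fin N → Ω → ℝ),
      IsLinearEstimate P G z shat ∧ r = ∫ ω, ∑ i, (s i ω - shat i ω) ^ 2 ∂P} =
      OrderIso.addLeft c '' {r : ℝ | ∃ (G : ℤ → Matrix (Fin N) (Fin K) ℝ) (shat : Fin N → Ω → ℝ),
        IsLinearEstimate P G z shat ∧ r = ∫ ω, ∑ i, (st i ω - shat i ω) ^ 2 ∂P} := by
    ext r
    constructor
    · rintro ⟨G, shat, hG, rfl⟩
      exact ⟨_, ⟨G, shat, hG, rfl⟩, (key G shat hG).symm⟩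
    · rintro ⟨_, ⟨G, shat, hG, rfl⟩, rfl⟩
      exact ⟨G, shat, hG, (key G shat hG).symm⟩
  rw [mse, mse, himg, ← (OrderIso.addLeft c).map_csInf' (mse_set_nonempty st z)
    (mse_set_bddBelow st z)]
  rfl

theorem mse_le_of_truncEstimate (hst : ∀ i, MemLp (st i) 2 P) (hz : ∀ k n, MemLp (z k n) 2 P)
    {G : ℤ → Matrix (Fin N) (Fin K) ℝ} {L : ℕ} (hG : ∀ n : ℤ, (L : ℤ) < |n| → G (-n) = 0) :
    mse P st z ≤ ∑ i, ∫ ω, (st i ω - truncEstimate G z L i ω) ^ 2 ∂P := by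
  rw [← integral_finsetSum _ fun i _ =>
    integrable_sub_sq (hst i) (memLp_truncEstimate hz G L i)]
  exact csInf_le (mse_set_bddBelow st z) ⟨G, _, isLinearEstimate_truncEstimate hz hG, rfl⟩

/-- Every admissible estimate is the mean-square limit of its truncations, so a bound valid for all
finite filters survives in the limit. -/
theorem le_mse_of_truncEstimate (hst : ∀ i, MemLp (st i) 2 P) (hz : ∀ k n, MemLp (z k n) 2 P)
    {c : ℝ} (hc : ∀ (G : ℤ → Matrix (Fin N) (Fin K) ℝ) (L : ℕ),
      c ≤ ∑ i, ∫ ω, (st i ω - truncEstimate G z L i ω) ^ 2 ∂P) : c ≤ mse P st z := by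
  refine le_csInf (mse_set_nonempty st z) ?_
  rintro r ⟨G, shat, hG, rfl⟩
  rw [integral_finsetSum _ fun i _ => integrable_sub_sq (hst i) (hG i).1]
  set B := ∑ i, ∫ ω, (st i ω - shat i ω) ^ 2 ∂P with hB
  have hlim : Tendsto (fun L : ℕ => ∑ i, ∫ ω, (shat i ω - truncEstimate G z L i ω) ^ 2 ∂P)
      atTop (𝓝 0) := by
    have := tendsto_finsetSum Finset.univ fun i (_ : i ∈ Finset.univ) => hG.tendsto hz i
    simpa using this
  have hδ : ∀ δ > 0, c ≤ (1 + δ) * B := by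
    intro δ hδ
    have h1 : ∀ L : ℕ, c ≤ (1 + δ) * B +
        (1 + δ⁻¹) * ∑ i, ∫ ω, (shat i ω - truncEstimate G z L i ω) ^ 2 ∂P := by
      intro L
      refine (hc G L).trans ?_
      rw [hB, Finset.mul_sum, Finset.mul_sum, ← Finset.sum_add_distrib]
      refine Finset.sum_le_sum fun i _ => ?_
      have := integral_sq_le_add ((hst i).sub (memLp_truncEstimate hz G L i))
        ((hst i).sub (hG i).1) hδ
      simp only [Pi.sub_apply, sub_sub_sub_cancel_left] at this
      exact this
    have h2 := (hlim.const_mul (1 + δ⁻¹)).const_add ((1 + δ) * B)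
    rw [mul_zero, add_zero] at h2
    exact ge_of_tendsto' h2 h1
  have h2 : Tendsto (fun δ : ℝ => (1 + δ) * B) (𝓝[>] 0) (𝓝 ((1 + 0) * B)) :=
    (Continuous.tendsto (by fun_prop) _).mono_left nhdsWithin_le_nhds
  simp only [add_zero, one_mul] at h2
  exact ge_of_tendsto h2 (eventually_mem_nhdsWithin.mono fun δ hδ' => hδ δ hδ')

end Estimation

/-! ### The front end as an additive noise channel -/

section FrontEnd

variable {Ω : Type*} [MeasurableSpace Ω] {P : Measure Ω} {M N K : ℕ} {x : Fin M → ℝ → Ω → ℝ}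
  {C : ℝ → Matrix (Fin M) (Fin M) ℂ} {s st : Fin N → Ω → ℝ} {fs : ℝ} {b : ℕ} {η : ℝ}
  {H : ℝ → Matrix (Fin K) (Fin M) ℂ} {z y e : Fin K → ℤ → Ω → ℝ} {σ2 : ℝ}

/-- The samples `z = y + e` of the filter outputs in additive white noise of variance `σ2` that is
uncorrelated with the inputs and the task. -/
structure IsAdditiveModel (P : Measure Ω) (x : Fin M → ℝ → Ω → ℝ)
    (C : ℝ → Matrix (Fin M) (Fin M) ℂ) (s : Fin N → Ω → ℝ) (fs σ2 : ℝ)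
    (H : ℝ → Matrix (Fin K) (Fin M) ℂ) (y e z : Fin K → ℤ → Ω → ℝ) : Prop where
  filtered : ∀ (k : Fin K) (n : ℤ), IsFilteredAt P x C (fun f m => ((1 / fs : ℝ) : ℂ) *
    (Complex.exp (2 * Real.pi * Complex.I * f * ((n * (1 / fs) : ℝ) : ℂ)) * H f k m)) 0 (y k n)
  noise_memLp : ∀ k n, MemLp (e k n) 2 P
  noise_input : ∀ k n m t, ∫ ω, e k n ω * x m t ω ∂P = 0
  noise_task : ∀ k n i, ∫ ω, e k n ω * s i ω ∂P = 0
  noise_cov : ∀ k n k' n', ∫ ω, e k n ω * e k' n' ω ∂P = if k = k' ∧ n = n' then σ2 else 0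
  output : ∀ k n ω, z k n ω = y k n ω + e k n ω

theorem IsAnalogFilter.isFiniteVariance {m : ℕ} {H : ℝ → Matrix (Fin m) (Fin M) ℂ}
    (hH : IsAnalogFilter C H) (k : Fin m) : IsFiniteVariance C fun f => H f k :=
  ⟨hH.measurable k, hH.finite_variance k⟩

theorem isFiniteVariance_sampled (hx : IsWSSWithPSD P x C) {h : ℝ → Fin M → ℂ}
    (hh : IsFiniteVariance C h) (a t : ℝ) : IsFiniteVariance C (fun f m => (a : ℂ) *
      (Complex.exp (2 * Real.pi * Complex.I * f * t) * h f m)) := by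
  have hCm : ∀ i j, AEStronglyMeasurable (fun f => C f i j) volume := fun i j =>
    (hx.integrable i j).1
  exact (hh.mul hx.posSemidef hCm (a := fun f => Complex.exp (2 * Real.pi * Complex.I * f * t))
    (B := 1) (by fun_prop) fun f => (norm_exp_freq' f t).le).mul hx.posSemidef hCm
    (a := fun _ => (a : ℂ)) (B := ‖(a : ℂ)‖) (by fun_prop) fun _ => le_rfl

/-- The range satisfies `γ² = η² (S + Δ² / 6)`, where `S` is the largest sample power and `Δ = 2γ /
2^b`. This equation is linear in `γ²`, and by `hηb` its coefficient `1 - 2η² / (3 · 2^{2b})` is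
positive. Hence `γ² = κ̄ S`, and the noise variance `Δ² / 4 = γ² / 2^{2b}` is proportional to the
power of the strongest channel. -/
theorem IsFrontEndOutput.exists_isAdditiveModel [IsProbabilityMeasure P] (hK : 0 < K)
    (hηb : 2 * η ^ 2 / (3 * 2 ^ (2 * b)) < 1) (hx : IsWSSWithPSD P x C)
    (hs : ∀ i, Measurable (s i)) (hs2 : ∀ i, MemLp (s i) 2 P) (hH : IsAnalogFilter C H)
    (hz : IsFrontEndOutput P x C s fs b η H z) :
    ∃ (σ2 : ℝ) (y e : Fin K → ℤ → Ω → ℝ), 0 < σ2 ∧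
      σ2 = kappaBar b η / 2 ^ (2 * b) * ((1 / fs) ^ 2 * ⨆ k, ∫ f, outPSD (C f) (H f k)) ∧
      IsAdditiveModel P x C s fs σ2 H y e z := by
  obtain ⟨Y, hY, hq⟩ := hz
  have hfilt : ∀ (k : Fin K) (n : ℤ), IsFilteredAt P x C (fun f m => ((1 / fs : ℝ) : ℂ) *
      (Complex.exp (2 * Real.pi * Complex.I * f * ((n * (1 / fs) : ℝ) : ℂ)) * H f k m)) 0
      (sampled fs Y k n) := fun k n => (hY k (n * (1 / fs))).shift.const_mul (1 / fs)
  have heq : IsEquivalentQuantization P x s b η (sampled fs Y) z := by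
    rcases hq with hq | hq
    · exact hq.isEquivalentQuantization hx.measurable hx.memLp hs hs2 (fun k n => (hfilt k n).1)
        fun k n => (hfilt k n).exists_inputSigma_measurable hx
    · exact hq
  obtain ⟨γ, e, hγ, he2, hex, hes, hee, hγ2, hze⟩ := heq
  have hpow : (2 : ℝ) ^ (2 * b) = (2 ^ b) ^ 2 := by rw [mul_comm, pow_mul]
  refine ⟨stepSize b γ ^ 2 / 4, sampled fs Y, e, ?_, ?_, hfilt, he2, hex, hes, hee, hze⟩
  · rw [stepSize]; positivity
  · have hne : Nonempty (Fin K) := ⟨⟨0, hK⟩⟩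
    have h2 : ∀ k, ∫ ω, sampled fs Y k 0 ω ^ 2 ∂P =
        (1 / fs) ^ 2 * ∫ f, outPSD (C f) (H f k) := by
      intro k
      rw [(hfilt k 0).integral_sq hx (isFiniteVariance_sampled hx (hH.isFiniteVariance k) _ _),
        ← integral_const_mul]
      congr 1
      funext f
      rw [outPSD_smul, outPSD_smul, norm_exp_freq', Complex.norm_real, Real.norm_eq_abs, sq_abs,
        one_pow, one_mul]
    have h3 := hγ2 0
    rw [← ciSup_add (Set.finite_range _).bddAbove] at h3
    simp only [h2] at h3
    rw [← Real.mul_iSup_of_nonneg (by positivity)] at h3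
    set S := (1 / fs) ^ 2 * ⨆ k, ∫ f, outPSD (C f) (H f k) with hS
    rw [kappaBar]
    rw [stepSize] at h3 ⊢
    rw [hpow] at hηb ⊢
    have hB : (0 : ℝ) < (2 ^ b) ^ 2 := by positivity
    have hpos : 0 < 1 - 2 * η ^ 2 / (3 * (2 ^ b) ^ 2) := by linarith
    have h4 : γ ^ 2 * (1 - 2 * η ^ 2 / (3 * (2 ^ b) ^ 2)) = η ^ 2 * S := by
      have : η ^ 2 * S = γ ^ 2 - η ^ 2 * ((2 * γ / 2 ^ b) ^ 2 / 6) := by rw [h3]; ring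
      rw [this]
      field_simp
      ring
    have h5 : γ ^ 2 = η ^ 2 * S * (1 - 2 * η ^ 2 / (3 * (2 ^ b) ^ 2))⁻¹ := by
      rw [← h4, mul_assoc, mul_inv_cancel₀ hpos.ne', mul_one]
    have h6 : (2 * γ / 2 ^ b) ^ 2 / 4 = γ ^ 2 / (2 ^ b) ^ 2 := by ring
    rw [h6, h5]
    ring

theorem IsAdditiveModel.memLp (h : IsAdditiveModel P x C s fs σ2 H y e z) (k : Fin K) (n : ℤ) :
    MemLp (z k n) 2 P := by
  rw [show z k n = y k n + e k n from funext fun ω => h.output k n ω]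
  exact (h.filtered k n).1.add (h.noise_memLp k n)

/-- The frequency response `∑ₙ a[n] e^{j2πfn/f_s} / f_s`, truncated to `|n| ≤ L`. -/
noncomputable def trigFilter (fs : ℝ) (a : ℤ → ℂ) (L : ℕ) (f : ℝ) : ℂ :=
  ((1 / fs : ℝ) : ℂ) * ∑ n ∈ Finset.Icc (-(L : ℤ)) L,
    a n * Complex.exp (2 * Real.pi * Complex.I * f * ((n * (1 / fs) : ℝ) : ℂ))

theorem continuous_trigFilter (fs : ℝ) (a : ℤ → ℂ) (L : ℕ) : Continuous (trigFilter fs a L) := by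
  unfold trigFilter
  fun_prop

theorem integral_exp_band (hfs : 0 < fs) (n : ℤ) :
    ∫ f in (-(fs / 2))..(fs / 2),
      Complex.exp (2 * Real.pi * Complex.I * f * ((n * (1 / fs) : ℝ) : ℂ)) =
      if n = 0 then (fs : ℂ) else 0 := by
  have hfs' : (fs : ℂ) ≠ 0 := by exact_mod_cast hfs.ne'
  split_ifs with hn
  · subst hn
    simp
  · have hc : 2 * Real.pi * Complex.I * ((n * (1 / fs) : ℝ) : ℂ) ≠ 0 := by
      have : (n : ℂ) ≠ 0 := by exact_mod_cast hn
      have hpi : (Real.pi : ℂ) ≠ 0 := by exact_mod_cast Real.pi_ne_zero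
      push_cast
      simp [this, hpi, hfs']
    have e : ∀ f : ℝ, 2 * Real.pi * Complex.I * f * ((n * (1 / fs) : ℝ) : ℂ) =
        2 * Real.pi * Complex.I * ((n * (1 / fs) : ℝ) : ℂ) * f := fun f => by ring
    simp only [e]
    rw [integral_exp_mul_complex hc]
    have h1 : Complex.exp (2 * Real.pi * Complex.I * ((n * (1 / fs) : ℝ) : ℂ) * ((fs / 2 : ℝ) : ℂ)) =
        Complex.exp (2 * Real.pi * Complex.I * ((n * (1 / fs) : ℝ) : ℂ) *
          ((-(fs / 2) : ℝ) : ℂ)) := by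
      refine Complex.exp_eq_exp_iff_exists_int.2 ⟨n, ?_⟩
      push_cast
      field_simp
      ring
    rw [h1, sub_self, zero_div]

/-- Parseval on one period of length `fs`; it turns the noise energy of a finite digital filter into
an integral over the band. -/
theorem integral_norm_trigFilter_sq (hfs : 0 < fs) (a : ℤ → ℂ) (L : ℕ) :
    ∫ f in (-(fs / 2))..(fs / 2), ‖trigFilter fs a L f‖ ^ 2 =
      1 / fs * ∑ n ∈ Finset.Icc (-(L : ℤ)) L, ‖a n‖ ^ 2 := by
  have hfs' : (fs : ℂ) ≠ 0 := by exact_mod_cast hfs.ne'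
  have e1 : ∀ f : ℝ, ((‖trigFilter fs a L f‖ ^ 2 : ℝ) : ℂ) = ∑ n ∈ Finset.Icc (-(L : ℤ)) L,
      ∑ m ∈ Finset.Icc (-(L : ℤ)) L, ((1 / fs : ℝ) : ℂ) ^ 2 * (a n * starRingEnd ℂ (a m)) *
        Complex.exp (2 * Real.pi * Complex.I * f * (((n - m : ℤ) * (1 / fs) : ℝ) : ℂ)) := by
    intro f
    rw [← Complex.normSq_eq_norm_sq, ← Complex.mul_conj, trigFilter, map_mul, map_sum,
      Complex.conj_ofReal, mul_mul_mul_comm, Finset.sum_mul_sum, ← sq, Finset.mul_sum]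
    refine Finset.sum_congr rfl fun n _ => ?_
    rw [Finset.mul_sum]
    refine Finset.sum_congr rfl fun m _ => ?_
    rw [map_mul, ← Complex.exp_conj]
    have : Complex.exp (2 * Real.pi * Complex.I * f * (((n - m : ℤ) * (1 / fs) : ℝ) : ℂ)) =
        Complex.exp (2 * Real.pi * Complex.I * f * ((n * (1 / fs) : ℝ) : ℂ)) *
        Complex.exp (starRingEnd ℂ (2 * Real.pi * Complex.I * f * ((m * (1 / fs) : ℝ) : ℂ))) := by
      rw [← Complex.exp_add]
      congr 1
      simp only [map_mul, Complex.conj_I, Complex.conj_ofReal, map_ofNat]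
      push_cast
      ring
    rw [this]
    ring
  have hint : ∀ n m : ℤ, IntervalIntegrable (fun f : ℝ => ((1 / fs : ℝ) : ℂ) ^ 2 *
      (a n * starRingEnd ℂ (a m)) * Complex.exp (2 * Real.pi * Complex.I * f *
        (((n - m : ℤ) * (1 / fs) : ℝ) : ℂ))) volume (-(fs / 2)) (fs / 2) := fun n m =>
    Continuous.intervalIntegrable (by fun_prop) _ _
  have h : ((∫ f in (-(fs / 2))..(fs / 2), ‖trigFilter fs a L f‖ ^ 2 : ℝ) : ℂ) =
      ((1 / fs * ∑ n ∈ Finset.Icc (-(L : ℤ)) L, ‖a n‖ ^ 2 : ℝ) : ℂ) := by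
    rw [← intervalIntegral.integral_ofReal]
    simp only [e1]
    rw [intervalIntegral.integral_finsetSum fun n _ =>
      Continuous.intervalIntegrable (by fun_prop) _ _]
    rw [Complex.ofReal_mul, Complex.ofReal_sum, Finset.mul_sum]
    refine Finset.sum_congr rfl fun n hn => ?_
    rw [intervalIntegral.integral_finsetSum fun m _ => hint n m, Finset.sum_eq_single n]
    · rw [intervalIntegral.integral_const_mul, integral_exp_band hfs, if_pos (sub_self n),
        Complex.mul_conj, Complex.normSq_eq_norm_sq]
      push_cast
      field_simp
    · intro m _ hm
      rw [intervalIntegral.integral_const_mul, integral_exp_band hfs,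
        if_neg (sub_ne_zero.2 hm.symm), mul_zero]
    · exact fun h => absurd hn h
  exact_mod_cast h

theorem IsAdditiveModel.integral_noise_sq (h : IsAdditiveModel P x C s fs σ2 H y e z)
    (I : Finset (Fin K × ℤ)) (a : Fin K × ℤ → ℝ) :
    ∫ ω, (∑ p ∈ I, a p * e p.1 p.2 ω) ^ 2 ∂P = σ2 * ∑ p ∈ I, a p ^ 2 := by
  have hi : ∀ p q : Fin K × ℤ, Integrable (fun ω => a p * e p.1 p.2 ω * (a q * e q.1 q.2 ω)) P :=
    fun p q => integrable_mul_of_memLp ((h.noise_memLp _ _).const_mul _)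
      ((h.noise_memLp _ _).const_mul _)
  have hc : ∀ (p q : Fin K × ℤ) (ω : Ω), a p * e p.1 p.2 ω * (a q * e q.1 q.2 ω) =
      a p * a q * (e p.1 p.2 ω * e q.1 q.2 ω) := fun p q ω => by ring
  simp only [sq, Finset.sum_mul_sum]
  rw [integral_finsetSum _ fun p _ => integrable_finsetSum _ fun q _ => hi p q, Finset.mul_sum]
  refine Finset.sum_congr rfl fun p hp => ?_
  rw [integral_finsetSum _ fun q _ => hi p q, Finset.sum_eq_single p]
  · simp only [hc]
    rw [integral_const_mul, h.noise_cov, if_pos ⟨rfl, rfl⟩, mul_comm]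
  · intro q _ hq
    simp only [hc]
    rw [integral_const_mul, h.noise_cov, if_neg fun hpq => hq (Prod.ext hpq.1 hpq.2).symm, mul_zero]
  · exact fun hn => absurd hp hn

/-- The mean-squared error of a finite digital filter, in the frequency domain. -/
theorem IsAdditiveModel.integral_sub_truncEstimate_sq (hx : IsWSSWithPSD P x C)
    (hH : IsAnalogFilter C H) (h : IsAdditiveModel P x C s fs σ2 H y e z) {g : ℝ → Fin M → ℂ}
    (hg : IsFiniteVariance C g) {v : Ω → ℝ} (hv : IsFilteredAt P x C g 0 v)
    (G : ℤ → Matrix (Fin N) (Fin K) ℝ) (L : ℕ) (i : Fin N) :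
    IsFiniteVariance C (fun f m => g f m - ∑ k, trigFilter fs (fun n => G (-n) i k) L f * H f k m) ∧
    ∫ ω, (v ω - truncEstimate G z L i ω) ^ 2 ∂P =
      (∫ f, outPSD (C f) (fun m => g f m -
        ∑ k, trigFilter fs (fun n => G (-n) i k) L f * H f k m)) +
      σ2 * ∑ n ∈ Finset.Icc (-(L : ℤ)) L, ∑ k, G (-n) i k ^ 2 := by
  have hCm : ∀ i j, AEStronglyMeasurable (fun f => C f i j) volume := fun i j =>
    (hx.integrable i j).1
  set I : Finset (Fin K × ℤ) := Finset.univ ×ˢ Finset.Icc (-(L : ℤ)) L with hI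
  set a : Fin K × ℤ → ℝ := fun p => G (-p.2) i p.1 with ha
  set r : Fin K × ℤ → ℝ → Fin M → ℂ := fun p f m => ((-a p : ℝ) : ℂ) * (((1 / fs : ℝ) : ℂ) *
    (Complex.exp (2 * Real.pi * Complex.I * f * ((p.2 * (1 / fs) : ℝ) : ℂ)) * H f p.1 m)) with hr
  have hrf : ∀ p, IsFilteredAt P x C (r p) 0 (fun ω => -a p * y p.1 p.2 ω) := fun p =>
    (h.filtered p.1 p.2).const_mul (-a p)
  have hrv : ∀ p, IsFiniteVariance C (r p) := fun p =>
    (isFiniteVariance_sampled hx (hH.isFiniteVariance p.1) (1 / fs) (p.2 * (1 / fs))).mul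
      hx.posSemidef hCm (a := fun _ => ((-a p : ℝ) : ℂ)) (B := ‖((-a p : ℝ) : ℂ)‖) (by fun_prop)
      fun _ => le_rfl
  have hAf := hv.add hx hg (IsFiniteVariance.sum hx.posSemidef hCm I fun p _ => hrv p)
    (IsFilteredAt.sum hx I (fun p _ => hrv p) fun p _ => hrf p)
  have hAv := hg.add hx.posSemidef hCm (IsFiniteVariance.sum hx.posSemidef hCm I fun p _ => hrv p)
  have hresp : ∀ f m, g f m + ∑ p ∈ I, r p f m =
      g f m - ∑ k, trigFilter fs (fun n => G (-n) i k) L f * H f k m := by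
    intro f m
    rw [sub_eq_add_neg, hI, Finset.sum_product, ← Finset.sum_neg_distrib]
    congr 1
    refine Finset.sum_congr rfl fun k _ => ?_
    rw [trigFilter, mul_assoc, Finset.sum_mul, Finset.mul_sum, ← Finset.sum_neg_distrib]
    refine Finset.sum_congr rfl fun n _ => ?_
    simp only [hr, ha]
    push_cast
    ring
  have hres := hAf.integral_sq hx hAv
  simp only [hresp] at hAv hres
  refine ⟨hAv, ?_⟩
  set A : Ω → ℝ := fun ω => v ω + ∑ p ∈ I, -a p * y p.1 p.2 ω with hA
  set E : Ω → ℝ := fun ω => ∑ p ∈ I, a p * e p.1 p.2 ω with hE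
  have hE2 : MemLp E 2 P := memLp_finsetSum _ fun p _ => (h.noise_memLp _ _).const_mul _
  -- `A` is the signal error, a filtered version of the inputs, and `E` the filtered noise; since
  -- the noise is orthogonal to the inputs, the cross term integrates to zero.
  have hdec : ∀ ω, (v ω - truncEstimate G z L i ω) ^ 2 = A ω ^ 2 + E ω ^ 2 - 2 * (E ω * A ω) := by
    intro ω
    have : truncEstimate G z L i ω = ∑ p ∈ I, a p * y p.1 p.2 ω + ∑ p ∈ I, a p * e p.1 p.2 ω := by
      rw [truncEstimate, Finset.sum_comm, ← Finset.sum_product', ← Finset.sum_add_distrib]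
      refine Finset.sum_congr rfl fun p _ => ?_
      rw [h.output]
      ring
    rw [this, hA, hE]
    simp only [neg_mul, Finset.sum_neg_distrib]
    ring
  have hEx : ∀ m u, ∫ ω, E ω * x m u ω ∂P = 0 := by
    intro m u
    simp only [hE, Finset.sum_mul]
    rw [integral_finsetSum _ fun p _ =>
      integrable_mul_of_memLp ((h.noise_memLp _ _).const_mul _) (hx.memLp m u)]
    refine Finset.sum_eq_zero fun p _ => ?_
    simp only [mul_assoc]
    rw [integral_const_mul, h.noise_input, mul_zero]
  have hEA : ∫ ω, E ω * A ω ∂P = 0 := hAf.integral_mul_eq_zero hx hE2 hEx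
  have i1 : Integrable (fun ω => A ω ^ 2 + E ω ^ 2) P := hAf.1.integrable_sq.add hE2.integrable_sq
  simp only [hdec]
  rw [integral_sub i1 ((integrable_mul_of_memLp hE2 hAf.1).const_mul 2),
    integral_add hAf.1.integrable_sq hE2.integrable_sq, integral_const_mul, hEA, mul_zero, sub_zero,
    hres, hE, h.integral_noise_sq]
  congr 2
  rw [hI, Finset.sum_comm, ← Finset.sum_product']

end FrontEnd

/-! ### Measurability of singular values, square roots and pseudo-inverses -/

section MatrixMeasurability

open Matrix

variable {α : Type*} [MeasurableSpace α] {μ : Measure α} {m n k : ℕ}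

/-- Entrywise almost everywhere strong measurability of a matrix-valued function. -/
def MatrixAEMeasurable (A : α → Matrix (Fin m) (Fin n) ℂ) (μ : Measure α) : Prop :=
  ∀ i j, AEStronglyMeasurable (fun f => A f i j) μ

theorem MatrixAEMeasurable.mul {A : α → Matrix (Fin m) (Fin n) ℂ}
    {B : α → Matrix (Fin n) (Fin k) ℂ} (hA : MatrixAEMeasurable A μ)
    (hB : MatrixAEMeasurable B μ) : MatrixAEMeasurable (fun f => A f * B f) μ := fun i j => by
  simp only [Matrix.mul_apply]
  exact Finset.aestronglyMeasurable_fun_sum _ fun l _ => (hA i l).mul (hB l j)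

theorem MatrixAEMeasurable.sub {A B : α → Matrix (Fin m) (Fin n) ℂ}
    (hA : MatrixAEMeasurable A μ) (hB : MatrixAEMeasurable B μ) :
    MatrixAEMeasurable (fun f => A f - B f) μ := fun i j => (hA i j).sub (hB i j)

theorem MatrixAEMeasurable.conjTranspose {A : α → Matrix (Fin m) (Fin n) ℂ}
    (hA : MatrixAEMeasurable A μ) : MatrixAEMeasurable (fun f => (A f)ᴴ) μ := fun i j =>
  Complex.continuous_conj.comp_aestronglyMeasurable (hA j i)

theorem MatrixAEMeasurable.frob {A : α → Matrix (Fin m) (Fin n) ℂ}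
    (hA : MatrixAEMeasurable A μ) : AEStronglyMeasurable (fun f => frob (A f)) μ := by
  unfold TaskADC.frob
  exact Finset.aestronglyMeasurable_fun_sum _ fun i _ => Finset.aestronglyMeasurable_fun_sum _
    fun j _ => (hA i j).norm.pow 2

theorem matrixAEMeasurable_diagonal {d : α → Fin n → ℝ}
    (hd : ∀ i, AEStronglyMeasurable (fun f => d f i) μ) :
    MatrixAEMeasurable (fun f => diagonal fun i => (d f i : ℂ)) μ := fun i j => by
  by_cases h : i = j
  · subst h
    simpa only [diagonal_apply_eq] using Complex.continuous_ofReal.comp_aestronglyMeasurable (hd i)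
  · simpa only [diagonal_apply_ne _ h] using aestronglyMeasurable_const

theorem matrixAEMeasurable_rectDiag {d : α → ℕ → ℝ}
    (hd : ∀ i, AEStronglyMeasurable (fun f => d f i) μ) :
    MatrixAEMeasurable (fun f => rectDiag m n (d f)) μ := fun i j => by
  simp only [rectDiag, of_apply]
  split_ifs
  · exact Complex.continuous_ofReal.comp_aestronglyMeasurable (hd i)
  · exact aestronglyMeasurable_const

theorem MatrixAEMeasurable.comp {A : α → Matrix (Fin n) (Fin n) ℂ}
    (hA : MatrixAEMeasurable A μ) {W : (Fin n → Fin n → ℂ) → (Fin n → Fin n → ℂ)}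
    (hW : Measurable W) : MatrixAEMeasurable (fun f => of (W (A f))) μ := fun i j => by
  have h1 : AEMeasurable (β := Fin n → Fin n → ℂ) (fun f i j => A f i j) μ :=
    aemeasurable_pi_lambda _ fun i => aemeasurable_pi_lambda _ fun j => (hA i j).aemeasurable
  exact ((measurable_pi_apply j).comp_aemeasurable
    ((measurable_pi_apply i).comp_aemeasurable (hW.comp_aemeasurable h1))).aestronglyMeasurable

theorem MatrixAEMeasurable.re_apply {A : α → Matrix (Fin m) (Fin n) ℂ}
    (hA : MatrixAEMeasurable A μ) (i : Fin m) (j : Fin n) :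
    AEStronglyMeasurable (fun f => (A f i j).re) μ :=
  Complex.continuous_re.comp_aestronglyMeasurable (hA i j)

theorem eq_of_diagonalization {B W : Matrix (Fin n) (Fin n) ℂ} (hW : W ∈ unitaryGroup (Fin n) ℂ)
    {d : Fin n → ℝ} (h : B * W = W * diagonal (fun i => (d i : ℂ))) :
    (∀ i, d i = ((Wᴴ * B * W) i i).re) ∧ B = W * diagonal (fun i => (d i : ℂ)) * Wᴴ := by
  have h1 : Wᴴ * W = 1 := mem_unitaryGroup_iff'.1 hW
  have h2 : W * Wᴴ = 1 := mem_unitaryGroup_iff.1 hW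
  refine ⟨fun i => ?_, ?_⟩
  · rw [Matrix.mul_assoc, h, ← Matrix.mul_assoc, h1, Matrix.one_mul, diagonal_apply_eq,
      Complex.ofReal_re]
  · rw [← h, Matrix.mul_assoc, h2, Matrix.mul_one]

/-- With a measurable diagonalizing matrix `W` of `B = Aᴴ A`, the squared singular values are
diagonal entries of `Wᴴ B W`, hence measurable. -/
theorem MatrixAEMeasurable.sval {A : α → Matrix (Fin m) (Fin n) ℂ}
    (hA : MatrixAEMeasurable A μ) (i : ℕ) : AEStronglyMeasurable (fun f => sval (A f) i) μ := by
  by_cases hi : i < n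
  · obtain ⟨W, hW, hWB⟩ := exists_measurable_diagonalization n
    have hB := hA.conjTranspose.mul hA
    have hm := (((hB.comp hW).conjTranspose.mul hB).mul (hB.comp hW)).re_apply ⟨i, hi⟩ ⟨i, hi⟩
    refine (Real.continuous_sqrt.comp_aestronglyMeasurable hm).congr (ae_of_all _ fun f => ?_)
    obtain ⟨hU, hd⟩ := hWB ((A f)ᴴ * A f)
    obtain ⟨d, hda, hd⟩ := hd (isHermitian_conjTranspose_mul_self _)
    have h1 := eigenvalues_eq_of_diagonalization (A f) hU hda hd ⟨i, hi⟩
    rw [(eq_of_diagonalization hU hd).1] at h1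
    exact (congrArg Real.sqrt h1.symm).trans (Real.sqrt_sq (sval_nonneg (A f) i))
  · have : ∀ f, TaskADC.sval (A f) i = 0 := fun f =>
      LinearMap.singularValues_of_finrank_le _ (by simpa using not_lt.1 hi)
    simp only [this]
    exact aestronglyMeasurable_const

/-- Both matrices are functions of the eigenvalues in the same basis; the convention `0⁻¹ = 0` makes
the entrywise inverse satisfy the Penrose equations. -/
theorem sqrt_eq_of_diagonalization {C W : Matrix (Fin n) (Fin n) ℂ} (hC : C.PosSemidef)
    (hW : W ∈ unitaryGroup (Fin n) ℂ) {d : Fin n → ℝ}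
    (h : C * W = W * diagonal (fun i => (d i : ℂ))) :
    CFC.sqrt C = W * diagonal (fun i => ((√(d i) : ℝ) : ℂ)) * Wᴴ ∧
    pinv (CFC.sqrt C) = W * diagonal (fun i => (((√(d i))⁻¹ : ℝ) : ℂ)) * Wᴴ := by
  have h1 : Wᴴ * W = 1 := mem_unitaryGroup_iff'.1 hW
  obtain ⟨hd, hCd⟩ := eq_of_diagonalization hW h
  have hd0 : ∀ i, 0 ≤ d i := fun i => by
    rw [hd]
    exact (Complex.nonneg_iff.1 (((hC.conjTranspose_mul_mul_same W)).diag_nonneg (i := i))).1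
  have hmul : ∀ a c : Fin n → ℝ, W * diagonal (fun i => (a i : ℂ)) * Wᴴ *
      (W * diagonal (fun i => (c i : ℂ)) * Wᴴ) = W * diagonal (fun i => ((a i * c i : ℝ) : ℂ)) * Wᴴ := by
    intro a c
    have : W * diagonal (fun i => (a i : ℂ)) * Wᴴ * (W * diagonal (fun i => (c i : ℂ)) * Wᴴ) =
        W * (diagonal (fun i => (a i : ℂ)) * (Wᴴ * W) * diagonal (fun i => (c i : ℂ))) * Wᴴ := by
      simp only [Matrix.mul_assoc]
    rw [this, h1, Matrix.mul_one, diagonal_mul_diagonal]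
    push_cast
    rfl
  have hherm : ∀ a : Fin n → ℝ, (W * diagonal (fun i => (a i : ℂ)) * Wᴴ)ᴴ =
      W * diagonal (fun i => (a i : ℂ)) * Wᴴ := by
    intro a
    rw [conjTranspose_mul, conjTranspose_mul, conjTranspose_conjTranspose, diagonal_conjTranspose,
      Matrix.mul_assoc]
    congr 3
    funext i
    simp
  have hs : CFC.sqrt C = W * diagonal (fun i => ((√(d i) : ℝ) : ℂ)) * Wᴴ := by
    refine CFC.sqrt_unique ?_ ?_
    · rw [hmul, hCd]
      simp only [Real.mul_self_sqrt (hd0 _)]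
    · refine nonneg_iff_posSemidef.2 (PosSemidef.mul_mul_conjTranspose_same ?_ W)
      exact PosSemidef.diagonal fun i => by
        simp only [Pi.zero_apply]
        exact_mod_cast Real.sqrt_nonneg _
  refine ⟨hs, (pinv_spec _).unique ?_⟩
  rw [hs]
  refine ⟨?_, ?_, ?_, ?_⟩
  · rw [hmul, hmul]
    congr 3
    funext i
    by_cases h0 : √(d i) = 0
    · simp [h0]
    · rw [mul_inv_cancel₀ h0, one_mul]
  · rw [hmul, hmul]
    congr 3
    funext i
    by_cases h0 : √(d i) = 0
    · simp [h0]
    · rw [inv_mul_cancel₀ h0, one_mul]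
  · rw [hmul, hherm]
  · rw [hmul, hherm]

theorem MatrixAEMeasurable.sqrt {C : α → Matrix (Fin n) (Fin n) ℂ} (hC : MatrixAEMeasurable C μ)
    (hC0 : ∀ f, (C f).PosSemidef) : MatrixAEMeasurable (fun f => CFC.sqrt (C f)) μ ∧
      MatrixAEMeasurable (fun f => pinv (CFC.sqrt (C f))) μ := by
  obtain ⟨W, hW, hWB⟩ := exists_measurable_diagonalization n
  have hWm := hC.comp hW
  have hdm := (hWm.conjTranspose.mul hC).mul hWm
  have h : ∀ f, ∃ d : Fin n → ℝ, C f * of (W (C f)) = of (W (C f)) * diagonal fun i => (d i : ℂ) :=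
    fun f => by
      obtain ⟨d, -, hd⟩ := (hWB (C f)).2 (hC0 f).1
      exact ⟨d, hd⟩
  choose d hd using h
  have hde : ∀ f i, d f i = (((of (W (C f)))ᴴ * C f * of (W (C f))) i i).re := fun f =>
    (eq_of_diagonalization (hWB (C f)).1 (hd f)).1
  have hsm : ∀ i, AEStronglyMeasurable (fun f => √(d f i)) μ := fun i => by
    simp only [hde]
    exact Real.continuous_sqrt.comp_aestronglyMeasurable (hdm.re_apply i i)
  have hsm' : ∀ i, AEStronglyMeasurable (fun f => (√(d f i))⁻¹) μ := fun i =>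
    ((hsm i).aemeasurable.inv).aestronglyMeasurable
  constructor
  · simp only [fun f => (sqrt_eq_of_diagonalization (hC0 f) (hWB (C f)).1 (hd f)).1]
    exact (hWm.mul (matrixAEMeasurable_diagonal hsm)).mul hWm.conjTranspose
  · simp only [fun f => (sqrt_eq_of_diagonalization (hC0 f) (hWB (C f)).1 (hd f)).2]
    exact (hWm.mul (matrixAEMeasurable_diagonal hsm')).mul hWm.conjTranspose

end MatrixMeasurability

/-! ### The mean-squared error as an integral over the band, and its lower bound -/

section Cost

open Matrix

variable {Ω : Type*} [MeasurableSpace Ω] {P : Measure Ω} {M N K m : ℕ} {x : Fin M → ℝ → Ω → ℝ}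
  {C : ℝ → Matrix (Fin M) (Fin M) ℂ} {s st : Fin N → Ω → ℝ} {fs : ℝ} {b : ℕ} {η : ℝ}
  {H : ℝ → Matrix (Fin K) (Fin M) ℂ} {z y e : Fin K → ℤ → Ω → ℝ} {σ2 : ℝ}

/-- Lebesgue measure on the band `[-f_s/2, f_s/2]`. -/
noncomputable def bandMeasure (fs : ℝ) : Measure ℝ :=
  volume.restrict (Set.Icc (-(fs / 2)) (fs / 2))

instance (fs : ℝ) : IsFiniteMeasure (bandMeasure fs) := by
  unfold bandMeasure
  infer_instance

theorem intervalIntegral_eq_bandMeasure (hfs : 0 < fs) (φ : ℝ → ℝ) :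
    ∫ f in (-(fs / 2))..(fs / 2), φ f = ∫ f, φ f ∂bandMeasure fs := by
  rw [intervalIntegral.integral_of_le (by linarith), bandMeasure, integral_Icc_eq_integral_Ioc]

theorem integral_eq_bandMeasure {φ : ℝ → ℝ} (h : ∀ f : ℝ, fs / 2 < |f| → φ f = 0) :
    ∫ f, φ f = ∫ f, φ f ∂bandMeasure fs := by
  refine (setIntegral_eq_integral_of_forall_compl_eq_zero fun f hf => h f ?_).symm
  rw [Set.mem_Icc, ← abs_le, not_le] at hf
  exact hf

theorem outPSD_zero (h : Fin M → ℂ) : outPSD 0 h = 0 := by simp [outPSD]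

theorem sum_outPSD_eq_frob {D : Matrix (Fin M) (Fin M) ℂ} (hD : D.PosSemidef)
    (A : Matrix (Fin m) (Fin M) ℂ) : ∑ i, outPSD D (A i) = frob (A * CFC.sqrt D) := by
  simp only [outPSD_eq_sum_norm_sq hD, frob]
  rfl

theorem IsAnalogFilter.integrable_frob (hx : IsWSSWithPSD P x C) {A : ℝ → Matrix (Fin m) (Fin M) ℂ}
    (hA : IsAnalogFilter C A) : Integrable fun f => frob (A f * CFC.sqrt (C f)) := by
  simp only [← sum_outPSD_eq_frob (hx.posSemidef _)]
  exact integrable_finsetSum _ fun i _ => hA.finite_variance i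

/-- The sum of the channel powers is at most `K` times the largest, with equality when all channels
carry equal power. This is why the optimal filter balances its channels. -/
theorem IsAnalogFilter.integral_frob_le (hx : IsWSSWithPSD P x C)
    (hH : IsAnalogFilter C H) :
    ∫ f, frob (H f * CFC.sqrt (C f)) ≤ K * ⨆ k, ∫ f, outPSD (C f) (H f k) := by
  simp only [← sum_outPSD_eq_frob (hx.posSemidef _)]
  rw [integral_finsetSum _ fun i _ => hH.finite_variance i]
  calc ∑ i, ∫ f, outPSD (C f) (H f i) ≤ ∑ _i : Fin K, ⨆ k, ∫ f, outPSD (C f) (H f k) :=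
        Finset.sum_le_sum fun i _ =>
          le_ciSup (f := fun k => ∫ f, outPSD (C f) (H f k)) (Set.finite_range _).bddAbove i
    _ = _ := by simp

/-- The matrix of frequency responses of finite digital filters. -/
noncomputable def trigMatrix (fs : ℝ) (a : Fin N → Fin K → ℤ → ℂ) (L : ℕ) (f : ℝ) :
    Matrix (Fin N) (Fin K) ℂ :=
  of fun i k => trigFilter fs (a i k) L f

/-- The integrand of the mean-squared error of a digital filter with response `g`, for whitened
task `A`, whitened analog filter `B` and noise level `ν`. -/
noncomputable def errorDensity (A : Matrix (Fin N) (Fin M) ℂ) (B : Matrix (Fin K) (Fin M) ℂ) (ν : ℝ)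
    (g : Matrix (Fin N) (Fin K) ℂ) : ℝ :=
  frob (A - g * B) + ν * frob g

theorem integral_frob_trigMatrix (hfs : 0 < fs) (a : Fin N → Fin K → ℤ → ℂ) (L : ℕ) :
    ∫ f, frob (trigMatrix fs a L f) ∂bandMeasure fs =
      1 / fs * ∑ i, ∑ k, ∑ n ∈ Finset.Icc (-(L : ℤ)) L, ‖a i k n‖ ^ 2 := by
  have hc : ∀ i k, Integrable (fun f => ‖trigFilter fs (a i k) L f‖ ^ 2) (bandMeasure fs) :=
    fun i k => ((continuous_trigFilter fs (a i k) L).norm.pow 2).continuousOn.integrableOn_Icc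
  simp only [frob, trigMatrix, of_apply]
  rw [integral_finsetSum _ fun i _ => integrable_finsetSum _ fun k _ => hc i k, Finset.mul_sum]
  refine Finset.sum_congr rfl fun i _ => ?_
  rw [integral_finsetSum _ fun k _ => hc i k, Finset.mul_sum]
  refine Finset.sum_congr rfl fun k _ => ?_
  rw [← integral_norm_trigFilter_sq hfs, intervalIntegral_eq_bandMeasure hfs]

theorem integrable_frob_trigMatrix (a : Fin N → Fin K → ℤ → ℂ) (L : ℕ) :
    Integrable (fun f => frob (trigMatrix fs a L f)) (bandMeasure fs) := by
  refine integrable_finsetSum _ fun i _ => integrable_finsetSum _ fun k _ => ?_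
  exact ((continuous_trigFilter fs (a i k) L).norm.pow 2).continuousOn.integrableOn_Icc

/-- Since `C` vanishes off the band, only one period of the digital response matters and nothing is
folded back into it. Whitening turns the signal part into a Frobenius norm, and Parseval turns the
noise energy into an integral with density factor `σ2 * fs`. -/
theorem IsAdditiveModel.sum_integral_sub_truncEstimate_sq (hfs : 0 < fs) (hx : IsWSSWithPSD P x C)
    (hband : ∀ f : ℝ, fs / 2 < |f| → C f = 0) {Γ : ℝ → Matrix (Fin N) (Fin M) ℂ}
    (hΓ : IsAnalogFilter C Γ) (hst : ∀ i, IsFilteredAt P x C (fun f => Γ f i) 0 (st i))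
    (hH : IsAnalogFilter C H) (h : IsAdditiveModel P x C s fs σ2 H y e z)
    (G : ℤ → Matrix (Fin N) (Fin K) ℝ) (L : ℕ) :
    Integrable (fun f => errorDensity (gammaBar C Γ f) (H f * CFC.sqrt (C f)) (σ2 * fs)
      (trigMatrix fs (fun i k n => G (-n) i k) L f)) (bandMeasure fs) ∧
    ∑ i, ∫ ω, (st i ω - truncEstimate G z L i ω) ^ 2 ∂P =
      ∫ f, errorDensity (gammaBar C Γ f) (H f * CFC.sqrt (C f)) (σ2 * fs)
        (trigMatrix fs (fun i k n => G (-n) i k) L f) ∂bandMeasure fs := by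
  have hr := fun i => h.integral_sub_truncEstimate_sq hx hH (hΓ.isFiniteVariance i) (hst i) G L i
  have hrow : ∀ f, ∑ i, outPSD (C f) (fun m => Γ f i m -
      ∑ k, trigFilter fs (fun n => G (-n) i k) L f * H f k m) =
      frob (gammaBar C Γ f - trigMatrix fs (fun i k n => G (-n) i k) L f *
        (H f * CFC.sqrt (C f))) := by
    intro f
    have := sum_outPSD_eq_frob (hx.posSemidef f)
      (Γ f - trigMatrix fs (fun i k n => G (-n) i k) L f * H f)
    rw [Matrix.sub_mul, Matrix.mul_assoc] at this
    exact this
  have hi : Integrable (fun f => frob (gammaBar C Γ f - trigMatrix fs (fun i k n => G (-n) i k) L f *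
      (H f * CFC.sqrt (C f)))) := by
    simp only [← hrow]
    exact integrable_finsetSum _ fun i _ => (hr i).1.integrable
  have hib : Integrable (fun f => frob (gammaBar C Γ f -
      trigMatrix fs (fun i k n => G (-n) i k) L f * (H f * CFC.sqrt (C f)))) (bandMeasure fs) :=
    hi.restrict
  have hig := (integrable_frob_trigMatrix (fs := fs)
    (fun i k n => ((G (-n) i k : ℝ) : ℂ)) L).const_mul (σ2 * fs)
  refine ⟨hib.add hig, ?_⟩
  unfold errorDensity
  rw [integral_add hib hig, integral_const_mul, integral_frob_trigMatrix hfs]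
  simp only [(hr _).2, Finset.sum_add_distrib]
  congr 1
  · rw [← integral_finsetSum _ fun i _ => (hr i).1.integrable,
      integral_eq_bandMeasure (fs := fs) fun f hf => by simp [hband f hf, outPSD_zero]]
    simp only [hrow]
  · simp only [Complex.norm_real, Real.norm_eq_abs, sq_abs]
    rw [← mul_assoc, mul_assoc σ2, mul_one_div_cancel hfs.ne', mul_one, Finset.mul_sum]
    refine Finset.sum_congr rfl fun i _ => ?_
    rw [Finset.sum_comm]

/-- The pointwise lower bound on the error density, as a function of the threshold `τ`, without the
power penalty. -/
noncomputable def thresholdedError (K : ℕ) (τ : ℝ) (A : Matrix (Fin N) (Fin M) ℂ) : ℝ :=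
  frob A - ∑ i ∈ Finset.range (min K M), max (sval A i - τ) 0 ^ 2

theorem frob_smul_real (c : ℝ) (A : Matrix (Fin m) (Fin M) ℂ) :
    frob ((c : ℂ) • A) = c ^ 2 * frob A := by
  rw [frob_smul, Complex.norm_real, Real.norm_eq_abs, sq_abs]

/-- Scaling `g` by `√ν` and `B` by its inverse keeps `g * B` and normalizes the noise, which reduces
the claim to `soft_threshold_le`. -/
theorem thresholdedError_le (A : Matrix (Fin N) (Fin M) ℂ) (B : Matrix (Fin K) (Fin M) ℂ) {ν : ℝ}
    (hν : 0 < ν) (τ : ℝ) (g : Matrix (Fin N) (Fin K) ℂ) :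
    thresholdedError K τ A - τ ^ 2 / ν * frob B ≤ errorDensity A B ν g := by
  have hs : √ν ≠ 0 := (Real.sqrt_pos.2 hν).ne'
  have h := soft_threshold_le A (((√ν : ℝ) : ℂ) • g) ((((√ν)⁻¹ : ℝ) : ℂ) • B) τ
  rw [frob_smul_real, frob_smul_real, Matrix.smul_mul, Matrix.mul_smul, smul_smul, ← Complex.ofReal_mul,
    mul_inv_cancel₀ hs, Complex.ofReal_one, one_smul, inv_pow, Real.sq_sqrt hν.le,
    ← mul_assoc, ← div_eq_mul_inv] at h
  unfold thresholdedError errorDensity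
  linarith

theorem integrable_gammaBar (hx : IsWSSWithPSD P x C)
    {Γ : ℝ → Matrix (Fin N) (Fin M) ℂ} (hΓ : IsAnalogFilter C Γ) :
    MatrixAEMeasurable (gammaBar C Γ) volume ∧ Integrable fun f => frob (gammaBar C Γ f) := by
  refine ⟨?_, hΓ.integrable_frob hx⟩
  exact MatrixAEMeasurable.mul hΓ.measurable
    (MatrixAEMeasurable.sqrt (fun i j => (hx.integrable i j).1) hx.posSemidef).1

theorem integrable_sval_sq {A : ℝ → Matrix (Fin N) (Fin M) ℂ} {μ : Measure ℝ}
    (hA : MatrixAEMeasurable A μ) (hi : Integrable (fun f => frob (A f)) μ) (i : ℕ) :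
    Integrable (fun f => sval (A f) i ^ 2) μ := by
  refine hi.mono' ((hA.sval i).pow 2) (ae_of_all _ fun f => ?_)
  rw [Real.norm_of_nonneg (sq_nonneg _)]
  by_cases h : i < M
  · rw [frob_eq_sum_sval_sq]
    exact Finset.single_le_sum (f := fun j : Fin M => sval (A f) j ^ 2)
      (fun j _ => sq_nonneg _) (Finset.mem_univ ⟨i, h⟩)
  · have : sval (A f) i = 0 := LinearMap.singularValues_of_finrank_le _ (by simpa using not_lt.1 h)
    rw [this]
    simpa using frob_nonneg _

theorem integrable_sval {A : ℝ → Matrix (Fin N) (Fin M) ℂ} {μ : Measure ℝ} [IsFiniteMeasure μ]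
    (hA : MatrixAEMeasurable A μ) (hi : Integrable (fun f => frob (A f)) μ) (i : ℕ) :
    Integrable (fun f => sval (A f) i) μ :=
  ((memLp_two_iff_integrable_sq (hA.sval i)).2 (integrable_sval_sq hA hi i)).integrable one_le_two

theorem integrable_waterPower {A : ℝ → Matrix (Fin N) (Fin M) ℂ} {μ : Measure ℝ} [IsFiniteMeasure μ]
    (hA : MatrixAEMeasurable A μ) (hi : Integrable (fun f => frob (A f)) μ) (ζ : ℝ) (i : ℕ) :
    Integrable (fun f => waterPower ζ (sval (A f) i)) μ := by
  unfold waterPower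
  exact (((integrable_sval hA hi i).const_mul ζ).sub (integrable_const 1)).pos_part

theorem integrable_thresholdedError {A : ℝ → Matrix (Fin N) (Fin M) ℂ} {μ : Measure ℝ}
    (hA : MatrixAEMeasurable A μ) (hi : Integrable (fun f => frob (A f)) μ) {τ : ℝ} (hτ : 0 ≤ τ) :
    Integrable (fun f => thresholdedError K τ (A f)) μ := by
  refine hi.sub (integrable_finsetSum _ fun i _ => ?_)
  have hm : AEStronglyMeasurable (fun f => max (sval (A f) i - τ) 0 ^ 2) μ :=
    (by fun_prop : Continuous fun t : ℝ => max (t - τ) 0 ^ 2).comp_aestronglyMeasurable (hA.sval i)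
  refine (integrable_sval_sq hA hi i).mono' hm (ae_of_all _ fun f => ?_)
  rw [Real.norm_of_nonneg (sq_nonneg _)]
  have h0 := sval_nonneg (A f) i
  exact pow_le_pow_left₀ (le_max_right _ _) (max_le (by linarith) h0) 2

theorem kappaBar_pos (hη : 0 < η) (hηb : 2 * η ^ 2 / (3 * 2 ^ (2 * b)) < 1) :
    0 < kappaBar b η :=
  mul_pos (by positivity) (inv_pos.2 (by linarith))

/-- Weak duality with multiplier `τ²`. The penalty after integration is `τ²` times the total power
divided by `σ2 * fs`. Numerator and denominator are both controlled by the power of the strongest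
channel, so the quotient is bounded independently of `H`. -/
theorem IsAdditiveModel.lower_bound (hfs : 0 < fs) (hκ : 0 < kappaBar b η)
    (hx : IsWSSWithPSD P x C) (hband : ∀ f : ℝ, fs / 2 < |f| → C f = 0)
    {Γ : ℝ → Matrix (Fin N) (Fin M) ℂ} (hΓ : IsAnalogFilter C Γ)
    (hst : ∀ i, IsFilteredAt P x C (fun f => Γ f i) 0 (st i))
    (hH : IsAnalogFilter C H) (hσ : 0 < σ2)
    (hσe : σ2 = kappaBar b η / 2 ^ (2 * b) * ((1 / fs) ^ 2 * ⨆ k, ∫ f, outPSD (C f) (H f k)))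
    (h : IsAdditiveModel P x C s fs σ2 H y e z) {τ : ℝ} (hτ : 0 ≤ τ) :
    (∫ f, thresholdedError K τ (gammaBar C Γ f) ∂bandMeasure fs) -
      τ ^ 2 * (K * fs * 2 ^ (2 * b) / kappaBar b η) ≤ mse P st z := by
  obtain ⟨hAm, hAi⟩ := integrable_gammaBar hx hΓ
  have hD : Integrable (fun f => thresholdedError K τ (gammaBar C Γ f)) (bandMeasure fs) :=
    (integrable_thresholdedError hAm hAi hτ).restrict
  have hB : Integrable (fun f => frob (H f * CFC.sqrt (C f))) (bandMeasure fs) :=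
    (hH.integrable_frob hx).restrict
  refine le_mse_of_truncEstimate (fun i => (hst i).1) (fun k n => h.memLp k n) fun G L => ?_
  obtain ⟨hi, he⟩ := h.sum_integral_sub_truncEstimate_sq hfs hx hband hΓ hst hH G L
  rw [he]
  have hν : 0 < σ2 * fs := mul_pos hσ hfs
  have hint : (∫ f, thresholdedError K τ (gammaBar C Γ f) ∂bandMeasure fs) -
      τ ^ 2 / (σ2 * fs) * ∫ f, frob (H f * CFC.sqrt (C f)) ∂bandMeasure fs ≤
      ∫ f, errorDensity (gammaBar C Γ f) (H f * CFC.sqrt (C f)) (σ2 * fs)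
        (trigMatrix fs (fun i k n => G (-n) i k) L f) ∂bandMeasure fs := by
    rw [← integral_const_mul, ← integral_sub hD (hB.const_mul _)]
    exact integral_mono (hD.sub (hB.const_mul _)) hi fun f => thresholdedError_le _ _ hν τ _
  have hE : ∫ f, frob (H f * CFC.sqrt (C f)) ∂bandMeasure fs ≤
      K * ⨆ k, ∫ f, outPSD (C f) (H f k) :=
    (setIntegral_le_integral (hH.integrable_frob hx) (ae_of_all _ fun f => frob_nonneg _)).trans
      (hH.integral_frob_le hx)
  refine le_trans (sub_le_sub_left ?_ _) hint
  rw [div_mul_eq_mul_div, mul_div_assoc]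
  refine mul_le_mul_of_nonneg_left ?_ (sq_nonneg τ)
  rw [div_le_div_iff₀ hν hκ, hσe]
  set S := ⨆ k, ∫ f, outPSD (C f) (H f k)
  calc _ ≤ K * S * kappaBar b η := mul_le_mul_of_nonneg_right hE hκ.le
    _ = _ := by field_simp

end Cost

/-! ### The optimal filter: whitening and channel powers -/

section OptimalFilter

open Matrix

variable {Ω : Type*} [MeasurableSpace Ω] {P : Measure Ω} {M N K k m n b : ℕ}
  {x : Fin M → ℝ → Ω → ℝ} {C : ℝ → Matrix (Fin M) (Fin M) ℂ} {fs η ζ : ℝ}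
  {Γ : ℝ → Matrix (Fin N) (Fin M) ℂ} {U : ℝ → Matrix (Fin K) (Fin K) ℂ}
  {V : ℝ → Matrix (Fin M) (Fin M) ℂ}

theorem frob_rectDiag (d : ℕ → ℝ) :
    frob (rectDiag k n d) = ∑ i ∈ Finset.range (min k n), d i ^ 2 := by
  have h := trace_conjTranspose_mul_self (rectDiag k n d)
  rw [conjTranspose_rectDiag_mul, trace_diagonal, ← Complex.ofReal_sum] at h
  rw [← Complex.ofReal_injective h, ← sum_fin_ite_lt]
  simp only [sq]

theorem sigmaH_eq_rectDiag (ζ : ℝ) (A : Matrix (Fin N) (Fin M) ℂ) :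
    sigmaH K b ζ A = rectDiag K M fun i => waterLevel b ζ (sval A i) := rfl

theorem sigmaH_eq_smul (ζ : ℝ) (A : Matrix (Fin N) (Fin M) ℂ) :
    sigmaH K b ζ A = (((1 / 2 ^ b : ℝ)) : ℂ) • rectDiag K M fun i => √(waterPower ζ (sval A i)) := by
  ext i j
  simp only [sigmaH, rectDiag, of_apply, Matrix.smul_apply, waterLevel, waterPower]
  split_ifs
  · rw [Complex.ofReal_mul, smul_eq_mul]
  · simp

theorem waterLevel_zero (b : ℕ) (ζ : ℝ) : waterLevel b ζ 0 = 0 := by simp [waterLevel]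

theorem pinv_zero : pinv (0 : Matrix (Fin n) (Fin m) ℂ) = 0 :=
  (pinv_spec _).unique ⟨by simp, by simp, by simp, by simp⟩

/-- Right singular vectors with nonzero power are in the row space of `Γ S`. -/
theorem sigmaH_mul_pinv_mul {S : Matrix (Fin M) (Fin M) ℂ} {Γ : Matrix (Fin N) (Fin M) ℂ}
    {V : Matrix (Fin M) (Fin M) ℂ} (hV : IsRightSingularMatrix (Γ * S) V) :
    sigmaH K b ζ (Γ * S) * Vᴴ * pinv S * S = sigmaH K b ζ (Γ * S) * Vᴴ := by
  obtain ⟨A, hA⟩ : ∃ A, A = Γ * S := ⟨_, rfl⟩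
  rw [← hA] at hV ⊢
  -- `D` projects onto the kernel of `S`, which `A = Γ S` annihilates. Right-singular vectors with
  -- nonzero singular value are orthogonal to it, and at singular value zero the water level is
  -- zero.
  set D := 1 - pinv S * S with hD
  have hSD : S * D = 0 := by
    rw [hD, Matrix.mul_sub, Matrix.mul_one, ← Matrix.mul_assoc, (pinv_spec S).mul_mul_self, sub_self]
  have hVD : diagonal (fun i : Fin M => ((sval A i ^ 2 : ℝ) : ℂ)) * (Vᴴ * D) = 0 := by
    have h := congrArg conjTranspose hV.2
    rw [conjTranspose_mul, (isHermitian_conjTranspose_mul_self A).eq, conjTranspose_mul,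
      diagonal_conjTranspose] at h
    have e : (star fun i : Fin M => ((sval A i ^ 2 : ℝ) : ℂ)) =
        fun i : Fin M => ((sval A i ^ 2 : ℝ) : ℂ) := by
      funext i
      simp
    rw [e] at h
    rw [← Matrix.mul_assoc, ← h, Matrix.mul_assoc, Matrix.mul_assoc, hA, Matrix.mul_assoc Γ, hSD,
      Matrix.mul_zero, Matrix.mul_zero, Matrix.mul_zero]
  have hz : sigmaH K b ζ A * (Vᴴ * D) = 0 := by
    ext i j
    rw [Matrix.mul_apply, Matrix.zero_apply]
    refine Finset.sum_eq_zero fun l _ => ?_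
    simp only [sigmaH, of_apply]
    split_ifs with hil
    · have := congrFun (congrFun hVD l) j
      rw [diagonal_mul, Matrix.zero_apply] at this
      rcases mul_eq_zero.1 this with h0 | h0
      · have h1 : sval A l = 0 := by
          have : sval A l ^ 2 = 0 := by exact_mod_cast h0
          exact pow_eq_zero_iff two_ne_zero |>.1 this
        rw [hil, h1, waterLevel_zero]
        simp
      · rw [h0, mul_zero]
    · rw [zero_mul]
  rw [hD, Matrix.mul_sub, Matrix.mul_one, Matrix.mul_sub, sub_eq_zero] at hz
  rw [Matrix.mul_assoc, Matrix.mul_assoc]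
  exact hz.symm

theorem optFilter_mul_sqrt {f : ℝ} (hV : IsRightSingularMatrix (gammaBar C Γ f) (V f)) :
    optFilter C Γ b ζ U V f * CFC.sqrt (C f) =
      U f * sigmaH K b ζ (gammaBar C Γ f) * (V f)ᴴ := by
  have h := sigmaH_mul_pinv_mul (K := K) (b := b) (ζ := ζ) hV
  rw [optFilter, Matrix.mul_assoc (U f), Matrix.mul_assoc (U f), Matrix.mul_assoc (U f)]
  exact congrArg (U f * ·) h

/-- The channel powers are the diagonal entries of `U Σ Σᴴ Uᴴ`. They are equal by assumption, so
each is the trace divided by `K`. -/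
theorem outPSD_optFilter {f : ℝ} (hK : 0 < K) (hC : (C f).PosSemidef)
    (hV : IsRightSingularMatrix (gammaBar C Γ f) (V f)) (hU : U f ∈ unitaryGroup (Fin K) ℂ)
    (hd : ∀ i j, (U f * sigmaH K b ζ (gammaBar C Γ f) * (sigmaH K b ζ (gammaBar C Γ f))ᴴ *
      (U f)ᴴ) i i = (U f * sigmaH K b ζ (gammaBar C Γ f) * (sigmaH K b ζ (gammaBar C Γ f))ᴴ *
      (U f)ᴴ) j j) (i : Fin K) :
    outPSD (C f) (optFilter C Γ b ζ U V f i) =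
      1 / K * ∑ i ∈ Finset.range (min K M), waterLevel b ζ (sval (gammaBar C Γ f) i) ^ 2 := by
  set S := sigmaH K b ζ (gammaBar C Γ f) with hS
  have hB := optFilter_mul_sqrt (b := b) (ζ := ζ) (U := U) hV
  rw [← hS] at hB
  have hVV : (V f)ᴴ * V f = 1 := mem_unitaryGroup_iff'.1 hV.1
  have h1 : ∀ i, ((outPSD (C f) (optFilter C Γ b ζ U V f i) : ℝ) : ℂ) =
      (U f * S * Sᴴ * (U f)ᴴ) i i := by
    intro i
    have e : U f * S * Sᴴ * (U f)ᴴ = (U f * S * (V f)ᴴ) * (U f * S * (V f)ᴴ)ᴴ := by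
      rw [conjTranspose_mul, conjTranspose_mul, conjTranspose_conjTranspose, Matrix.mul_assoc _ (V f)ᴴ,
        ← Matrix.mul_assoc (V f)ᴴ, hVV, Matrix.one_mul, ← Matrix.mul_assoc]
    rw [e, ← hB, mul_conjTranspose_self_apply_self, outPSD_eq_sum_norm_sq hC]
    rfl
  have h2 : ∀ j, outPSD (C f) (optFilter C Γ b ζ U V f j) =
      outPSD (C f) (optFilter C Γ b ζ U V f i) := fun j => by
    have := (h1 j).trans ((hd j i).trans (h1 i).symm)
    exact_mod_cast this
  have h3 := sum_outPSD_eq_frob hC (optFilter C Γ b ζ U V f)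
  rw [hB, frob_mul_conjTranspose_unitary _ hV.1, frob_unitary_mul _ hU, hS, sigmaH_eq_rectDiag,
    frob_rectDiag] at h3
  simp only [h2] at h3
  rw [Finset.sum_const, Finset.card_univ, Fintype.card_fin, nsmul_eq_mul] at h3
  rw [← h3]
  have : (K : ℝ) ≠ 0 := by exact_mod_cast hK.ne'
  field_simp

/-- For `ζ ≤ 0` all water levels vanish, contradicting the normalization. -/
theorem IsOptimalFactors.pos {A : ℝ → Matrix (Fin N) (Fin M) ℂ}
    (h : IsOptimalFactors fs b η A ζ U V) : 0 < ζ := by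
  by_contra hζ
  have h0 : ∀ (f : ℝ) (i : ℕ), waterLevel b ζ (sval (A f) i) = 0 := fun f i => by
    have : ζ * sval (A f) i ≤ 0 := mul_nonpos_of_nonpos_of_nonneg (not_lt.1 hζ) (sval_nonneg _ _)
    rw [waterLevel, max_eq_right (by linarith), Real.sqrt_zero, mul_zero]
  have := h.normalization
  simp [h0] at this

theorem IsOptimalFactors.integral_waterLevel (hfs : 0 < fs) (hK : 0 < K) (hη : 0 < kappaBar b η)
    {A : ℝ → Matrix (Fin N) (Fin M) ℂ} (h : IsOptimalFactors fs b η A ζ U V) :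
    ∫ f, ∑ i ∈ Finset.range (min K M), waterLevel b ζ (sval (A f) i) ^ 2 ∂bandMeasure fs =
      K * fs / kappaBar b η := by
  have h1 := h.normalization
  rw [intervalIntegral_eq_bandMeasure hfs] at h1
  have : (K : ℝ) ≠ 0 := by exact_mod_cast hK.ne'
  rw [eq_div_iff hη.ne']
  field_simp at h1
  linarith

theorem ae_band_and_off {p : ℝ → Prop} (h1 : ∀ᵐ f ∂bandMeasure fs, p f)
    (h2 : ∀ f, fs / 2 < |f| → p f) : ∀ᵐ f, p f := by
  rw [bandMeasure, ae_restrict_iff' measurableSet_Icc] at h1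
  filter_upwards [h1] with f hf
  by_cases hm : f ∈ Set.Icc (-(fs / 2)) (fs / 2)
  · exact hf hm
  · rw [Set.mem_Icc, ← abs_le, not_le] at hm
    exact h2 f hm

theorem aestronglyMeasurable_of_band {φ : ℝ → ℂ} (h : AEStronglyMeasurable φ (bandMeasure fs))
    (h0 : ∀ f, fs / 2 < |f| → φ f = 0) : AEStronglyMeasurable φ volume := by
  have e : φ = (Set.Icc (-(fs / 2)) (fs / 2)).indicator φ := by
    funext f
    by_cases hm : f ∈ Set.Icc (-(fs / 2)) (fs / 2)
    · rw [Set.indicator_of_mem hm]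
    · rw [Set.indicator_of_notMem hm]
      rw [Set.mem_Icc, ← abs_le, not_le] at hm
      exact h0 f hm
  rw [e, aestronglyMeasurable_indicator_iff measurableSet_Icc]
  exact h

theorem optFilter_eq_zero {f : ℝ} (h : C f = 0) : optFilter C Γ b ζ U V f = 0 := by
  rw [optFilter, h, CFC.sqrt_zero, pinv_zero, Matrix.mul_zero]

theorem IsOptimalFactors.outPSD_ae_eq (hK : 0 < K) (hx : IsWSSWithPSD P x C)
    (h : IsOptimalFactors fs b η (gammaBar C Γ) ζ U V) : ∀ᵐ f ∂bandMeasure fs, ∀ i,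
    outPSD (C f) (optFilter C Γ b ζ U V f i) =
      1 / K * ∑ i ∈ Finset.range (min K M), waterLevel b ζ (sval (gammaBar C Γ f) i) ^ 2 := by
  filter_upwards [h.rightSingular, h.unitary_U, h.equal_diagonal] with f h1 h2 h3 i
  exact outPSD_optFilter hK (hx.posSemidef f) h1 h2 h3 i

theorem integrable_waterLevel_sum (hx : IsWSSWithPSD P x C) (hΓ : IsAnalogFilter C Γ) :
    Integrable (fun f => ∑ i ∈ Finset.range (min K M),
      waterLevel b ζ (sval (gammaBar C Γ f) i) ^ 2) (bandMeasure fs) := by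
  obtain ⟨hAm, hAi⟩ := integrable_gammaBar hx hΓ
  refine integrable_finsetSum _ fun i _ => ?_
  simp only [waterLevel_sq]
  exact (integrable_waterPower (μ := bandMeasure fs) (fun i j => (hAm i j).restrict) hAi.restrict
    ζ i).const_mul _

theorem IsOptimalFactors.isAnalogFilter (hK : 0 < K) (hx : IsWSSWithPSD P x C)
    (hband : ∀ f : ℝ, fs / 2 < |f| → C f = 0) (hΓ : IsAnalogFilter C Γ)
    (h : IsOptimalFactors fs b η (gammaBar C Γ) ζ U V)
    (hc : ConjSymm (optFilter C Γ b ζ U V)) : IsAnalogFilter C (optFilter C Γ b ζ U V) := by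
  obtain ⟨hAm, hAi⟩ := integrable_gammaBar hx hΓ
  have hAm' : MatrixAEMeasurable (gammaBar C Γ) (bandMeasure fs) := fun i j => (hAm i j).restrict
  refine ⟨fun k m => ?_, hc, fun k => ?_⟩
  · refine aestronglyMeasurable_of_band (fs := fs) ?_ fun f hf => by
      rw [optFilter_eq_zero (hband f hf), Matrix.zero_apply]
    have hD : MatrixAEMeasurable (fun f => sigmaH K b ζ (gammaBar C Γ f)) (bandMeasure fs) :=
      matrixAEMeasurable_rectDiag fun i => (by unfold waterLevel; fun_prop :
        Continuous fun t => waterLevel b ζ t).comp_aestronglyMeasurable (hAm'.sval i)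
    have hS := (MatrixAEMeasurable.sqrt (μ := bandMeasure fs)
      (fun i j => (hx.integrable i j).1.restrict) hx.posSemidef).2
    exact ((MatrixAEMeasurable.mul h.measurable_U hD).mul
      (MatrixAEMeasurable.conjTranspose h.measurable_V)).mul hS k m
  · have hb : Integrable (fun f => outPSD (C f) (optFilter C Γ b ζ U V f k)) (bandMeasure fs) :=
      ((integrable_waterLevel_sum hx hΓ).const_mul (1 / (K : ℝ))).congr
        ((h.outPSD_ae_eq hK hx).mono fun f hf => (hf k).symm)
    rw [bandMeasure, ← IntegrableOn] at hb
    refine (integrableOn_iff_integrable_of_support_subset fun f hf => ?_).1 hb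
    by_contra hm
    rw [Set.mem_Icc, ← abs_le, not_le] at hm
    exact hf (by simp only [hband f hm, outPSD_zero])

/-- All channels have the same power, so the maximum is the average that the normalization
prescribes. At this value the noise level `σ2 * fs` is exactly `1 / 2 ^ (2 * b)`. -/
theorem IsOptimalFactors.iSup_integral_outPSD (hfs : 0 < fs) (hK : 0 < K) (hη : 0 < kappaBar b η)
    (hx : IsWSSWithPSD P x C) (hband : ∀ f : ℝ, fs / 2 < |f| → C f = 0)
    (h : IsOptimalFactors fs b η (gammaBar C Γ) ζ U V) :
    ⨆ k, ∫ f, outPSD (C f) (optFilter C Γ b ζ U V f k) = fs / kappaBar b η := by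
  have hne : Nonempty (Fin K) := ⟨⟨0, hK⟩⟩
  have : ∀ k, ∫ f, outPSD (C f) (optFilter C Γ b ζ U V f k) = fs / kappaBar b η := by
    intro k
    rw [integral_eq_bandMeasure (fs := fs) fun f hf => by simp only [hband f hf, outPSD_zero],
      integral_congr_ae ((h.outPSD_ae_eq hK hx).mono fun f hf => hf k), integral_const_mul,
      h.integral_waterLevel hfs hK hη]
    have : (K : ℝ) ≠ 0 := by exact_mod_cast hK.ne'
    field_simp
  simp only [this, ciSup_const]

end OptimalFilter

/-! ### Entrywise conjugation, for the symmetry of real filters -/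

section Conjugation

open Matrix

variable {m n k : ℕ}

/-- Entrywise complex conjugation. -/
noncomputable abbrev conjMap (A : Matrix (Fin m) (Fin n) ℂ) : Matrix (Fin m) (Fin n) ℂ :=
  A.map (starRingEnd ℂ)

theorem conjMap_conjMap (A : Matrix (Fin m) (Fin n) ℂ) : conjMap (conjMap A) = A := by
  ext i j
  simp

theorem conjMap_mul (A : Matrix (Fin m) (Fin n) ℂ) (B : Matrix (Fin n) (Fin k) ℂ) :
    conjMap (A * B) = conjMap A * conjMap B := Matrix.map_mul

theorem conjMap_sub (A B : Matrix (Fin m) (Fin n) ℂ) :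
    conjMap (A - B) = conjMap A - conjMap B := by
  ext i j
  simp

theorem conjMap_conjTranspose (A : Matrix (Fin m) (Fin n) ℂ) : (conjMap A)ᴴ = conjMap Aᴴ := by
  ext i j
  simp

theorem conjMap_diagonal_ofReal (d : Fin n → ℝ) :
    conjMap (diagonal fun i => (d i : ℂ)) = diagonal fun i => (d i : ℂ) := by
  ext i j
  by_cases h : i = j
  · subst h
    simp
  · simp [h]

theorem frob_conjMap (A : Matrix (Fin m) (Fin n) ℂ) : frob (conjMap A) = frob A := by
  simp [frob]

theorem posSemidef_conjMap {C : Matrix (Fin n) (Fin n) ℂ} (hC : C.PosSemidef) :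
    (conjMap C).PosSemidef := by
  have h : conjMap C = Cᵀ := by
    conv_rhs => rw [← hC.1.eq]
    ext i j
    simp
  rw [h]
  exact hC.transpose

theorem sqrt_conjMap {C : Matrix (Fin n) (Fin n) ℂ} (hC : C.PosSemidef) :
    CFC.sqrt (conjMap C) = conjMap (CFC.sqrt C) := by
  refine CFC.sqrt_unique ?_ ?_
  · rw [← conjMap_mul, CFC.sqrt_mul_sqrt_self C (nonneg_iff_posSemidef.2 hC)]
  · exact nonneg_iff_posSemidef.2 (posSemidef_conjMap (nonneg_iff_posSemidef.1 (CFC.sqrt_nonneg C)))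

theorem pinv_conjMap (A : Matrix (Fin m) (Fin n) ℂ) : pinv (conjMap A) = conjMap (pinv A) := by
  have h := pinv_spec A
  refine (pinv_spec _).unique ⟨?_, ?_, ?_, ?_⟩
  · rw [← conjMap_mul, ← conjMap_mul, h.mul_mul_self]
  · rw [← conjMap_mul, ← conjMap_mul, h.self_mul_mul]
  · rw [← conjMap_mul, conjMap_conjTranspose, h.left_hermitian]
  · rw [← conjMap_mul, conjMap_conjTranspose, h.right_hermitian]

theorem conjMap_mem_unitaryGroup {U : Matrix (Fin n) (Fin n) ℂ} (hU : U ∈ unitaryGroup (Fin n) ℂ) :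
    conjMap U ∈ unitaryGroup (Fin n) ℂ := by
  rw [mem_unitaryGroup_iff, star_eq_conjTranspose] at *
  rw [conjMap_conjTranspose, ← conjMap_mul, hU]
  simp

theorem sval_conjMap (A : Matrix (Fin m) (Fin n) ℂ) (i : ℕ) : sval (conjMap A) i = sval A i := by
  by_cases hi : i < n
  · obtain ⟨V, hV, hAV⟩ := exists_isRightSingularMatrix A
    have h : (conjMap A)ᴴ * conjMap A * conjMap V =
        conjMap V * diagonal fun i : Fin n => ((sval A i ^ 2 : ℝ) : ℂ) := by
      rw [conjMap_conjTranspose, ← conjMap_mul, ← conjMap_mul, hAV, conjMap_mul,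
        conjMap_diagonal_ofReal]
    have := eigenvalues_eq_of_diagonalization (conjMap A) (conjMap_mem_unitaryGroup hV)
      (fun i j hij => pow_le_pow_left₀ (sval_nonneg A j) (sval_antitone A hij) 2) h ⟨i, hi⟩
    exact (sq_eq_sq₀ (sval_nonneg _ _) (sval_nonneg _ _)).1 this
  · rw [sval, sval, LinearMap.singularValues_of_finrank_le _ (by simpa using not_lt.1 hi),
      LinearMap.singularValues_of_finrank_le _ (by simpa using not_lt.1 hi)]

theorem IsRightSingularMatrix.conjMap {A : Matrix (Fin m) (Fin n) ℂ}
    {V : Matrix (Fin n) (Fin n) ℂ} (h : IsRightSingularMatrix A V) :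
    IsRightSingularMatrix (conjMap A) (TaskADC.conjMap V) := by
  refine ⟨conjMap_mem_unitaryGroup h.1, ?_⟩
  simp only [sval_conjMap]
  rw [conjMap_conjTranspose, ← conjMap_mul, ← conjMap_mul, h.2, conjMap_mul,
    conjMap_diagonal_ofReal]

end Conjugation

/-! ### Density of trigonometric polynomials in L² of a finite measure -/

section TrigonometricDensity

variable {fs : ℝ}

theorem exists_trigFilter_eq (hfs : 0 < fs) {p : C(AddCircle fs, ℂ)}
    (hp : p ∈ Submodule.span ℂ (Set.range (fourier (T := fs)))) :
    ∃ (a : ℤ → ℂ) (L : ℕ), ∀ f : ℝ, p f = trigFilter fs a L f := by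
  obtain ⟨c, rfl⟩ := Finsupp.mem_span_range_iff_exists_finsupp.1 hp
  have hfs' : (fs : ℂ) ≠ 0 := by exact_mod_cast hfs.ne'
  refine ⟨fun n => fs * c n, c.support.sup Int.natAbs, fun f => ?_⟩
  have hsub : c.support ⊆ Finset.Icc (-((c.support.sup Int.natAbs : ℕ) : ℤ))
      ((c.support.sup Int.natAbs : ℕ) : ℤ) := fun n hn => by
    have := Finset.le_sup (f := Int.natAbs) hn
    rw [Finset.mem_Icc]
    omega
  rw [Finsupp.sum, ContinuousMap.sum_apply, trigFilter, Finset.mul_sum,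
    Finset.sum_subset hsub fun n _ hn => by simp [Finsupp.notMem_support_iff.1 hn]]
  refine Finset.sum_congr rfl fun n _ => ?_
  rw [ContinuousMap.smul_apply, fourier_coe_apply, smul_eq_mul]
  have : 2 * Real.pi * Complex.I * n * f / fs =
      2 * Real.pi * Complex.I * f * ((n * (1 / fs) : ℝ) : ℂ) := by
    push_cast
    ring
  rw [this]
  push_cast
  field_simp

/-- Continuous functions are dense in L², and trigonometric polynomials are uniformly dense among
them on the circle; uniform closeness controls the L² distance because the measure is finite. -/
theorem exists_trigFilter_near (hfs : 0 < fs) (ν : Measure (AddCircle fs)) [IsFiniteMeasure ν]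
    {u : AddCircle fs → ℂ} (hu : MemLp u 2 ν) {ε : ℝ} (hε : 0 < ε) :
    ∃ (p : C(AddCircle fs, ℂ)) (a : ℤ → ℂ) (L : ℕ), (∀ f : ℝ, p f = trigFilter fs a L f) ∧
      eLpNorm (u - ⇑p) 2 ν ≤ ENNReal.ofReal ε := by
  have : Fact (0 < fs) := ⟨hfs⟩
  obtain ⟨g, hg, -⟩ := hu.exists_boundedContinuous_eLpNorm_sub_le (by simp)
    (ε := ENNReal.ofReal (ε / 2)) (by simpa using hε)
  set B : ℝ := (ν Set.univ).toReal ^ (1 / 2 : ℝ) with hB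
  have hB0 : 0 ≤ B := by positivity
  have hcl : g.toContinuousMap ∈ (Submodule.span ℂ (Set.range (fourier (T := fs)))).topologicalClosure := by
    rw [span_fourier_closure_eq_top]
    trivial
  -- The L² distance is at most `B` times the uniform distance, hence at most `ε / 2`; the `+ 1`
  -- covers `B = 0`.
  obtain ⟨p, hp, hgp⟩ := Metric.mem_closure_iff.1 hcl (ε / (2 * (B + 1))) (by positivity)
  obtain ⟨a, L, ha⟩ := exists_trigFilter_eq hfs hp
  refine ⟨p, a, L, ha, ?_⟩
  have h2 : eLpNorm (⇑g - ⇑p) 2 ν ≤ ENNReal.ofReal (ε / 2) := by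
    refine (eLpNorm_le_of_ae_bound (C := ε / (2 * (B + 1))) (ae_of_all _ fun t => ?_)).trans ?_
    · rw [Pi.sub_apply, ← dist_eq_norm]
      exact (ContinuousMap.dist_apply_le_dist (f := g.toContinuousMap) (g := p) t).trans hgp.le
    · rw [← ENNReal.ofReal_toReal (measure_ne_top ν Set.univ), ENNReal.toReal_ofNat,
        ENNReal.ofReal_rpow_of_nonneg ENNReal.toReal_nonneg (by norm_num),
        ← ENNReal.ofReal_mul (by positivity)]
      refine ENNReal.ofReal_le_ofReal ?_
      rw [← one_div, ← hB, ← mul_div_assoc, div_le_div_iff₀ (by positivity) two_pos]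
      nlinarith
  calc eLpNorm (u - ⇑p) 2 ν = eLpNorm ((u - ⇑g) + (⇑g - ⇑p)) 2 ν := by
        congr 1; funext t; simp
    _ ≤ eLpNorm (u - ⇑g) 2 ν + eLpNorm (⇑g - ⇑p) 2 ν :=
        eLpNorm_add_le (hu.1.sub g.continuous.aestronglyMeasurable)
          (g.continuous.aestronglyMeasurable.sub p.continuous.aestronglyMeasurable) (by norm_num)
    _ ≤ ENNReal.ofReal (ε / 2) + ENNReal.ofReal (ε / 2) := add_le_add hg h2
    _ = ENNReal.ofReal ε := by
        rw [← ENNReal.ofReal_add (by positivity) (by positivity), add_halves]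

/-- Trigonometric polynomials of period `f_s` are dense in `L²` of every finite measure that lives
on one period. -/
theorem exists_trigFilter_eLpNorm_sub_le (hfs : 0 < fs) (μ : Measure ℝ) [IsFiniteMeasure μ]
    (hμ : ∀ᵐ f ∂μ, f ∈ Set.Ioc (-(fs / 2)) (fs / 2)) {u : ℝ → ℂ} (hu : MemLp u 2 μ) {ε : ℝ}
    (hε : 0 < ε) : ∃ (a : ℤ → ℂ) (L : ℕ), eLpNorm (u - trigFilter fs a L) 2 μ ≤ ENNReal.ofReal ε := by
  have : Fact (0 < fs) := ⟨hfs⟩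
  have hmk : Measurable ((↑) : ℝ → AddCircle fs) := (AddCircle.continuous_mk' fs).measurable
  set v : AddCircle fs → ℂ := fun t => hu.1.mk u (AddCircle.measurableEquivIoc fs (-(fs / 2)) t)
    with hv
  have hvm : Measurable v := hu.1.stronglyMeasurable_mk.measurable.comp
    (measurable_subtype_coe.comp (AddCircle.measurableEquivIoc fs (-(fs / 2))).measurable)
  have hvu : (fun f : ℝ => v f) =ᵐ[μ] u := by
    filter_upwards [hμ, hu.1.ae_eq_mk] with f hf hfe
    have : ((AddCircle.measurableEquivIoc fs (-(fs / 2)) (f : AddCircle fs) :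
        Set.Ioc (-(fs / 2)) (-(fs / 2) + fs)) : ℝ) = f := by
      have hf' : f ∈ Set.Ioc (-(fs / 2)) (-(fs / 2) + fs) := ⟨hf.1, by linarith [hf.2]⟩
      exact congrArg Subtype.val (AddCircle.equivIoc_coe_eq hf')
    rw [hv, hfe]
    simp only [this]
  have hv2 : MemLp v 2 (μ.map ((↑) : ℝ → AddCircle fs)) :=
    (memLp_map_measure_iff hvm.aestronglyMeasurable hmk.aemeasurable).2 (hu.ae_eq hvu.symm)
  obtain ⟨p, a, L, ha, hp⟩ := exists_trigFilter_near hfs _ hv2 hε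
  refine ⟨a, L, le_trans (le_of_eq ?_) hp⟩
  rw [eLpNorm_map_measure (hvm.aestronglyMeasurable.sub p.continuous.aestronglyMeasurable)
    hmk.aemeasurable]
  refine eLpNorm_congr_ae (hvu.mono fun f hf => ?_)
  simp only [Pi.sub_apply, Function.comp_apply, ha]
  rw [← hf]

end TrigonometricDensity

/-! ### Weighted approximation of digital responses and reduction to real coefficients -/

section WeightedApproximation

open Matrix

variable {N K M m n k : ℕ} {fs ν : ℝ}

/-- Density is applied to the measure with density `w` on the band. The weight to be used, `frob B +
ν`, is integrable but need not be bounded, so unweighted approximation would not suffice. -/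
theorem exists_trigFilter_integral_le (hfs : 0 < fs) {w : ℝ → ℝ} (hw0 : ∀ f, 0 ≤ w f)
    (hw : Integrable w (bandMeasure fs)) {u : ℝ → ℂ}
    (hum : AEStronglyMeasurable u (bandMeasure fs))
    (hu : Integrable (fun f => w f * ‖u f‖ ^ 2) (bandMeasure fs)) {ε : ℝ} (hε : 0 < ε) :
    ∃ (a : ℤ → ℂ) (L : ℕ),
      Integrable (fun f => w f * ‖u f - trigFilter fs a L f‖ ^ 2) (bandMeasure fs) ∧
      ∫ f, w f * ‖u f - trigFilter fs a L f‖ ^ 2 ∂bandMeasure fs ≤ ε := by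
  set μ := (bandMeasure fs).withDensity fun f => ENNReal.ofReal (w f) with hμ
  have hwm : AEMeasurable (fun f => ENNReal.ofReal (w f)) (bandMeasure fs) :=
    hw.1.aemeasurable.ennreal_ofReal
  have hfin : IsFiniteMeasure μ := isFiniteMeasure_withDensity_ofReal hw.2
  have hac : μ ≪ bandMeasure fs := withDensity_absolutelyContinuous _ _
  have hIoc : ∀ᵐ f ∂μ, f ∈ Set.Ioc (-(fs / 2)) (fs / 2) := by
    refine hac.ae_le ?_
    rw [bandMeasure, ← restrict_Ioc_eq_restrict_Icc]
    exact ae_restrict_mem measurableSet_Ioc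
  have hint : ∀ φ : ℝ → ℝ, Integrable φ μ ↔ Integrable (fun f => w f * φ f) (bandMeasure fs) := by
    intro φ
    rw [hμ, integrable_withDensity_iff_integrable_smul₀' hwm (ae_of_all _ fun f => by simp)]
    simp only [ENNReal.toReal_ofReal (hw0 _), smul_eq_mul]
  have hu2 : MemLp u 2 μ :=
    (memLp_two_iff_integrable_sq_norm (hum.mono_ac hac)).2 ((hint _).2 hu)
  obtain ⟨a, L, ha⟩ := exists_trigFilter_eLpNorm_sub_le hfs μ hIoc hu2 (Real.sqrt_pos.2 hε)
  have hd : MemLp (u - trigFilter fs a L) 2 μ :=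
    ⟨hu2.1.sub (continuous_trigFilter fs a L).aestronglyMeasurable,
      ha.trans_lt ENNReal.ofReal_lt_top⟩
  refine ⟨a, L, (hint _).1 ((memLp_two_iff_integrable_sq_norm hd.1).1 hd), ?_⟩
  have he : ∫ f, ‖(u - trigFilter fs a L) f‖ ^ 2 ∂μ =
      ∫ f, w f * ‖u f - trigFilter fs a L f‖ ^ 2 ∂bandMeasure fs := by
    rw [hμ, integral_withDensity_eq_integral_toReal_smul₀ hwm (ae_of_all _ fun f => by simp)]
    simp only [ENNReal.toReal_ofReal (hw0 _), smul_eq_mul, Pi.sub_apply]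
  rw [hd.eLpNorm_eq_integral_rpow_norm (by simp) (by simp)] at ha
  have h1 := (ENNReal.ofReal_le_ofReal_iff (Real.sqrt_nonneg ε)).1 ha
  simp only [ENNReal.toReal_ofNat, Real.rpow_ofNat, he] at h1
  rw [show ((2 : ℝ)⁻¹) = 1 / 2 by norm_num, ← Real.sqrt_eq_rpow] at h1
  exact (Real.sqrt_le_sqrt_iff hε.le).1 h1

/-- Padding by zeros, used to give all entries of a matrix of filters a common length. -/
theorem trigFilter_extend (fs : ℝ) (a : ℤ → ℂ) {L L' : ℕ} (h : L ≤ L') :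
    trigFilter fs (fun n => if n ∈ Finset.Icc (-(L : ℤ)) L then a n else 0) L' =
      trigFilter fs a L := by
  funext f
  have hsub : Finset.Icc (-(L : ℤ)) L ⊆ Finset.Icc (-(L' : ℤ)) L' :=
    Finset.Icc_subset_Icc (by omega) (by omega)
  rw [trigFilter, trigFilter, ← Finset.sum_subset hsub fun n _ hn => by rw [if_neg hn, zero_mul]]
  congr 1
  exact Finset.sum_congr rfl fun n hn => by rw [if_pos hn]

theorem exists_trigMatrix_integral_le (hfs : 0 < fs) {w : ℝ → ℝ} (hw0 : ∀ f, 0 ≤ w f)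
    (hw : Integrable w (bandMeasure fs)) {g : ℝ → Matrix (Fin N) (Fin K) ℂ}
    (hgm : MatrixAEMeasurable g (bandMeasure fs))
    (hg : Integrable (fun f => w f * frob (g f)) (bandMeasure fs)) {ε : ℝ} (hε : 0 < ε) :
    ∃ (a : Fin N → Fin K → ℤ → ℂ) (L : ℕ),
      Integrable (fun f => w f * frob (g f - trigMatrix fs a L f)) (bandMeasure fs) ∧
      ∫ f, w f * frob (g f - trigMatrix fs a L f) ∂bandMeasure fs ≤ ε := by
  have hgi : ∀ i k, Integrable (fun f => w f * ‖g f i k‖ ^ 2) (bandMeasure fs) := fun i k => by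
    refine hg.mono' (hw.1.mul ((hgm i k).norm.pow 2)) (ae_of_all _ fun f => ?_)
    rw [Real.norm_of_nonneg (mul_nonneg (hw0 f) (sq_nonneg _))]
    refine mul_le_mul_of_nonneg_left ?_ (hw0 f)
    exact (Finset.single_le_sum (f := fun k => ‖g f i k‖ ^ 2) (fun _ _ => sq_nonneg _)
      (Finset.mem_univ k)).trans (Finset.single_le_sum (f := fun i => ∑ k, ‖g f i k‖ ^ 2)
        (fun _ _ => Finset.sum_nonneg fun _ _ => sq_nonneg _) (Finset.mem_univ i))
  have hε' : 0 < ε / (N * K + 1) := by positivity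
  choose a L hi hle using fun i k =>
    exists_trigFilter_integral_le hfs hw0 hw (hgm i k) (hgi i k) hε'
  set L' := Finset.univ.sup fun p : Fin N × Fin K => L p.1 p.2 with hL'
  have hLL : ∀ i k, L i k ≤ L' := fun i k =>
    Finset.le_sup (f := fun p : Fin N × Fin K => L p.1 p.2) (Finset.mem_univ (i, k))
  have he : ∀ f, w f * frob (g f - trigMatrix fs (fun i k n =>
      if n ∈ Finset.Icc (-(L i k : ℤ)) (L i k) then a i k n else 0) L' f) =
      ∑ i, ∑ k, w f * ‖g f i k - trigFilter fs (a i k) (L i k) f‖ ^ 2 := by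
    intro f
    simp only [frob, Finset.mul_sum, trigMatrix, Matrix.sub_apply, of_apply, trigFilter_extend fs _ (hLL _ _)]
  refine ⟨fun i k n => if n ∈ Finset.Icc (-(L i k : ℤ)) (L i k) then a i k n else 0, L', ?_, ?_⟩
  · simp only [he]
    exact integrable_finsetSum _ fun i _ => integrable_finsetSum _ fun k _ => hi i k
  · simp only [he]
    rw [integral_finsetSum _ fun i _ => integrable_finsetSum _ fun k _ => hi i k]
    simp only [integral_finsetSum _ fun k _ => hi _ k]
    calc _ ≤ ∑ _i : Fin N, ∑ _k : Fin K, ε / (N * K + 1) :=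
          Finset.sum_le_sum fun i _ => Finset.sum_le_sum fun k _ => hle i k
      _ = N * K * (ε / (N * K + 1)) := by simp [mul_assoc]
      _ ≤ ε := by
          rw [← mul_div_assoc, div_le_iff₀ (by positivity)]
          nlinarith

theorem frob_mul_le (A : Matrix (Fin m) (Fin n) ℂ) (B : Matrix (Fin n) (Fin k) ℂ) :
    frob (A * B) ≤ frob A * frob B := by
  unfold frob
  rw [Finset.sum_mul]
  refine Finset.sum_le_sum fun i _ => ?_
  rw [Finset.sum_comm (f := fun i j => ‖B i j‖ ^ 2), Finset.mul_sum]
  refine Finset.sum_le_sum fun j _ => ?_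
  refine (pow_le_pow_left₀ (norm_nonneg _) ?_ 2).trans (Finset.sum_mul_sq_le_sq_mul_sq _ _ _)
  rw [Matrix.mul_apply]
  exact (norm_sum_le _ _).trans (Finset.sum_le_sum fun l _ => (norm_mul _ _).le)

theorem frob_le_add (X Y : Matrix (Fin m) (Fin n) ℂ) {δ : ℝ} (hδ : 0 < δ) :
    frob X ≤ (1 + δ) * frob Y + (1 + δ⁻¹) * frob (X - Y) := by
  unfold frob
  simp only [Finset.mul_sum, ← Finset.sum_add_distrib]
  exact Finset.sum_le_sum fun i _ => Finset.sum_le_sum fun j _ => norm_sq_le_add _ _ hδ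

theorem frob_sub_comm (X Y : Matrix (Fin m) (Fin n) ℂ) : frob (X - Y) = frob (Y - X) := by
  simp only [frob, Matrix.sub_apply, norm_sub_rev]

theorem errorDensity_nonneg (A : Matrix (Fin N) (Fin M) ℂ) (B : Matrix (Fin K) (Fin M) ℂ)
    (hν : 0 ≤ ν) (g : Matrix (Fin N) (Fin K) ℂ) : 0 ≤ errorDensity A B ν g :=
  add_nonneg (frob_nonneg _) (mul_nonneg hν (frob_nonneg _))

/-- Replacing `g` by `g'` perturbs the residual by `(g - g') * B` and the filter by `g - g'`. The
weight `frob B + ν` dominates both contributions. -/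
theorem errorDensity_le_add (A : Matrix (Fin N) (Fin M) ℂ) (B : Matrix (Fin K) (Fin M) ℂ)
    (hν : 0 ≤ ν) (g g' : Matrix (Fin N) (Fin K) ℂ) {δ : ℝ} (hδ : 0 < δ) :
    errorDensity A B ν g' ≤ (1 + δ) * errorDensity A B ν g +
      (1 + δ⁻¹) * ((frob B + ν) * frob (g - g')) := by
  have h1 := frob_le_add (A - g' * B) (A - g * B) hδ
  have h2 := frob_le_add g' g hδ
  have h3 : A - g' * B - (A - g * B) = (g - g') * B := by rw [Matrix.sub_mul]; abel
  rw [h3] at h1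
  rw [frob_sub_comm] at h2
  have h4 : (1 + δ⁻¹) * frob ((g - g') * B) ≤ (1 + δ⁻¹) * (frob (g - g') * frob B) :=
    mul_le_mul_of_nonneg_left (frob_mul_le _ _) (by positivity)
  have h5 := mul_le_mul_of_nonneg_left h2 hν
  unfold errorDensity
  linarith

theorem MatrixAEMeasurable.errorDensity {A : ℝ → Matrix (Fin N) (Fin M) ℂ}
    {B : ℝ → Matrix (Fin K) (Fin M) ℂ} {g : ℝ → Matrix (Fin N) (Fin K) ℂ} {μ : Measure ℝ}
    (hA : MatrixAEMeasurable A μ) (hB : MatrixAEMeasurable B μ) (hg : MatrixAEMeasurable g μ) :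
    AEStronglyMeasurable (fun f => errorDensity (A f) (B f) ν (g f)) μ :=
  (hA.sub (hg.mul hB)).frob.add (hg.frob.const_mul ν)

theorem trigMatrix_matrixAEMeasurable (a : Fin N → Fin K → ℤ → ℂ) (L : ℕ) (μ : Measure ℝ) :
    MatrixAEMeasurable (trigMatrix fs a L) μ := fun i k =>
  (continuous_trigFilter fs (a i k) L).aestronglyMeasurable

theorem trigFilter_neg (a : ℤ → ℂ) (L : ℕ) (f : ℝ) :
    trigFilter fs a L (-f) = starRingEnd ℂ (trigFilter fs (fun n => starRingEnd ℂ (a n)) L f) := by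
  simp only [trigFilter, map_mul, map_sum, Complex.conj_ofReal, Complex.conj_conj,
    ← Complex.exp_conj, Complex.conj_I, map_ofNat, Complex.ofReal_neg]
  congr 1
  refine Finset.sum_congr rfl fun n _ => ?_
  congr 2
  ring

theorem trigMatrix_neg (a : Fin N → Fin K → ℤ → ℂ) (L : ℕ) (f : ℝ) :
    trigMatrix fs a L (-f) = conjMap (trigMatrix fs (fun i k n => starRingEnd ℂ (a i k n)) L f) := by
  ext i k
  exact trigFilter_neg _ _ _

theorem errorDensity_conjMap (A : Matrix (Fin N) (Fin M) ℂ) (B : Matrix (Fin K) (Fin M) ℂ)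
    (g : Matrix (Fin N) (Fin K) ℂ) :
    errorDensity (conjMap A) (conjMap B) ν (conjMap g) = errorDensity A B ν g := by
  rw [errorDensity, ← conjMap_mul, ← conjMap_sub, frob_conjMap, frob_conjMap, errorDensity]

theorem trigMatrix_re (a : Fin N → Fin K → ℤ → ℂ) (L : ℕ) (f : ℝ) :
    trigMatrix fs (fun i k n => ((a i k n).re : ℂ)) L f = (1 / 2 : ℂ) •
      (trigMatrix fs a L f + trigMatrix fs (fun i k n => starRingEnd ℂ (a i k n)) L f) := by
  ext i k
  simp only [trigMatrix, of_apply, Matrix.smul_apply, Matrix.add_apply, trigFilter, smul_eq_mul,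
    Complex.re_eq_add_conj]
  simp only [Finset.mul_sum]
  rw [← Finset.sum_add_distrib, Finset.mul_sum]
  refine Finset.sum_congr rfl fun n _ => ?_
  ring

theorem frob_midpoint_le (X Y : Matrix (Fin m) (Fin n) ℂ) :
    frob ((1 / 2 : ℂ) • (X + Y)) ≤ 1 / 2 * (frob X + frob Y) := by
  unfold frob
  rw [← Finset.sum_add_distrib, Finset.mul_sum]
  refine Finset.sum_le_sum fun i _ => ?_
  rw [← Finset.sum_add_distrib, Finset.mul_sum]
  refine Finset.sum_le_sum fun j _ => ?_
  have h1 := norm_add_le (X i j) (Y i j)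
  rw [Matrix.smul_apply, Matrix.add_apply, norm_smul, mul_pow]
  have h2 := pow_le_pow_left₀ (norm_nonneg _) h1 2
  norm_num
  nlinarith [sq_nonneg (‖X i j‖ - ‖Y i j‖)]

theorem errorDensity_midpoint_le (A : Matrix (Fin N) (Fin M) ℂ) (B : Matrix (Fin K) (Fin M) ℂ)
    (hν : 0 ≤ ν) (g g' : Matrix (Fin N) (Fin K) ℂ) :
    errorDensity A B ν ((1 / 2 : ℂ) • (g + g')) ≤
      1 / 2 * (errorDensity A B ν g + errorDensity A B ν g') := by
  have h : A - (1 / 2 : ℂ) • (g + g') * B =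
      (1 / 2 : ℂ) • ((A - g * B) + (A - g' * B)) := by
    ext i j
    simp only [Matrix.smul_mul, Matrix.add_mul, Matrix.sub_apply, Matrix.smul_apply,
      Matrix.add_apply, smul_eq_mul]
    ring
  have h1 := frob_midpoint_le (A - g * B) (A - g' * B)
  have h2 := mul_le_mul_of_nonneg_left (frob_midpoint_le g g') hν
  rw [errorDensity, h]
  unfold errorDensity
  linarith

theorem measurePreserving_neg_bandMeasure (fs : ℝ) :
    MeasurePreserving (fun f : ℝ => -f) (bandMeasure fs) (bandMeasure fs) := by
  have h := (Measure.measurePreserving_neg (volume : Measure ℝ)).restrict_preimage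
    (s := Set.Icc (-(fs / 2)) (fs / 2)) measurableSet_Icc
  have e : (fun f : ℝ => -f) ⁻¹' Set.Icc (-(fs / 2)) (fs / 2) = Set.Icc (-(fs / 2)) (fs / 2) := by
    ext f
    simp only [Set.mem_preimage, Set.mem_Icc]
    constructor <;> rintro ⟨h1, h2⟩ <;> constructor <;> linarith
  have e' : (Neg.neg : ℝ → ℝ) ⁻¹' Set.Icc (-(fs / 2)) (fs / 2) = Set.Icc (-(fs / 2)) (fs / 2) := e
  rw [e'] at h
  exact h

/-- Complex digital filters are no better than real ones. -/
theorem integral_errorDensity_re_le {A : ℝ → Matrix (Fin N) (Fin M) ℂ}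
    {B : ℝ → Matrix (Fin K) (Fin M) ℂ} (hA : ∀ᵐ f ∂bandMeasure fs, A (-f) = conjMap (A f))
    (hB : ∀ᵐ f ∂bandMeasure fs, B (-f) = conjMap (B f))
    (hν : 0 ≤ ν) (a : Fin N → Fin K → ℤ → ℂ) (L : ℕ)
    (hi : Integrable (fun f => errorDensity (A f) (B f) ν (trigMatrix fs a L f)) (bandMeasure fs)) :
    ∫ f, errorDensity (A f) (B f) ν (trigMatrix fs (fun i k n => ((a i k n).re : ℂ)) L f)
      ∂bandMeasure fs ≤
    ∫ f, errorDensity (A f) (B f) ν (trigMatrix fs a L f) ∂bandMeasure fs := by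
  set φ := fun f => errorDensity (A f) (B f) ν (trigMatrix fs a L f) with hφ
  set ψ := fun f => errorDensity (A f) (B f) ν
    (trigMatrix fs (fun i k n => starRingEnd ℂ (a i k n)) L f) with hψ
  have hmp := measurePreserving_neg_bandMeasure fs
  -- Reflecting the frequency conjugates `A`, `B` and the coefficients, so the filter with conjugate
  -- coefficients has the same total error. The real parts are the midpoint of the two filters, and
  -- the error is convex.
  have hψe : (fun f => φ (-f)) =ᵐ[bandMeasure fs] ψ := by
    filter_upwards [hA, hB] with f h1 h2
    simp only [hφ, hψ]
    rw [h1, h2, trigMatrix_neg, errorDensity_conjMap]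
  have hφn : Integrable (fun f => φ (-f)) (bandMeasure fs) := hmp.integrable_comp_of_integrable hi
  have hψi : Integrable ψ (bandMeasure fs) := hφn.congr hψe
  have hψ' : ∫ f, ψ f ∂bandMeasure fs = ∫ f, φ f ∂bandMeasure fs := by
    rw [← integral_congr_ae hψe]
    exact hmp.integral_comp (MeasurableEquiv.neg ℝ).measurableEmbedding φ
  have hle : ∀ f, errorDensity (A f) (B f) ν
      (trigMatrix fs (fun i k n => ((a i k n).re : ℂ)) L f) ≤ 1 / 2 * (φ f + ψ f) := fun f => by
    rw [trigMatrix_re]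
    exact errorDensity_midpoint_le _ _ hν _ _
  have hri : Integrable (fun f => 1 / 2 * (φ f + ψ f)) (bandMeasure fs) :=
    (hi.add hψi).const_mul _
  calc _ ≤ ∫ f, 1 / 2 * (φ f + ψ f) ∂bandMeasure fs := by
        refine integral_mono_of_nonneg (ae_of_all _ fun f => errorDensity_nonneg _ _ hν _) hri
          (ae_of_all _ hle)
    _ = ∫ f, φ f ∂bandMeasure fs := by
        rw [integral_const_mul, integral_add hi hψi, hψ']
        ring

end WeightedApproximation

/-! ### Upper bound: the error of any admissible digital response is approached -/

section UpperBound

open Matrix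

variable {Ω : Type*} [MeasurableSpace Ω] {P : Measure Ω} {M N K m : ℕ} {x : Fin M → ℝ → Ω → ℝ}
  {C : ℝ → Matrix (Fin M) (Fin M) ℂ} {s st : Fin N → Ω → ℝ} {fs : ℝ}
  {H : ℝ → Matrix (Fin K) (Fin M) ℂ} {z y e : Fin K → ℤ → Ω → ℝ} {σ2 : ℝ}

theorem IsAnalogFilter.mul_sqrt_neg (hx : IsWSSWithPSD P x C) {A : ℝ → Matrix (Fin m) (Fin M) ℂ}
    (hA : ConjSymm A) : ∀ᵐ f, A (-f) * CFC.sqrt (C (-f)) = conjMap (A f * CFC.sqrt (C f)) := by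
  filter_upwards [hA, hx.conjSymm] with f h1 h2
  rw [h1, h2, conjMap_mul, ← sqrt_conjMap (hx.posSemidef f)]

/-- The infimum over digital filters is at most the error of any square integrable frequency
response, realizable or not. -/
theorem IsAdditiveModel.mse_le (hfs : 0 < fs) (hx : IsWSSWithPSD P x C)
    (hband : ∀ f : ℝ, fs / 2 < |f| → C f = 0) {Γ : ℝ → Matrix (Fin N) (Fin M) ℂ}
    (hΓ : IsAnalogFilter C Γ) (hst : ∀ i, IsFilteredAt P x C (fun f => Γ f i) 0 (st i))
    (hH : IsAnalogFilter C H) (hσ : 0 < σ2) (h : IsAdditiveModel P x C s fs σ2 H y e z)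
    {g : ℝ → Matrix (Fin N) (Fin K) ℂ} (hgm : MatrixAEMeasurable g (bandMeasure fs))
    (hg : Integrable (fun f => (frob (H f * CFC.sqrt (C f)) + σ2 * fs) * frob (g f))
      (bandMeasure fs))
    (hgJ : Integrable (fun f => errorDensity (gammaBar C Γ f) (H f * CFC.sqrt (C f)) (σ2 * fs)
      (g f)) (bandMeasure fs)) :
    mse P st z ≤ ∫ f, errorDensity (gammaBar C Γ f) (H f * CFC.sqrt (C f)) (σ2 * fs) (g f)
      ∂bandMeasure fs := by
  have hν : 0 < σ2 * fs := mul_pos hσ hfs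
  have hS := (MatrixAEMeasurable.sqrt (fun i j => (hx.integrable i j).1) hx.posSemidef).1
  have hAm : MatrixAEMeasurable (gammaBar C Γ) (bandMeasure fs) := fun i j =>
    (MatrixAEMeasurable.mul hΓ.measurable hS i j).restrict
  have hBm : MatrixAEMeasurable (fun f => H f * CFC.sqrt (C f)) (bandMeasure fs) := fun i j =>
    (MatrixAEMeasurable.mul hH.measurable hS i j).restrict
  have hBi : Integrable (fun f => frob (H f * CFC.sqrt (C f))) (bandMeasure fs) :=
    (hH.integrable_frob hx).restrict
  have hw : Integrable (fun f => frob (H f * CFC.sqrt (C f)) + σ2 * fs) (bandMeasure fs) :=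
    hBi.add (integrable_const _)
  have hA : ∀ᵐ f ∂bandMeasure fs, gammaBar C Γ (-f) = conjMap (gammaBar C Γ f) :=
    ae_restrict_of_ae (IsAnalogFilter.mul_sqrt_neg hx hΓ.conjSymm)
  have hB : ∀ᵐ f ∂bandMeasure fs, H (-f) * CFC.sqrt (C (-f)) = conjMap (H f * CFC.sqrt (C f)) :=
    ae_restrict_of_ae (IsAnalogFilter.mul_sqrt_neg hx hH.conjSymm)
  refine le_of_approx fun ε hε => ?_
  obtain ⟨a, L, hai, hale⟩ := exists_trigMatrix_integral_le hfs
    (fun f => add_nonneg (frob_nonneg _) hν.le) hw hgm hg hε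
  have hpt : ∀ δ > 0, ∀ f, errorDensity (gammaBar C Γ f) (H f * CFC.sqrt (C f)) (σ2 * fs)
      (trigMatrix fs a L f) ≤ (1 + δ) * errorDensity (gammaBar C Γ f) (H f * CFC.sqrt (C f))
        (σ2 * fs) (g f) + (1 + δ⁻¹) * ((frob (H f * CFC.sqrt (C f)) + σ2 * fs) *
        frob (g f - trigMatrix fs a L f)) := fun δ hδ f =>
    errorDensity_le_add _ _ hν.le _ _ hδ
  have hai' : Integrable (fun f => errorDensity (gammaBar C Γ f) (H f * CFC.sqrt (C f)) (σ2 * fs)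
      (trigMatrix fs a L f)) (bandMeasure fs) := by
    refine ((hgJ.const_mul (1 + 1)).add (hai.const_mul (1 + 1⁻¹))).mono'
      (hAm.errorDensity hBm (trigMatrix_matrixAEMeasurable a L _)) (ae_of_all _ fun f => ?_)
    rw [Real.norm_of_nonneg (errorDensity_nonneg _ _ hν.le _)]
    exact hpt 1 one_pos f
  refine ⟨∫ f, errorDensity (gammaBar C Γ f) (H f * CFC.sqrt (C f)) (σ2 * fs)
    (trigMatrix fs a L f) ∂bandMeasure fs, fun δ hδ => ?_, fun δ hδ => ?_⟩
  · set T := ∫ f, errorDensity (gammaBar C Γ f) (H f * CFC.sqrt (C f)) (σ2 * fs)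
      (trigMatrix fs a L f) ∂bandMeasure fs with hT
    have hT0 : 0 ≤ T := integral_nonneg fun f => errorDensity_nonneg _ _ hν.le _
    have hle : mse P st z ≤ T := by
      -- The estimate uses `G (-n)`, hence the reversed index; cutting off beyond `L` makes the
      -- filter finite.
      set G : ℤ → Matrix (Fin N) (Fin K) ℝ := fun n =>
        of fun i k => if |n| ≤ (L : ℤ) then (a i k (-n)).re else 0 with hG
      have h1 := mse_le_of_truncEstimate (G := G) (L := L) (fun i => (hst i).1)
        (fun k n => h.memLp k n) fun n hn => by
          ext i k
          simp only [hG, of_apply, abs_neg, if_neg (not_le.2 hn), Matrix.zero_apply]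
      refine h1.trans ?_
      rw [(h.sum_integral_sub_truncEstimate_sq hfs hx hband hΓ hst hH G L).2]
      have e1 : trigMatrix fs (fun i k n => ((G (-n) i k : ℝ) : ℂ)) L =
          trigMatrix fs (fun i k n => ((a i k n).re : ℂ)) L := by
        funext f
        ext i k
        simp only [trigMatrix, of_apply, trigFilter]
        congr 1
        refine Finset.sum_congr rfl fun n hn => ?_
        have : |(-n : ℤ)| ≤ (L : ℤ) := by
          rw [abs_neg, abs_le]
          exact Finset.mem_Icc.1 hn
        simp only [hG, of_apply, if_pos this, neg_neg]
      rw [e1]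
      exact integral_errorDensity_re_le hA hB hν.le a L hai'
    have h2 : 0 ≤ δ * T := by positivity
    have h3 : 0 ≤ (1 + δ⁻¹) * ε := by positivity
    linarith
  · have hri : Integrable (fun f => (1 + δ) * errorDensity (gammaBar C Γ f) (H f * CFC.sqrt (C f))
        (σ2 * fs) (g f) + (1 + δ⁻¹) * ((frob (H f * CFC.sqrt (C f)) + σ2 * fs) *
        frob (g f - trigMatrix fs a L f))) (bandMeasure fs) :=
      (hgJ.const_mul _).add (hai.const_mul _)
    refine (integral_mono hai' hri (hpt δ hδ)).trans ?_
    rw [integral_add (hgJ.const_mul _) (hai.const_mul _), integral_const_mul, integral_const_mul]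
    have := mul_le_mul_of_nonneg_left hale (by positivity : 0 ≤ 1 + δ⁻¹)
    linarith

end UpperBound

/-! ### Attainment of the bound and optimality -/

section Optimality

open Matrix

variable {Ω : Type*} [MeasurableSpace Ω] {P : Measure Ω} {M N K b : ℕ} {x : Fin M → ℝ → Ω → ℝ}
  {C : ℝ → Matrix (Fin M) (Fin M) ℂ} {s st : Fin N → Ω → ℝ} {fs η ζ : ℝ}
  {Γ : ℝ → Matrix (Fin N) (Fin M) ℂ} {U : ℝ → Matrix (Fin K) (Fin K) ℂ}
  {V : ℝ → Matrix (Fin M) (Fin M) ℂ}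
  {H : ℝ → Matrix (Fin K) (Fin M) ℂ} {z y e : Fin K → ℤ → Ω → ℝ} {σ2 : ℝ}

/-- Square integrability, not just integrability, is needed: the weighted energy of the digital
filter in `errorDensity_optDigital` contains the square of the total water power. -/
theorem memLp_waterPower {A : ℝ → Matrix (Fin N) (Fin M) ℂ} {μ : Measure ℝ}
    (hA : MatrixAEMeasurable A μ) (hi : Integrable (fun f => frob (A f)) μ) (hζ : 0 ≤ ζ) (i : ℕ) :
    MemLp (fun f => waterPower ζ (sval (A f) i)) 2 μ := by
  have hm : AEStronglyMeasurable (fun f => waterPower ζ (sval (A f) i)) μ :=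
    (by unfold waterPower; fun_prop :
      Continuous fun t => waterPower ζ t).comp_aestronglyMeasurable (hA.sval i)
  refine (((memLp_two_iff_integrable_sq (hA.sval i)).2 (integrable_sval_sq hA hi i)).const_mul
    ζ).of_le hm (ae_of_all _ fun f => ?_)
  have h0 : 0 ≤ ζ * sval (A f) i := mul_nonneg hζ (sval_nonneg _ _)
  rw [Real.norm_of_nonneg (waterPower_nonneg _ _), Real.norm_of_nonneg h0]
  exact max_le (by linarith) h0

/-- The digital filter that attains the bound for the whitened task `A`, before truncation. -/
noncomputable def optDigital (K b : ℕ) (ζ : ℝ) (A : Matrix (Fin N) (Fin M) ℂ)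
    (U : Matrix (Fin K) (Fin K) ℂ) (V : Matrix (Fin M) (Fin M) ℂ) : Matrix (Fin N) (Fin K) ℂ :=
  ((2 ^ b : ℝ) : ℂ) • (A * V * (rectDiag K M fun i => √(waterPower ζ (sval A i)) /
    (1 + waterPower ζ (sval A i)))ᴴ * Uᴴ)

/-- The factors `2^{-b}` in `sigmaH` and `2^b` in `optDigital` cancel in the product, and the noise
level `2^{-2b}` normalizes the digital filter; this is the setting of `water_filling_attains`. The
second identity supplies the integrability required for approximation by trigonometric polynomials.
-/
theorem errorDensity_optDigital {A : Matrix (Fin N) (Fin M) ℂ} {U : Matrix (Fin K) (Fin K) ℂ}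
    {V : Matrix (Fin M) (Fin M) ℂ} (hV : IsRightSingularMatrix A V)
    (hU : U ∈ unitaryGroup (Fin K) ℂ) (hζ : 0 < ζ) :
    errorDensity A (U * sigmaH K b ζ A * Vᴴ) ((1 / 2 ^ b) ^ 2) (optDigital K b ζ A U V) =
      thresholdedError K ζ⁻¹ A -
        ζ⁻¹ ^ 2 * ∑ i ∈ Finset.range (min K M), waterPower ζ (sval A i) ∧
    (frob (U * sigmaH K b ζ A * Vᴴ) + (1 / 2 ^ b) ^ 2) * frob (optDigital K b ζ A U V) =
      ζ⁻¹ ^ 2 * ((∑ i ∈ Finset.range (min K M), waterPower ζ (sval A i)) +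
        (∑ i ∈ Finset.range (min K M), waterPower ζ (sval A i)) ^ 2) := by
  have h2 : (2 : ℝ) ^ b ≠ 0 := by positivity
  obtain ⟨h3, h4⟩ := water_filling_attains hV hU hζ
  have hg : frob (optDigital K b ζ A U V) = (2 ^ b) ^ 2 *
      (ζ⁻¹ ^ 2 * ∑ i ∈ Finset.range (min K M), waterPower ζ (sval A i)) := by
    rw [optDigital, frob_smul_real, h4]
  have hB : frob (U * sigmaH K b ζ A * Vᴴ) =
      (1 / 2 ^ b) ^ 2 * ∑ i ∈ Finset.range (min K M), waterPower ζ (sval A i) := by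
    rw [frob_mul_conjTranspose_unitary _ hV.1, frob_unitary_mul _ hU, sigmaH_eq_rectDiag,
      frob_rectDiag, Finset.mul_sum]
    simp only [waterLevel_sq]
  have hgB : optDigital K b ζ A U V * (U * sigmaH K b ζ A * Vᴴ) =
      A * V * (rectDiag K M fun i => √(waterPower ζ (sval A i)) /
        (1 + waterPower ζ (sval A i)))ᴴ * Uᴴ *
      (U * rectDiag K M (fun i => √(waterPower ζ (sval A i))) * Vᴴ) := by
    rw [optDigital, sigmaH_eq_smul, Matrix.mul_smul, Matrix.smul_mul, Matrix.smul_mul,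
      Matrix.mul_smul, smul_smul, ← Complex.ofReal_mul, mul_one_div_cancel h2, Complex.ofReal_one,
      one_smul]
  constructor
  · rw [errorDensity, hgB, hg, thresholdedError]
    rw [h4] at h3
    rw [← mul_assoc, ← mul_pow, one_div_mul_cancel h2, one_pow, one_mul]
    linarith
  · rw [hB, hg]
    field_simp
    ring

/-- The mean-squared error of the optimal front end is at most the value of the lower bound. -/
theorem IsAdditiveModel.mse_optFilter_le (hfs : 0 < fs) (hK : 0 < K) (hκ : 0 < kappaBar b η)
    (hx : IsWSSWithPSD P x C) (hband : ∀ f : ℝ, fs / 2 < |f| → C f = 0)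
    (hΓ : IsAnalogFilter C Γ) (hst : ∀ i, IsFilteredAt P x C (fun f => Γ f i) 0 (st i))
    (ho : IsOptimalFactors fs b η (gammaBar C Γ) ζ U V)
    (hH : IsAnalogFilter C (optFilter C Γ b ζ U V)) (hσ : 0 < σ2)
    (hσe : σ2 = kappaBar b η / 2 ^ (2 * b) *
      ((1 / fs) ^ 2 * ⨆ k, ∫ f, outPSD (C f) (optFilter C Γ b ζ U V f k)))
    (h : IsAdditiveModel P x C s fs σ2 (optFilter C Γ b ζ U V) y e z) :
    mse P st z ≤ (∫ f, thresholdedError K ζ⁻¹ (gammaBar C Γ f) ∂bandMeasure fs) -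
      ζ⁻¹ ^ 2 * (K * fs * 2 ^ (2 * b) / kappaBar b η) := by
  have hζ := ho.pos
  have hν : σ2 * fs = (1 / 2 ^ b) ^ 2 := by
    rw [hσe, ho.iSup_integral_outPSD hfs hK hκ hx hband, mul_comm 2 b, pow_mul]
    field_simp
  obtain ⟨hAm', hAi'⟩ := integrable_gammaBar hx hΓ
  have hAm : MatrixAEMeasurable (gammaBar C Γ) (bandMeasure fs) := fun i j => (hAm' i j).restrict
  have hAi : Integrable (fun f => frob (gammaBar C Γ f)) (bandMeasure fs) := hAi'.restrict
  have hβ : MemLp (fun f => ∑ i ∈ Finset.range (min K M), waterPower ζ (sval (gammaBar C Γ f) i)) 2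
      (bandMeasure fs) := memLp_finsetSum _ fun i _ => memLp_waterPower hAm hAi hζ.le i
  have hβi := hβ.integrable one_le_two
  have hD := integrable_thresholdedError (K := K) hAm hAi (inv_nonneg.2 hζ.le)
  have hDi : Integrable (fun f => thresholdedError K ζ⁻¹ (gammaBar C Γ f) -
      ζ⁻¹ ^ 2 * ∑ i ∈ Finset.range (min K M), waterPower ζ (sval (gammaBar C Γ f) i))
      (bandMeasure fs) := hD.sub (hβi.const_mul _)
  set g : ℝ → Matrix (Fin N) (Fin K) ℂ := fun f => optDigital K b ζ (gammaBar C Γ f) (U f) (V f)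
    with hg
  have hpt : ∀ᵐ f ∂bandMeasure fs,
      errorDensity (gammaBar C Γ f) (optFilter C Γ b ζ U V f * CFC.sqrt (C f)) (σ2 * fs) (g f) =
        thresholdedError K ζ⁻¹ (gammaBar C Γ f) -
          ζ⁻¹ ^ 2 * ∑ i ∈ Finset.range (min K M), waterPower ζ (sval (gammaBar C Γ f) i) ∧
      (frob (optFilter C Γ b ζ U V f * CFC.sqrt (C f)) + σ2 * fs) * frob (g f) =
        ζ⁻¹ ^ 2 * ((∑ i ∈ Finset.range (min K M), waterPower ζ (sval (gammaBar C Γ f) i)) +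
          (∑ i ∈ Finset.range (min K M), waterPower ζ (sval (gammaBar C Γ f) i)) ^ 2) := by
    filter_upwards [ho.rightSingular, ho.unitary_U] with f hV hU
    rw [optFilter_mul_sqrt hV, hν]
    exact errorDensity_optDigital hV hU hζ
  have hgm : MatrixAEMeasurable g (bandMeasure fs) := by
    have hc : Continuous fun t => √(waterPower ζ t) / (1 + waterPower ζ t) := by
      have h1 : Continuous fun t => waterPower ζ t := by unfold waterPower; fun_prop
      exact h1.sqrt.div (by fun_prop) fun t => by linarith [waterPower_nonneg ζ t]
    have hR : MatrixAEMeasurable (fun f => rectDiag K M fun i =>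
        √(waterPower ζ (sval (gammaBar C Γ f) i)) / (1 + waterPower ζ (sval (gammaBar C Γ f) i)))
        (bandMeasure fs) :=
      matrixAEMeasurable_rectDiag fun i => hc.comp_aestronglyMeasurable (hAm.sval i)
    have hp := ((hAm.mul ho.measurable_V).mul hR.conjTranspose).mul
      (MatrixAEMeasurable.conjTranspose ho.measurable_U)
    exact fun i j => (hp i j).const_mul _
  have hle := h.mse_le hfs hx hband hΓ hst hH hσ hgm
    (((hβi.add hβ.integrable_sq).const_mul (ζ⁻¹ ^ 2)).congr (hpt.mono fun f hf => hf.2.symm))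
    (hDi.congr (hpt.mono fun f hf => hf.1.symm))
  refine hle.trans (le_of_eq ?_)
  rw [integral_congr_ae (hpt.mono fun f hf => hf.1), integral_sub hD (hβi.const_mul _),
    integral_const_mul]
  have hw := ho.integral_waterLevel hfs hK hκ
  simp only [waterLevel_sq, ← Finset.mul_sum] at hw
  rw [integral_const_mul] at hw
  congr 2
  rw [eq_div_iff hκ.ne'] at hw ⊢
  rw [mul_comm 2 b, pow_mul, ← hw]
  field_simp

/-- Inputs are measurable for the conditioning σ-algebra and can be pulled out of the conditional
expectation. -/
theorem integral_sub_condExp_mul_input [IsProbabilityMeasure P] (hx : IsWSSWithPSD P x C)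
    (hs2 : ∀ i, MemLp (s i) 2 P) (hst : ∀ i, MemLp (st i) 2 P)
    (hmmse : ∀ i, P[s i | inputSigma x] =ᵐ[P] st i) (i : Fin N) (m : Fin M) (t : ℝ) :
    ∫ ω, (s i ω - st i ω) * x m t ω ∂P = 0 := by
  have hle : inputSigma x ≤ ‹MeasurableSpace Ω› := inputSigma_le hx.measurable
  have hxm : StronglyMeasurable[inputSigma x] (x m t) :=
    (measurable_inputSigma m t).stronglyMeasurable
  have hsx : Integrable (fun ω => s i ω * x m t ω) P :=
    integrable_mul_of_memLp (hs2 i) (hx.memLp m t)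
  have h1 := condExp_mul_of_stronglyMeasurable_right (m := inputSigma x) hxm hsx
    ((hs2 i).integrable one_le_two)
  have h2 : ∫ ω, s i ω * x m t ω ∂P = ∫ ω, st i ω * x m t ω ∂P := by
    rw [← integral_condExp hle]
    refine integral_congr_ae ?_
    filter_upwards [h1, hmmse i] with ω e1 e2
    rw [← e2]
    exact e1
  simp only [sub_mul]
  rw [integral_sub hsx (integrable_mul_of_memLp (hst i) (hx.memLp m t)), h2, sub_self]

/-- The residual `s - st` is orthogonal to filtered inputs, as a conditional expectation residual,
and to the noise, which is uncorrelated with both `s` and the inputs. The added constant does not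
involve the front end, so both criteria have the same minimizers. -/
theorem IsAdditiveModel.mse_eq [IsProbabilityMeasure P] (hx : IsWSSWithPSD P x C)
    (hs2 : ∀ i, MemLp (s i) 2 P) (hst : ∀ i, IsFilteredAt P x C (fun f => Γ f i) 0 (st i))
    (hmmse : ∀ i, P[s i | inputSigma x] =ᵐ[P] st i)
    (h : IsAdditiveModel P x C s fs σ2 H y e z) :
    mse P s z = (∫ ω, ∑ i, (s i ω - st i ω) ^ 2 ∂P) + mse P st z := by
  have hst2 := fun i => (hst i).1
  have hr : ∀ i, MemLp (fun ω => s i ω - st i ω) 2 P := fun i => (hs2 i).sub (hst2 i)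
  have hrx := integral_sub_condExp_mul_input hx hs2 hst2 hmmse
  refine mse_eq_add_mse hs2 hst2 (fun k n => h.memLp k n)
    (fun i => (hst i).integral_mul_eq_zero hx (hr i) (hrx i)) fun i k n => ?_
  have hes : ∫ ω, (s i ω - st i ω) * e k n ω ∂P = 0 := by
    have e1 : ∀ ω, (s i ω - st i ω) * e k n ω = e k n ω * s i ω - e k n ω * st i ω := fun ω => by
      ring
    simp only [e1]
    rw [integral_sub (integrable_mul_of_memLp (h.noise_memLp k n) (hs2 i))
      (integrable_mul_of_memLp (h.noise_memLp k n) (hst2 i)), h.noise_task,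
      (hst i).integral_mul_eq_zero hx (h.noise_memLp k n) (h.noise_input k n), sub_zero]
  simp only [h.output, mul_add]
  rw [integral_add (integrable_mul_of_memLp (hr i) (h.filtered k n).1)
    (integrable_mul_of_memLp (hr i) (h.noise_memLp k n)), hes,
    (h.filtered k n).integral_mul_eq_zero hx (hr i) (hrx i), add_zero]

/-- At `τ = ζ⁻¹` the upper bound for the optimal filter and the lower bound for an arbitrary one are
the same number. -/
theorem IsOptimalFactors.mse_le [IsProbabilityMeasure P] (hK : 0 < K) (hfs : 0 < fs) (hη : 0 < η)
    (hηb : 2 * η ^ 2 / (3 * 2 ^ (2 * b)) < 1) (hx : IsWSSWithPSD P x C)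
    (hband : ∀ f : ℝ, fs / 2 < |f| → C f = 0) (hs : ∀ i, Measurable (s i))
    (hs2 : ∀ i, MemLp (s i) 2 P) (hΓ : IsAnalogFilter C Γ)
    (hst : ∀ i, IsFilteredAt P x C (fun f => Γ f i) 0 (st i))
    (hmmse : ∀ i, P[s i | inputSigma x] =ᵐ[P] st i)
    (ho : IsOptimalFactors fs b η (gammaBar C Γ) ζ U V)
    (hc : ConjSymm (optFilter C Γ b ζ U V)) (hH : IsAnalogFilter C H)
    {zo : Fin K → ℤ → Ω → ℝ}
    (hzo : IsFrontEndOutput P x C s fs b η (optFilter C Γ b ζ U V) zo)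
    (hz : IsFrontEndOutput P x C s fs b η H z) :
    mse P s zo ≤ mse P s z ∧ mse P st zo ≤ mse P st z := by
  have hκ := kappaBar_pos hη hηb
  have hHo := ho.isAnalogFilter hK hx hband hΓ hc
  obtain ⟨σo, yo, eo, hσo, hσoe, hmo⟩ := hzo.exists_isAdditiveModel hK hηb hx hs hs2 hHo
  obtain ⟨σ, y, e, hσ, hσe, hm⟩ := hz.exists_isAdditiveModel hK hηb hx hs hs2 hH
  have hle : mse P st zo ≤ mse P st z :=
    (hmo.mse_optFilter_le hfs hK hκ hx hband hΓ hst ho hHo hσo hσoe).trans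
      (hm.lower_bound hfs hκ hx hband hΓ hst hH hσ hσe (inv_nonneg.2 ho.pos.le))
  refine ⟨?_, hle⟩
  rw [hmo.mse_eq hx hs2 hst hmmse, hm.mse_eq hx hs2 hst hmmse]
  linarith

end Optimality

/-! ### A unitary matrix with entries of constant modulus -/

section FourierMatrix

open Matrix

variable {K M N b : ℕ}

theorem conjMap_rectDiag (k n : ℕ) (d : ℕ → ℝ) : conjMap (rectDiag k n d) = rectDiag k n d := by
  ext i j
  simp only [Matrix.map_apply, rectDiag, of_apply]
  split_ifs <;> simp

/-- The unitary discrete Fourier transform matrix. -/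
noncomputable def fourierMatrix (K : ℕ) : Matrix (Fin K) (Fin K) ℂ :=
  of fun i j => (((√K)⁻¹ : ℝ) : ℂ) * Complex.exp (2 * Real.pi * Complex.I / K) ^ ((i : ℕ) * j)

theorem norm_exp_two_pi_div (K : ℕ) : ‖Complex.exp (2 * Real.pi * Complex.I / K)‖ = 1 := by
  have : (2 * Real.pi * Complex.I / K : ℂ) = ((2 * Real.pi / K : ℝ) : ℂ) * Complex.I := by
    push_cast
    ring
  rw [this, Complex.norm_exp_ofReal_mul_I]

theorem norm_fourierMatrix_sq (i j : Fin K) : ‖fourierMatrix K i j‖ ^ 2 = (K : ℝ)⁻¹ := by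
  rw [fourierMatrix, of_apply, norm_mul, norm_pow, norm_exp_two_pi_div, one_pow, mul_one,
    Complex.norm_real, Real.norm_eq_abs, sq_abs, inv_pow, Real.sq_sqrt (Nat.cast_nonneg K)]

theorem fourierMatrix_mem_unitaryGroup (hK : 0 < K) :
    fourierMatrix K ∈ unitaryGroup (Fin K) ℂ := by
  rw [mem_unitaryGroup_iff, star_eq_conjTranspose]
  set w := Complex.exp (2 * Real.pi * Complex.I / K) with hw
  have hprim : IsPrimitiveRoot w K := Complex.isPrimitiveRoot_exp K hK.ne'
  have hw0 : w ≠ 0 := Complex.exp_ne_zero _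
  have hconj : starRingEnd ℂ w = w⁻¹ := by
    rw [Complex.inv_def, Complex.normSq_eq_norm_sq, norm_exp_two_pi_div]
    simp
  ext i j
  by_cases hij : i = j
  · subst hij
    rw [mul_conjTranspose_self_apply_self, one_apply_eq]
    simp only [norm_fourierMatrix_sq]
    have : (K : ℝ) ≠ 0 := by exact_mod_cast hK.ne'
    simp [this]
  · rw [one_apply_ne hij, Matrix.mul_apply]
    have e : ∀ l : Fin K, fourierMatrix K i l * (fourierMatrix K)ᴴ l j =
        ((((√K)⁻¹ : ℝ) : ℂ) * (((√K)⁻¹ : ℝ) : ℂ)) * (w ^ (i : ℕ) * (w ^ (j : ℕ))⁻¹) ^ (l : ℕ) := by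
      intro l
      rw [conjTranspose_apply, fourierMatrix, of_apply, of_apply, Complex.star_def, map_mul, map_pow,
        Complex.conj_ofReal, ← hw, hconj, pow_mul, pow_mul, mul_pow, inv_pow, inv_pow]
      ring
    simp only [e]
    rw [← Finset.mul_sum, Fin.sum_univ_eq_sum_range (fun l =>
      (w ^ (i : ℕ) * (w ^ (j : ℕ))⁻¹) ^ l) K]
    set q := w ^ (i : ℕ) * (w ^ (j : ℕ))⁻¹ with hq
    have hqK : q ^ K = 1 := by
      rw [hq, mul_pow, inv_pow, ← pow_mul, ← pow_mul, mul_comm (i : ℕ), mul_comm (j : ℕ), pow_mul,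
        pow_mul, hprim.pow_eq_one]
      simp
    have hq1 : q - 1 ≠ 0 := by
      intro h
      have h1 : w ^ (i : ℕ) = w ^ (j : ℕ) := by
        have := sub_eq_zero.1 h
        rwa [hq, mul_inv_eq_one₀ (pow_ne_zero _ hw0)] at this
      exact hij (Fin.ext (hprim.pow_inj i.2 j.2 h1))
    have := mul_geom_sum q K
    rw [hqK, sub_self] at this
    rw [(mul_eq_zero.1 this).resolve_left hq1, mul_zero]

/-- The diagonal entries are squared row lengths of `U * rectDiag K M d`, and these weight the `d l
^ 2` by moduli that do not depend on the row. Hence one matrix balances the channels at all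
frequencies. -/
theorem diagonal_apply_eq_of_norm_eq {U : Matrix (Fin K) (Fin K) ℂ} {c : ℝ}
    (hU : ∀ i j, ‖U i j‖ ^ 2 = c) (d : ℕ → ℝ) (i j : Fin K) :
    (U * rectDiag K M d * (rectDiag K M d)ᴴ * Uᴴ) i i =
      (U * rectDiag K M d * (rectDiag K M d)ᴴ * Uᴴ) j j := by
  rw [Matrix.mul_assoc _ _ Uᴴ, ← conjTranspose_mul, mul_conjTranspose_self_apply_self,
    mul_conjTranspose_self_apply_self]
  have key : ∀ i l, ‖(U * rectDiag K M d) i l‖ ^ 2 = if (l : ℕ) < K then c * d l ^ 2 else 0 := by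
    intro i l
    rw [Matrix.mul_apply]
    split_ifs with hl
    · rw [Finset.sum_eq_single (⟨l, hl⟩ : Fin K)]
      · simp only [rectDiag, of_apply, if_true]
        rw [norm_mul, mul_pow, hU, Complex.norm_real, Real.norm_eq_abs, sq_abs]
      · intro p _ hp
        have : (p : ℕ) ≠ l := fun h => hp (Fin.ext h)
        simp [rectDiag, this]
      · simp
    · rw [Finset.sum_eq_zero, norm_zero, zero_pow two_ne_zero]
      intro p _
      have : (p : ℕ) ≠ l := fun h => hl (h ▸ p.2)
      simp [rectDiag, this]
  simp only [key]

end FourierMatrix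

/-! ### Existence of the optimal factors -/

section Existence

open Matrix

variable {Ω : Type*} [MeasurableSpace Ω] {P : Measure Ω} {M N K b : ℕ} {x : Fin M → ℝ → Ω → ℝ}
  {C : ℝ → Matrix (Fin M) (Fin M) ℂ} {fs η : ℝ} {Γ : ℝ → Matrix (Fin N) (Fin M) ℂ}

/-- Extends a function on positive frequencies to a conjugate symmetric one. -/
noncomputable def conjExtend {m n : ℕ} (V : ℝ → Matrix (Fin m) (Fin n) ℂ) (f : ℝ) :
    Matrix (Fin m) (Fin n) ℂ :=
  if 0 < f then V f else conjMap (V (-f))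

theorem conjExtend_neg {m n : ℕ} (V : ℝ → Matrix (Fin m) (Fin n) ℂ) {f : ℝ} (hf : f ≠ 0) :
    conjExtend V (-f) = conjMap (conjExtend V f) := by
  unfold conjExtend
  rcases lt_or_gt_of_ne hf with h | h
  · rw [if_pos (by linarith), if_neg (by linarith), conjMap_conjMap]
  · rw [if_neg (by linarith), if_pos h, neg_neg]

theorem MatrixAEMeasurable.conjExtend {m n : ℕ} {V : ℝ → Matrix (Fin m) (Fin n) ℂ}
    (hV : MatrixAEMeasurable V volume) : MatrixAEMeasurable (conjExtend V) volume := fun i j => by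
  have h1 : AEStronglyMeasurable (fun f => starRingEnd ℂ (V (-f) i j)) volume :=
    Complex.continuous_conj.comp_aestronglyMeasurable
      ((hV i j).comp_measurePreserving (Measure.measurePreserving_neg volume))
  have h2 : AEStronglyMeasurable ((Set.Ioi (0 : ℝ)).piecewise (fun f => V f i j)
      fun f => starRingEnd ℂ (V (-f) i j)) volume :=
    AEStronglyMeasurable.piecewise measurableSet_Ioi (hV i j).restrict h1.restrict
  refine h2.congr (ae_of_all _ fun f => ?_)
  by_cases hf : 0 < f
  · simp [TaskADC.conjExtend, hf]
  · simp [TaskADC.conjExtend, hf]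

/-- Singular vectors are not unique, so a measurable choice need not be conjugate symmetric. The
choice is kept on positive frequencies and conjugated onto negative ones, where it is still valid by
the symmetry of `A`; the frequency zero is negligible. -/
theorem exists_measurable_rightSingular {A : ℝ → Matrix (Fin N) (Fin M) ℂ}
    (hA : MatrixAEMeasurable A volume) (hc : ConjSymm A) :
    ∃ V : ℝ → Matrix (Fin M) (Fin M) ℂ, MatrixAEMeasurable V volume ∧
      (∀ᵐ f, IsRightSingularMatrix (A f) (V f)) ∧ ConjSymm V := by
  obtain ⟨W, hW, hWB⟩ := exists_measurable_diagonalization M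
  set V : ℝ → Matrix (Fin M) (Fin M) ℂ := fun f => of (W ((A f)ᴴ * A f)) with hV
  have hVm : MatrixAEMeasurable V volume := (hA.conjTranspose.mul hA).comp hW
  have hVr : ∀ f, IsRightSingularMatrix (A f) (V f) := by
    intro f
    obtain ⟨hU, hd⟩ := hWB ((A f)ᴴ * A f)
    obtain ⟨d, hda, hd⟩ := hd (isHermitian_conjTranspose_mul_self _)
    refine ⟨hU, ?_⟩
    simp only [eigenvalues_eq_of_diagonalization (A f) hU hda hd]
    exact hd
  refine ⟨conjExtend V, hVm.conjExtend, ?_, ?_⟩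
  · filter_upwards [hc] with f hf
    unfold conjExtend
    split_ifs
    · exact hVr f
    · have := (hVr (-f)).conjMap
      rwa [hf, conjMap_conjMap] at this
  · filter_upwards [Measure.ae_ne volume (0 : ℝ)] with f hf
    exact conjExtend_neg V hf

theorem abs_waterPower_sub_le (ζ ζ' σ : ℝ) :
    |waterPower ζ σ - waterPower ζ' σ| ≤ |ζ - ζ'| * |σ| := by
  unfold waterPower
  refine (abs_max_sub_max_le_abs _ _ _).trans (le_of_eq ?_)
  rw [← abs_mul]
  congr 1
  ring

/-- The intermediate value theorem in `ζ`: the total power is continuous, being a sum of Lipschitz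
functions, it vanishes at `ζ = 0`, and it is unbounded because the largest singular value has
positive integral. -/
theorem exists_waterLevel_integral_eq {A : ℝ → Matrix (Fin N) (Fin M) ℂ} {μ : Measure ℝ}
    [IsFiniteMeasure μ] (hA : MatrixAEMeasurable A μ) (hi : Integrable (fun f => frob (A f)) μ)
    (hK : 0 < K) (hM : 0 < M) (h0 : 0 < ∫ f, sval (A f) 0 ∂μ) {c : ℝ} (hc : 0 ≤ c) :
    ∃ ζ, ∫ f, ∑ i ∈ Finset.range (min K M), waterLevel b ζ (sval (A f) i) ^ 2 ∂μ = c := by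
  simp only [waterLevel_sq, ← Finset.mul_sum]
  simp only [integral_const_mul]
  have hwi := fun ζ i => integrable_waterPower hA hi ζ i
  have hsi := fun i => integrable_sval hA hi i
  set φ : ℝ → ℝ := fun ζ => ∫ f, ∑ i ∈ Finset.range (min K M), waterPower ζ (sval (A f) i) ∂μ
    with hφ
  have hφs : ∀ ζ, φ ζ = ∑ i ∈ Finset.range (min K M), ∫ f, waterPower ζ (sval (A f) i) ∂μ :=
    fun ζ => integral_finsetSum _ fun i _ => hwi ζ i
  have hcont : Continuous φ := by
    have : φ = fun ζ => ∑ i ∈ Finset.range (min K M), ∫ f, waterPower ζ (sval (A f) i) ∂μ :=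
      funext hφs
    rw [this]
    refine continuous_finsetSum _ fun i _ => ?_
    refine (LipschitzWith.of_dist_le_mul (K := Real.toNNReal (∫ f, sval (A f) i ∂μ))
      fun ζ ζ' => ?_).continuous
    rw [Real.dist_eq, Real.dist_eq, ← integral_sub (hwi ζ i) (hwi ζ' i),
      Real.coe_toNNReal _ (integral_nonneg fun f => sval_nonneg _ _), mul_comm,
      ← integral_const_mul]
    refine (abs_integral_le_integral_abs).trans (integral_mono ((hwi ζ i).sub (hwi ζ' i)).abs
      ((hsi i).const_mul _) fun f => ?_)
    refine (abs_waterPower_sub_le _ _ _).trans (le_of_eq ?_)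
    rw [abs_of_nonneg (sval_nonneg _ _)]
  have hφ0 : φ 0 = 0 := by simp [hφ, waterPower]
  set t := c * (2 ^ b) ^ 2 with ht
  have ht0 : 0 ≤ t := by positivity
  have hlow : ∀ ζ, ζ * (∫ f, sval (A f) 0 ∂μ) - μ.real Set.univ ≤ φ ζ := by
    intro ζ
    have e : ζ * (∫ f, sval (A f) 0 ∂μ) - μ.real Set.univ = ∫ f, (ζ * sval (A f) 0 - 1) ∂μ := by
      rw [integral_sub ((hsi 0).const_mul ζ) (integrable_const 1), integral_const_mul]
      simp
    rw [e]
    refine integral_mono (((hsi 0).const_mul ζ).sub (integrable_const 1))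
      (integrable_finsetSum _ fun i _ => hwi ζ i) fun f => ?_
    exact (le_max_left _ _).trans (Finset.single_le_sum
      (f := fun i => waterPower ζ (sval (A f) i)) (fun i _ => waterPower_nonneg _ _)
      (Finset.mem_range.2 (lt_min hK hM)))
  have hmem : t ∈ Set.range φ := by
    refine mem_range_of_exists_le_of_exists_ge hcont ⟨0, by rw [hφ0]; exact ht0⟩
      ⟨(t + μ.real Set.univ) / ∫ f, sval (A f) 0 ∂μ, ?_⟩
    refine le_trans (le_of_eq ?_) (hlow _)
    rw [div_mul_cancel₀ _ h0.ne']
    ring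
  obtain ⟨ζ, hζ⟩ := hmem
  refine ⟨ζ, ?_⟩
  have : ∫ f, ∑ i ∈ Finset.range (min K M), waterPower ζ (sval (A f) i) ∂μ = t := hζ
  rw [this, ht]
  field_simp

theorem eq_zero_of_frob_eq_zero {m n : ℕ} {A : Matrix (Fin m) (Fin n) ℂ} (h : frob A = 0) :
    A = 0 := by
  ext i j
  have h1 := (Finset.sum_eq_zero_iff_of_nonneg fun i _ =>
    Finset.sum_nonneg fun j _ => sq_nonneg ‖A i j‖).1 h i (Finset.mem_univ i)
  have h2 := (Finset.sum_eq_zero_iff_of_nonneg fun j _ => sq_nonneg ‖A i j‖).1 h1 j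
    (Finset.mem_univ j)
  simpa using h2

theorem eq_zero_of_sval_zero_eq_zero {m n : ℕ} {A : Matrix (Fin m) (Fin n) ℂ} (h : sval A 0 = 0) :
    A = 0 := by
  refine eq_zero_of_frob_eq_zero ?_
  rw [frob_eq_sum_sval_sq]
  refine Finset.sum_eq_zero fun j _ => ?_
  rw [le_antisymm ((sval_antitone A (Nat.zero_le j)).trans h.le) (sval_nonneg _ _),
    zero_pow two_ne_zero]

theorem exists_isOptimalFactors (hK : 0 < K) (hfs : 0 < fs) (hκ : 0 < kappaBar b η)
    (hx : IsWSSWithPSD P x C) (hband : ∀ f : ℝ, fs / 2 < |f| → C f = 0) (hΓ : IsAnalogFilter C Γ)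
    (hne : ¬ ∀ᵐ f : ℝ, gammaBar C Γ f = 0) :
    ∃ (ζ : ℝ) (U : ℝ → Matrix (Fin K) (Fin K) ℂ) (V : ℝ → Matrix (Fin M) (Fin M) ℂ),
      IsOptimalFactors fs b η (gammaBar C Γ) ζ U V ∧ ConjSymm (optFilter C Γ b ζ U V) := by
  obtain ⟨hAm', hAi'⟩ := integrable_gammaBar hx hΓ
  have hAm : MatrixAEMeasurable (gammaBar C Γ) (bandMeasure fs) := fun i j => (hAm' i j).restrict
  have hAi : Integrable (fun f => frob (gammaBar C Γ f)) (bandMeasure fs) := hAi'.restrict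
  have hAc : ConjSymm (gammaBar C Γ) := IsAnalogFilter.mul_sqrt_neg hx hΓ.conjSymm
  have hM : 0 < M := by
    rcases Nat.eq_zero_or_pos M with rfl | h
    · exact absurd (ae_of_all _ fun f => by ext i j; exact j.elim0) hne
    · exact h
  -- If this integral vanished, `gammaBar` would be zero almost everywhere on the band, and off the
  -- band it is zero because `C` is.
  have h0 : 0 < ∫ f, sval (gammaBar C Γ f) 0 ∂bandMeasure fs := by
    have hnn : 0 ≤ ∫ f, sval (gammaBar C Γ f) 0 ∂bandMeasure fs :=
      integral_nonneg fun f => sval_nonneg _ _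
    refine lt_of_le_of_ne hnn fun h => hne ?_
    have h1 := (integral_eq_zero_iff_of_nonneg (fun f => sval_nonneg (gammaBar C Γ f) 0)
      (integrable_sval hAm hAi 0)).1 h.symm
    refine ae_band_and_off (fs := fs) (h1.mono fun f hf => eq_zero_of_sval_zero_eq_zero hf)
      fun f hf => ?_
    rw [gammaBar, hband f hf, CFC.sqrt_zero, Matrix.mul_zero]
  obtain ⟨ζ, hζ⟩ := exists_waterLevel_integral_eq (b := b) (K := K) hAm hAi hK hM h0
    (c := K * fs / kappaBar b η) (by positivity)
  obtain ⟨V, hVm, hVr, hVc⟩ := exists_measurable_rightSingular hAm' hAc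
  -- The constant Fourier matrix already balances the channels; it is conjugated at negative
  -- frequencies only to make the filter real.
  set U : ℝ → Matrix (Fin K) (Fin K) ℂ := conjExtend fun _ => fourierMatrix K with hU
  have hUm : MatrixAEMeasurable U volume :=
    MatrixAEMeasurable.conjExtend fun i j => aestronglyMeasurable_const
  have hUn : ∀ f i j, ‖U f i j‖ ^ 2 = (K : ℝ)⁻¹ := by
    intro f i j
    rw [hU, conjExtend]
    split_ifs
    · exact norm_fourierMatrix_sq i j
    · exact (congrArg (· ^ 2) (RCLike.norm_conj _)).trans (norm_fourierMatrix_sq i j)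
  refine ⟨ζ, U, V, ⟨fun i j => (hUm i j).restrict, fun i j => (hVm i j).restrict,
    ae_restrict_of_ae hVr, ae_of_all _ fun f => ?_, ae_of_all _ fun f i j => ?_, ?_⟩, ?_⟩
  · rw [hU, conjExtend]
    split_ifs
    · exact fourierMatrix_mem_unitaryGroup hK
    · exact conjMap_mem_unitaryGroup (fourierMatrix_mem_unitaryGroup hK)
  · rw [sigmaH_eq_rectDiag]
    exact diagonal_apply_eq_of_norm_eq (hUn f) (fun i => waterLevel b ζ (sval (gammaBar C Γ f) i)) i j
  · rw [intervalIntegral_eq_bandMeasure hfs, hζ]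
    have : (K : ℝ) ≠ 0 := by exact_mod_cast hK.ne'
    field_simp
  · filter_upwards [Measure.ae_ne volume (0 : ℝ), hVc, hAc, hx.conjSymm] with f hf hV hA hC
    rw [optFilter, hV, hA, hC, hU, conjExtend_neg _ hf, sigmaH_eq_rectDiag]
    simp only [sval_conjMap]
    rw [← conjMap_rectDiag K M, sqrt_conjMap (hx.posSemidef f), pinv_conjMap,
      conjMap_conjTranspose, ← conjMap_mul, ← conjMap_mul, ← conjMap_mul]
    rfl

end Existence

end TaskADC

theorem corollary1 {Ω : Type*} [MeasurableSpace Ω] (P : Measure Ω) [IsProbabilityMeasure P]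
    (M N K b : ℕ) (fs η : ℝ) (hK : 0 < K) (hb : 1 ≤ b) (hfs : 0 < fs) (hη : 0 < η)
    (hηb : 2 * η ^ 2 / (3 * 2 ^ (2 * b)) < 1)
    -- jointly wide-sense stationary inputs with PSD matrix `C`, bandlimited to `fs / 2`
    (x : Fin M → ℝ → Ω → ℝ) (C : ℝ → Matrix (Fin M) (Fin M) ℂ)
    (hx : TaskADC.IsWSSWithPSD P x C)
    (hband : ∀ f : ℝ, fs / 2 < |f| → C f = 0)
    -- the task `s`, whose MMSE estimate `st` from the inputs is a linear filter `Γ` of them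
    (s st : Fin N → Ω → ℝ) (hs : ∀ i, Measurable (s i)) (hs2 : ∀ i, MemLp (s i) 2 P)
    (hs0 : ∀ i, ∫ ω, s i ω ∂P = 0)
    (Γ : ℝ → Matrix (Fin N) (Fin M) ℂ) (hΓ : TaskADC.IsAnalogFilter C Γ)
    (hst : ∀ i, TaskADC.IsFilteredAt P x C (fun f => Γ f i) 0 (st i))
    (hmmse : ∀ i, P[s i | TaskADC.inputSigma x] =ᵐ[P] st i) :
    -- factors as described exist, unless the MMSE estimate is degenerate
    ((¬ ∀ᵐ f : ℝ, TaskADC.gammaBar C Γ f = 0) →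
      ∃ (ζ : ℝ) (U : ℝ → Matrix (Fin K) (Fin K) ℂ) (V : ℝ → Matrix (Fin M) (Fin M) ℂ),
        TaskADC.IsOptimalFactors fs b η (TaskADC.gammaBar C Γ) ζ U V ∧
        TaskADC.ConjSymm (TaskADC.optFilter C Γ b ζ U V)) ∧
    -- and every choice of them gives an MSE-minimizing analog filter
    ∀ (ζ : ℝ) (U : ℝ → Matrix (Fin K) (Fin K) ℂ) (V : ℝ → Matrix (Fin M) (Fin M) ℂ),
      TaskADC.IsOptimalFactors fs b η (TaskADC.gammaBar C Γ) ζ U V →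
      TaskADC.ConjSymm (TaskADC.optFilter C Γ b ζ U V) →
      TaskADC.IsAnalogFilter C (TaskADC.optFilter C Γ b ζ U V) ∧
      ∀ (H : ℝ → Matrix (Fin K) (Fin M) ℂ) (zo z : Fin K → ℤ → Ω → ℝ),
        TaskADC.IsAnalogFilter C H →
        TaskADC.IsFrontEndOutput P x C s fs b η (TaskADC.optFilter C Γ b ζ U V) zo →
        TaskADC.IsFrontEndOutput P x C s fs b η H z →
        TaskADC.mse P s zo ≤ TaskADC.mse P s z ∧ TaskADC.mse P st zo ≤ TaskADC.mse P st z := by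
  refine ⟨TaskADC.exists_isOptimalFactors hK hfs (TaskADC.kappaBar_pos hη hηb) hx hband hΓ,
    fun ζ U V ho hc => ⟨ho.isAnalogFilter hK hx hband hΓ hc, fun H zo z hH hzo hz => ?_⟩⟩
  exact ho.mse_le hK hfs hη hηb hx hband hs hs2 hΓ hst hmmse hc hH hzo hz
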